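/- **Setting.** Let $Z$ be a real Hilbert space and let $A$ generate an exponentially stable analytic semigroup $e^{At}$ on $Z$, with compact resolvent. For $s\ge 0$ let $Z^{s}=\operatorname{ran}(-A)^{-s}$ with $\|\varphi\|_s=\|(-A)^s\varphi\|$, and let $Z^{-s}$ be the completion of $Z$ in the norm $\|(-A)^{-s}\varphi\|$. Let $s_b,s_c,s_d\in[0,1)$ with $s_c+s_b<1$ and $s_c+s_d<1$; let $B_{\rm in}\in Z^{-s_b}$, $B_{\rm d}\in Z^{-s_d}$ (one-dimensional input and disturbance), let $C:Z^{s_c}\to\mathbb R$ be bounded linear, and suppose $G=C(-A)^{-1}B_{\rm in}\ne0$. Let $f:Z\to Z$ satisfy $\|f(\varphi_1)-f(\varphi_2)\|\le\epsilon\|\varphi_1-\varphi_2\|_{s_1}$ for some $0<s_1<1$, $\epsilon>0$. Put $B=B_{\rm in}G^{-1}$, $I_0=I+BCA^{-1}$ and, for $0<\beta<1$, $A_\beta=A-\frac{1-\beta}{\beta}BC$, regarded as an operator in $Z^{-s}$, $s=\max\{s_b,s_d\}$, with domain $Z^{1-s}$. Suppose that $\beta$ is such that the semigroup $e^{A_\beta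 t}$ on $Z^{-s}$ generated by $A_\beta$ is exponentially stable. **Iteration.** Let $r,d:[0,\infty)\to\mathbb R$ be continuous, $\bar z_0\in Z$, $n\ge1$, and let $\bar z^0,\dots,\bar z^n\in C([0,\infty);Z^{s_1}\cap Z^{s_c})$ be mild solutions (variation of parameters) of $$\tfrac{d}{dt}\bar z^0=A_\beta\bar z^0+I_0\big(f(\bar z^0)+B_{\rm d}d\big)+\tfrac1\beta B r,\quad \bar z^0(0)=\bar z_0,\qquad e_0=r-C\bar z^0,$$ $$\tfrac{d}{dt}\bar z^j=A_\beta\bar z^j+I_0F_j+\tfrac1\beta B e_{j-1},\quad \bar z^j(0)=0,\qquad e_j=e_{j-1}-C\bar z^j\qquad(1\le j\le n),$$ where $F_j=f(\bar z_j)-f(\bar z_{j-1})$ and $\bar z_j=\sum_{i=0}^j\bar z^i$. **Constants.** Let $K(t)=-\frac1\beta CA_\beta^{-1}e^{A_\beta t}B$ and $$D=\int_0^\infty|K(t)|\,dt,\quad D_H=\int_0^\infty\|Ce^{A_\beta t}I_0\|_{\mathcal L(Z,\mathbb R)}\,dt,$$ and, for $0<T\le\infty$, $$D_B(T)=\int_0^T\big\|\tfrac1\beta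 e^{A_\beta t}B\big\|_{s_1}dt,\quad D_{A_\beta}(T)=\int_0^T\|e^{A_\beta t}I_0\|_{\mathcal L(Z,Z^{s_1})}\,dt,\quad \mathcal D(T)=D_H\,\frac{\epsilon D_B(T)}{1-\epsilon D_{A_\beta}(T)}$$ (values in $[0,\infty]$; $\mathcal D(T)$ is used only when $\epsilon D_{A_\beta}(T)<1$; products in $[0,\infty]$ use $0\cdot\infty=0$). Write $\|e\|_{(0,t)}=\sup_{0<\tau<t}|e(\tau)|$ and $\|e\|_{1,(0,t)}=\max\{\|e\|_{(0,t)},\|e'\|_{(0,t)}\}$. **Proposition.** $D$ and $D_H$ are finite, and: i) Let $t>0$, let $e_{n-1}$ be $C^1$ on $(0,t)$ and $\epsilon D_{A_\beta}(t)<1$. Then, with the transient $G_n(\tau)=K(\tau)e_{n-1}(0)$, $$\|e_n-G_n\|_{(0,t)}\le\big(D+\mathcal D(t)\big)\,\|e_{n-1}\|_{1,(0,t)} .$$ If the initial state satisfies $C\bar z_0=r(0)$, then $$\|e_n\|_{(0,t)}\le\big(D+\mathcal D(t)\big)\,\|e_{n-1}\|_{1,(0,t)} .$$ ii) If $e_{n-1}$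 is $C^1$ on $(0,\infty)$, $D_B(\infty)<\infty$ and $\epsilon D_{A_\beta}(\infty)<1$, then (for every admissible $\bar z_0$) $$\limsup_{t\to\infty}|e_n(t)|\le\big(D+\mathcal D(\infty)\big)\limsup_{t\to\infty}\max\{|e_{n-1}(t)|,|e_{n-1}'(t)|\}.$$ -/

import Mathlib

open MeasureTheory Set Filter Topology
open scoped ENNReal

noncomputable section

namespace GeomReg

/-! ### Strongly continuous semigroups and their generators -/

/-- A strongly continuous semigroup `(T t)_{t ≥ 0}` of bounded operators on a real Banach space.
The values at negative times carry no information. -/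
structure C0Semigroup (E : Type*) [NormedAddCommGroup E] [NormedSpace ℝ E] where
  op : ℝ → E →L[ℝ] E
  op_zero : op 0 = ContinuousLinearMap.id ℝ E
  op_add : ∀ s t : ℝ, 0 ≤ s → 0 ≤ t → op (s + t) = (op s).comp (op t)
  continuousOn : ∀ x : E, ContinuousOn (fun t => op t x) (Ici 0)

namespace C0Semigroup

variable {E : Type*} [NormedAddCommGroup E] [NormedSpace ℝ E]

/-- The graph of the infinitesimal generator: `(x, y)` belongs to it iff
`y = lim_{h ↓ 0} (T h x - x) / h`. -/
def generatorGraph (T : C0Semigroup E) : Set (E × E) :=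
  {p | Tendsto (fun h : ℝ => h⁻¹ • (T.op h p.1 - p.1)) (𝓝[>] 0) (𝓝 p.2)}

/-- `‖T t‖ ≤ M e^{-ω t}` for some `M ≥ 1`, `ω > 0` and all `t ≥ 0`. -/
def ExpStable (T : C0Semigroup E) : Prop :=
  ∃ M ω : ℝ, 1 ≤ M ∧ 0 < ω ∧ ∀ t : ℝ, 0 ≤ t → ‖T.op t‖ ≤ M * Real.exp (-ω * t)

/-- Analyticity of an (exponentially stable) semigroup with generator `A`, over the reals:
`T t` maps `E` into `D(A)` for `t > 0`, and `‖A T(t)‖ ≤ M / t`. -/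
def IsAnalytic (T : C0Semigroup E) : Prop :=
  ∃ M : ℝ, ∀ t : ℝ, 0 < t → ∀ x : E, ∃ y : E,
    (T.op t x, y) ∈ T.generatorGraph ∧ ‖y‖ ≤ M / t * ‖x‖

/-- The generator `A` has a compact resolvent: for some real `lam`, `R = (lam - A)⁻¹` exists as an
everywhere defined bounded operator and is compact. -/
def HasCompactResolvent (T : C0Semigroup E) : Prop :=
  ∃ (lam : ℝ) (R : E →L[ℝ] E), IsCompactOperator R ∧
    ∀ x y : E, y = R x ↔ (y, lam • y - x) ∈ T.generatorGraph

end C0Semigroup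

/-! ### Fractional powers and the scale of spaces generated by `A` -/

section Scale

variable {Z : Type*} [NormedAddCommGroup Z] [InnerProductSpace ℝ Z] [CompleteSpace Z]

/-- The negative fractional power `(-A)^{-s}`, `s ≥ 0`, of the generator `A` of `T`:
`(-A)^{-s} = Γ(s)⁻¹ ∫_0^∞ t^{s-1} e^{At} dt` for `s > 0`, and the identity for `s = 0`. -/
def negPow (T : C0Semigroup Z) (s : ℝ) : Z →L[ℝ] Z :=
  if s = 0 then ContinuousLinearMap.id ℝ Z
  else (Real.Gamma s)⁻¹ • ∫ t in Ioi (0 : ℝ), t ^ (s - 1) • T.op t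

/-- The space `Z^s = ran (-A)^{-s}`, `s ≥ 0`, as a subspace of `Z`. -/
def posSpace (T : C0Semigroup Z) (s : ℝ) : Submodule ℝ Z :=
  LinearMap.range (negPow T s : Z →ₗ[ℝ] Z)

/-- The norm `‖φ‖_s = ‖(-A)^s φ‖` for `φ ∈ Z^s`, with value `∞` off `Z^s`. -/
def posNorm (T : C0Semigroup Z) (s : ℝ) (φ : Z) : ℝ≥0∞ :=
  ⨅ (v : Z) (_ : negPow T s v = φ), ‖v‖ₑ

/-- `z : [0, ∞) → Z^s` is continuous for the norm of `Z^s`. -/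
def ContinuousInto (T : C0Semigroup Z) (s : ℝ) (z : ℝ → Z) : Prop :=
  ∃ v : ℝ → Z, ContinuousOn v (Ici 0) ∧ ∀ t : ℝ, 0 ≤ t → z t = negPow T s (v t)

/-- A copy of `Z`, to be given the norm `‖φ‖_{-s} = ‖(-A)^{-s} φ‖`. -/
@[nolint unusedArguments]
def PreNeg (_T : C0Semigroup Z) (_s : ℝ) : Type _ := Z

instance (T : C0Semigroup Z) (s : ℝ) : AddCommGroup (PreNeg T s) :=
  inferInstanceAs (AddCommGroup Z)

instance (T : C0Semigroup Z) (s : ℝ) : Module ℝ (PreNeg T s) :=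
  inferInstanceAs (Module ℝ Z)

/-- The identity map from `Z` to its copy. -/
def toPreNeg (T : C0Semigroup Z) (s : ℝ) : Z ≃ₗ[ℝ] PreNeg T s := LinearEquiv.refl ℝ Z

/-- `(-A)^{-s}` as a linear map out of the copy of `Z`. -/
def preNegMap (T : C0Semigroup Z) (s : ℝ) : PreNeg T s →ₗ[ℝ] Z :=
  (negPow T s : Z →ₗ[ℝ] Z) ∘ₗ ((toPreNeg T s).symm : PreNeg T s →ₗ[ℝ] Z)

instance (T : C0Semigroup Z) (s : ℝ) : SeminormedAddCommGroup (PreNeg T s) :=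
  SeminormedAddCommGroup.induced (PreNeg T s) Z (preNegMap T s)

instance (T : C0Semigroup Z) (s : ℝ) : NormedSpace ℝ (PreNeg T s) :=
  NormedSpace.induced ℝ (PreNeg T s) Z (preNegMap T s)

/-- The space `Z^{-s}`, `s ≥ 0`: the completion of `Z` in the norm `‖φ‖_{-s} = ‖(-A)^{-s} φ‖`. -/
abbrev NegSpace (T : C0Semigroup Z) (s : ℝ) : Type _ := UniformSpace.Completion (PreNeg T s)

/-- The inclusion `Z ⊆ Z^{-s}`. -/
def incl (T : C0Semigroup Z) (s : ℝ) (φ : Z) : NegSpace T s :=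
  (toPreNeg T s φ : UniformSpace.Completion (PreNeg T s))

/-- The inclusion `Z^{-s} ⊆ Z^{-s'}` for `s ≤ s'`: the continuous extension of the identity. -/
def inclNeg (T : C0Semigroup Z) (s s' : ℝ) : NegSpace T s → NegSpace T s' :=
  UniformSpace.Completion.map (fun φ : PreNeg T s => toPreNeg T s' ((toPreNeg T s).symm φ))

/-- The norm `‖x‖_σ`, `σ ≥ 0`, of an element `x` of `Z^{-s}`; it is `∞` if `x ∉ Z^σ`. -/
def posNormNeg (T : C0Semigroup Z) (s σ : ℝ) (x : NegSpace T s) : ℝ≥0∞ :=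
  ⨅ (φ : Z) (_ : incl T s φ = x), posNorm T σ φ

/-- The graph of the extension `A : Z^{1-s} → Z^{-s}`, as an unbounded operator in `Z^{-s}`:
the closure in `Z^{-s} × Z^{-s}` of the graph of `A : D(A) → Z`. -/
def extGraph (T : C0Semigroup Z) (s : ℝ) : Set (NegSpace T s × NegSpace T s) :=
  closure (Prod.map (incl T s) (incl T s) '' T.generatorGraph)

end Scale

open Classical in
/-- The inverse `L⁻¹ x` of an (injective) operator `L` given by its graph; `0` if `x ∉ ran L`. -/
def graphInv {X : Type*} [Zero X] (L : Set (X × X)) (x : X) : X :=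
  if h : ∃ y : X, (y, x) ∈ L then h.choose else 0

/-! ### The control system -/

/-- The data of the SISO control system `z' = A z + f(z) + B_in u + B_d d`, `y = C z`, where `A`
is the generator of `T`, together with the regularization parameter `β`.
As `U = D = Y = ℝ`, the operators `B_in : ℝ → Z^{-s_b}` and `B_d : ℝ → Z^{-s_d}` are
multiplications by the vectors `bIn` and `bD`. -/
structure Plant (Z : Type*) [NormedAddCommGroup Z] [InnerProductSpace ℝ Z] [CompleteSpace Z] where
  T : C0Semigroup Z
  sb : ℝ
  sd : ℝ
  sc : ℝ
  s1 : ℝ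
  bIn : NegSpace T sb
  bD : NegSpace T sd
  C : posSpace T sc →ₗ[ℝ] ℝ
  f : Z → Z
  ε : ℝ
  β : ℝ

namespace Plant

variable {Z : Type*} [NormedAddCommGroup Z] [InnerProductSpace ℝ Z] [CompleteSpace Z]

/-- The space `Z^{-s}`, `s = max (s_b, s_d)`, which contains `Z`, `Z^{-s_b}` and `Z^{-s_d}`. -/
abbrev X (P : Plant Z) : Type _ := NegSpace P.T (max P.sb P.sd)

/-- The inclusion `Z ⊆ X`. -/
def ι (P : Plant Z) (φ : Z) : P.X := incl P.T (max P.sb P.sd) φ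

/-- `B_in` as an element of `X`. -/
def bInX (P : Plant Z) : P.X := inclNeg P.T P.sb (max P.sb P.sd) P.bIn

/-- `B_d` as an element of `X`. -/
def bDX (P : Plant Z) : P.X := inclNeg P.T P.sd (max P.sb P.sd) P.bD

open Classical in
/-- `C x` for an element `x` of `X` that lies in `Z^{s_c}` (and `0` for all other `x`). -/
def out (P : Plant Z) (x : P.X) : ℝ :=
  if h : ∃ φ : posSpace P.T P.sc, P.ι (φ : Z) = x then P.C h.choose else 0

/-- `A⁻¹ : X → Z^{1-s}`. -/
def Ainv (P : Plant Z) (x : P.X) : P.X := graphInv (extGraph P.T (max P.sb P.sd)) x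

/-- The transfer function at zero, `G = C (-A)⁻¹ B_in`. -/
def gain (P : Plant Z) : ℝ := P.out (-P.Ainv P.bInX)

/-- `B = B_in G⁻¹`. -/
def B (P : Plant Z) : P.X := P.gain⁻¹ • P.bInX

/-- `ζ = (1 - β) / β`. -/
def ζ (P : Plant Z) : ℝ := (1 - P.β) / P.β

/-- The graph of `A_β = A - ζ B C : Z^{1-s} → Z^{-s}`, as an unbounded operator in `X`. -/
def AβGraph (P : Plant Z) : Set (P.X × P.X) :=
  {p | ∃ y : P.X, (p.1, y) ∈ extGraph P.T (max P.sb P.sd) ∧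
    p.2 = y - (P.ζ * P.out p.1) • P.B}

/-- `A_β⁻¹ : X → Z^{1-s}`. -/
def Aβinv (P : Plant Z) (x : P.X) : P.X := graphInv P.AβGraph x

/-- `I_0 = I + B C A⁻¹`. -/
def I0 (P : Plant Z) (x : P.X) : P.X := x + P.out (P.Ainv x) • P.B

/-- The assumptions on the control system. -/
structure Assumptions (P : Plant Z) : Prop where
  stable : P.T.ExpStable
  analytic : P.T.IsAnalytic
  compactResolvent : P.T.HasCompactResolvent
  sb_nonneg : 0 ≤ P.sb
  sd_nonneg : 0 ≤ P.sd
  sc_nonneg : 0 ≤ P.sc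
  sb_lt : P.sb < 1
  sd_lt : P.sd < 1
  sc_lt : P.sc < 1
  scb : P.sc + P.sb < 1
  scd : P.sc + P.sd < 1
  /-- `C` is bounded for the norm of `Z^{s_c}`. -/
  C_bounded : ∃ M : ℝ, ∀ v : Z,
    |P.C ⟨negPow P.T P.sc v, LinearMap.mem_range.2 ⟨v, rfl⟩⟩| ≤ M * ‖v‖
  gain_ne : P.gain ≠ 0
  s1_pos : 0 < P.s1
  s1_lt : P.s1 < 1
  ε_pos : 0 < P.ε
  f_lipschitz : ∀ φ₁ φ₂ : Z,
    ‖P.f φ₁ - P.f φ₂‖ₑ ≤ ENNReal.ofReal P.ε * posNorm P.T P.s1 (φ₁ - φ₂)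
  β_pos : 0 < P.β
  β_lt : P.β < 1

/-! ### The iteration -/

/-- `z_n = ∑_{j=0}^n z^j`. -/
def partialSum (z : ℕ → ℝ → Z) (n : ℕ) (t : ℝ) : Z := ∑ j ∈ Finset.range (n + 1), z j t

/-- The errors `e_0 = r - C z^0`, `e_j = e_{j-1} - C z^j`. -/
def err (P : Plant Z) (r : ℝ → ℝ) (z : ℕ → ℝ → Z) : ℕ → ℝ → ℝ
  | 0, t => r t - P.out (P.ι (z 0 t))
  | j + 1, t => P.err r z j t - P.out (P.ι (z (j + 1) t))

/-- `F_j = f(z_j) - f(z_{j-1})` for `j ≥ 1`. -/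
def Fterm (P : Plant Z) (z : ℕ → ℝ → Z) (j : ℕ) (t : ℝ) : Z :=
  P.f (partialSum z j t) - P.f (partialSum z (j - 1) t)

/-- `z : [0, ∞) → Z` is a mild solution of `z' = A_β z + g`, `z(0) = z₀`, which is continuous with
values in `Z^{s_1}` and in `Z^{s_c}`; here `S t = e^{A_β t}`. -/
structure IsMildSolution (P : Plant Z) (S : C0Semigroup P.X) (z₀ : Z) (g : ℝ → P.X)
    (z : ℝ → Z) : Prop where
  cont_s1 : ContinuousInto P.T P.s1 z
  cont_sc : ContinuousInto P.T P.sc z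
  formula : ∀ t : ℝ, 0 ≤ t →
    P.ι (z t) = S.op t (P.ι z₀) + ∫ τ in (0 : ℝ)..t, S.op (t - τ) (g τ)

/-- `z^0, …, z^n` are produced by the iterative scheme for the reference signal `r`, the
disturbance `d` and the initial state `z₀`:
`(z^0)' = A_β z^0 + I_0 (f(z^0) + B_d d) + β⁻¹ B r`, `z^0(0) = z₀`, and, for `1 ≤ j ≤ n`,
`(z^j)' = A_β z^j + I_0 F_j + β⁻¹ B e_{j-1}`, `z^j(0) = 0`. -/
structure IsIteration (P : Plant Z) (S : C0Semigroup P.X) (r d : ℝ → ℝ) (z₀ : Z) (n : ℕ)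
    (z : ℕ → ℝ → Z) : Prop where
  zero : P.IsMildSolution S z₀
    (fun τ => P.I0 (P.ι (P.f (z 0 τ)) + d τ • P.bDX) + (P.β⁻¹ * r τ) • P.B) (z 0)
  succ : ∀ j : ℕ, 1 ≤ j → j ≤ n → P.IsMildSolution S 0
    (fun τ => P.I0 (P.ι (P.Fterm z j τ)) + (P.β⁻¹ * P.err r z (j - 1) τ) • P.B) (z j)

/-! ### The kernels and the constants; throughout, `S t = e^{A_β t}` -/

/-- `K(t) = -β⁻¹ C A_β⁻¹ e^{A_β t} B`. -/
def K (P : Plant Z) (S : C0Semigroup P.X) (t : ℝ) : ℝ :=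
  -(P.β⁻¹ * P.out (P.Aβinv (S.op t P.B)))

/-- `D = ∫_0^∞ ‖K(t)‖ dt`. -/
def D (P : Plant Z) (S : C0Semigroup P.X) : ℝ≥0∞ :=
  ∫⁻ t in Ioi (0 : ℝ), ‖P.K S t‖ₑ

/-- `D_H = ∫_0^∞ ‖C e^{A_β t} I_0‖ dt`, with the norm of bounded functionals on `Z`. -/
def DH (P : Plant Z) (S : C0Semigroup P.X) : ℝ≥0∞ :=
  ∫⁻ t in Ioi (0 : ℝ), ⨆ (φ : Z) (_ : ‖φ‖ ≤ 1), ‖P.out (S.op t (P.I0 (P.ι φ)))‖ₑ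

/-- `D_B = ∫_J ‖β⁻¹ e^{A_β t} B‖ dt`, with the norm of `Z^{s_1}`; `J` is `(0,t)` or `(0,∞)`. -/
def DB (P : Plant Z) (S : C0Semigroup P.X) (J : Set ℝ) : ℝ≥0∞ :=
  ∫⁻ t in J, posNormNeg P.T (max P.sb P.sd) P.s1 (P.β⁻¹ • S.op t P.B)

/-- `D_{A_β} = ∫_J ‖e^{A_β t} I_0‖ dt`, with the norm of bounded operators from `Z` to `Z^{s_1}`;
`J` is `(0,t)` or `(0,∞)`. -/
def DA (P : Plant Z) (S : C0Semigroup P.X) (J : Set ℝ) : ℝ≥0∞ :=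
  ∫⁻ t in J, ⨆ (φ : Z) (_ : ‖φ‖ ≤ 1),
    posNormNeg P.T (max P.sb P.sd) P.s1 (S.op t (P.I0 (P.ι φ)))

/-- `𝒟 = D_H (D_B ε / (1 - ε D_{A_β}))`, meaningful when `ε D_{A_β} < 1`. -/
def DD (P : Plant Z) (S : C0Semigroup P.X) (J : Set ℝ) : ℝ≥0∞ :=
  P.DH S * (P.DB S J * ENNReal.ofReal P.ε / (1 - ENNReal.ofReal P.ε * P.DA S J))

end Plant

/-! ### Norms of scalar signals -/

/-- `‖e‖_{(0,t)} = sup_{0<τ<t} |e(τ)|`. -/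
def supNorm (t : ℝ) (e : ℝ → ℝ) : ℝ≥0∞ := ⨆ τ ∈ Ioo 0 t, ‖e τ‖ₑ

/-- `‖e‖_{1,(0,t)} = max (sup_{0<τ<t} |e(τ)|, sup_{0<τ<t} |e'(τ)|)`. -/
def supNormOne (t : ℝ) (e : ℝ → ℝ) : ℝ≥0∞ := max (supNorm t e) (supNorm t (deriv e))

end GeomReg

end

set_option linter.unusedSectionVars false

noncomputable section
namespace GeomReg

/-! ### The norm induced on the range of a bounded operator on a Hilbert space -/

section ImageNorm

variable {Z X : Type*} [NormedAddCommGroup Z] [InnerProductSpace ℝ Z] [CompleteSpace Z]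
  [NormedAddCommGroup X] [NormedSpace ℝ X]

/-! Write e for the error of the previous step, y for the new state and S(t) for the semigroup of
A_β. Applying C to the variation of parameters formula gives the new error as e minus the
convolution of β⁻¹CS(t)B with e, minus the convolution of CS(t)I_0 with the nonlinear increment F.
The normalisation of B means CA⁻¹B = -1, hence CA_β⁻¹ = βCA⁻¹ and K(t) = 1 - ∫₀ᵗ β⁻¹CS(τ)B dτ. So
K(0) = 1, and integration by parts (`error_integral_eq`) turns the linear part into K(t)e(0) plus
the convolution of K with e', which produces D.

The nonlinear part is handled by absorption. Since ‖F‖ ≤ ε‖y‖_{s_1}, Minkowski's inequality in the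
mild formula gives sup‖y‖_{s_1} ≤ εD_{A_β} sup‖y‖_{s_1} + D_B sup|e|. As εD_{A_β} < 1, this bounds
y, hence F, hence its output through D_H (`posNorm_le_of_bound`, `supNorm_error_le`). For the limit
superior the integration by parts starts at a late time, and everything earlier decays
(`limsup_error_le`).

The analytic core is that CS(t) is a bounded functional on Z^{-s} with integrable norm. The isometry
(-A)^{-s} moves the problem to Z, where C becomes bounded after composition with (-A)^{-α}, for some
α strictly between s_c + s and 1. Duhamel's formula, the smoothing bound ‖(-A)^α e^{At}‖ ≤ Mt^{-α}
and a singular Gronwall inequality then give S(t) = (-A)^{-α}W(t) with ‖W(t)‖ integrable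
(`IsPerturbation.exists_factor`, `exists_isOutput`).

The Z^{s_1} norm is used as an extended norm on Z^{-s}. Weak compactness of balls makes it attained
and lower semicontinuous; duality gives Minkowski's inequality (`imageNorm_integral_le`). -/

/-- The norm of the range of `J`: the infimum of `‖v‖` over the preimages `v` of `x`. -/
def imageNorm (J : Z →L[ℝ] X) (x : X) : ℝ≥0∞ := ⨅ (v : Z) (_ : J v = x), ‖v‖ₑ

lemma imageNorm_apply_le (J : Z →L[ℝ] X) (v : Z) : imageNorm J (J v) ≤ ‖v‖ₑ :=
  iInf_le_of_le v (iInf_le_of_le rfl le_rfl)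

/-- By Riesz and Banach–Alaoglu the ball is weakly compact. Its image in the product space of
functions on the dual of X is therefore compact, and the set in question is the preimage of that
image under evaluation. -/
lemma isClosed_image_closedBall (J : Z →L[ℝ] X) (M : ℝ) :
    IsClosed (J '' Metric.closedBall 0 M) := by
  -- For w = ⟨v, ·⟩ the value `Φ w l` is `l (J v)`.
  let Φ : WeakDual ℝ Z → (StrongDual ℝ X → ℝ) := fun w l =>
    w ((InnerProductSpace.toDual ℝ Z).symm (l.comp J))
  have hΦ : Continuous Φ := continuous_pi fun l => WeakDual.eval_continuous _
  have hc := ((WeakDual.isCompact_closedBall (0 : StrongDual ℝ Z) M).image hΦ).isClosed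
  have hev : Continuous (fun (x : X) (l : StrongDual ℝ X) => l x) :=
    continuous_pi fun l => l.continuous
  convert! hc.preimage hev using 1
  ext x
  constructor
  · rintro ⟨v, hv, rfl⟩
    refine ⟨StrongDual.toWeakDual (InnerProductSpace.toDual ℝ Z v), ?_, ?_⟩
    · simpa using hv
    · funext l
      change InnerProductSpace.toDual ℝ Z v ((InnerProductSpace.toDual ℝ Z).symm (l.comp J)) = _
      rw [InnerProductSpace.toDual_apply_apply, real_inner_comm,
        InnerProductSpace.toDual_symm_apply]
      rfl
  · rintro ⟨w, hw, hx⟩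
    refine ⟨(InnerProductSpace.toDual ℝ Z).symm (WeakDual.toStrongDual w), ?_, ?_⟩
    · simpa using hw
    · refine (SeparatingDual.eq_iff_forall_dual_eq (R := ℝ)).2 fun l => ?_
      have h1 := congrFun hx l
      change w _ = l x at h1
      rw [← h1]
      have h2 := InnerProductSpace.toDual_symm_apply (𝕜 := ℝ) (E := Z)
        (x := (InnerProductSpace.toDual ℝ Z).symm (WeakDual.toStrongDual w)) (y := l.comp J)
      have h3 := InnerProductSpace.toDual_symm_apply (𝕜 := ℝ) (E := Z)
        (x := (InnerProductSpace.toDual ℝ Z).symm (l.comp J)) (y := WeakDual.toStrongDual w)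
      rw [real_inner_comm, h3] at h2
      exact h2.symm

/-- The infimum is attained: near-minimisers, shrunk into the ball of radius M, have images
converging to x, and the image of the ball is closed. -/
lemma imageNorm_le_ofReal_iff (J : Z →L[ℝ] X) (x : X) {M : ℝ} (hM : 0 ≤ M) :
    imageNorm J x ≤ ENNReal.ofReal M ↔ ∃ v, J v = x ∧ ‖v‖ ≤ M := by
  constructor
  · intro h
    have key : ∀ k : ℕ, ∃ v, J v = x ∧ ‖v‖ ≤ M + 1 / (k + 1) := by
      intro k
      have hlt : imageNorm J x < ENNReal.ofReal (M + 1 / (k + 1)) :=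
        h.trans_lt ((ENNReal.ofReal_lt_ofReal_iff (by positivity)).2 (by
          have : (0 : ℝ) < 1 / (k + 1) := by positivity
          linarith))
      obtain ⟨v, hv, hlt⟩ := by simpa only [imageNorm, iInf_lt_iff] using hlt
      refine ⟨v, hv, ?_⟩
      rw [← ofReal_norm, ENNReal.ofReal_lt_ofReal_iff (by positivity)] at hlt
      exact hlt.le
    have hmem : x ∈ J '' Metric.closedBall 0 M := by
      refine (isClosed_image_closedBall J M).mem_of_tendsto
        (f := fun k : ℕ => (M / (M + 1 / ((k : ℝ) + 1))) • x) (b := atTop) ?_ ?_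
      -- For M = 0 the rescaled sequence is constantly 0, so x = 0 must be shown directly from
      -- preimages tending to 0.
      · rcases hM.eq_or_lt with rfl | hM
        · obtain ⟨v, hv, -⟩ := key 0
          have h0 : Tendsto (fun k : ℕ => 0 + 1 / ((k : ℝ) + 1)) atTop (𝓝 0) := by
            simpa using tendsto_one_div_add_atTop_nhds_zero_nat (𝕜 := ℝ)
          have : x = 0 := by
            choose w hw hw' using key
            have hw0 : Tendsto w atTop (𝓝 0) := squeeze_zero_norm hw' h0
            have := (J.continuous.tendsto 0).comp hw0
            rw [map_zero] at this
            refine tendsto_nhds_unique ?_ this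
            simp [Function.comp_def, hw]
          subst this
          simp
        · have h0 : Tendsto (fun k : ℕ => M + 1 / ((k : ℝ) + 1)) atTop (𝓝 M) := by
            simpa using tendsto_const_nhds.add (tendsto_one_div_add_atTop_nhds_zero_nat (𝕜 := ℝ))
          have h1 := (tendsto_const_nhds (x := M)).div h0 hM.ne'
          rw [div_self hM.ne'] at h1
          simpa using h1.smul_const x
      · refine Eventually.of_forall fun k => ?_
        obtain ⟨v, hv, hv'⟩ := key k
        have hpos : 0 < M + 1 / ((k : ℝ) + 1) := by positivity
        refine ⟨(M / (M + 1 / ((k : ℝ) + 1))) • v, ?_, by simp [hv]⟩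
        rw [mem_closedBall_zero_iff, norm_smul, Real.norm_of_nonneg (by positivity)]
        calc _ ≤ M / (M + 1 / ((k : ℝ) + 1)) * (M + 1 / (k + 1)) := by gcongr
          _ = M := by field_simp
    obtain ⟨v, hv, rfl⟩ := hmem
    exact ⟨v, rfl, by simpa using hv⟩
  · rintro ⟨v, rfl, hv⟩
    refine (imageNorm_apply_le J v).trans ?_
    rw [← ofReal_norm]
    exact ENNReal.ofReal_le_ofReal hv

lemma exists_of_imageNorm_ne_top {J : Z →L[ℝ] X} {x : X} (h : imageNorm J x ≠ ∞) :
    ∃ v, J v = x ∧ ‖v‖ₑ = imageNorm J x := by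
  obtain ⟨v, hv, hle⟩ := (imageNorm_le_ofReal_iff J x (ENNReal.toReal_nonneg
    (a := imageNorm J x))).1 (by rw [ENNReal.ofReal_toReal h])
  refine ⟨v, hv, le_antisymm ?_ (hv ▸ imageNorm_apply_le J v)⟩
  rw [← ENNReal.ofReal_toReal h, ← ofReal_norm]
  exact ENNReal.ofReal_le_ofReal hle

/-- Sublevel sets are images of closed balls. This supplies Borel measurability of the stronger norm
along trajectories in X. -/
lemma lowerSemicontinuous_imageNorm (J : Z →L[ℝ] X) : LowerSemicontinuous (imageNorm J) := by
  rw [lowerSemicontinuous_iff_isClosed_preimage]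
  intro y
  induction y using ENNReal.recTopCoe with
  | top => simp
  | coe m =>
    convert! isClosed_image_closedBall J m using 1
    ext x
    rw [mem_preimage, mem_Iic, ← ENNReal.ofReal_coe_nnreal]
    refine (imageNorm_le_ofReal_iff J x m.2).trans ?_
    constructor
    · rintro ⟨v, rfl, hv⟩; exact ⟨v, by simpa using hv, rfl⟩
    · rintro ⟨v, hv, rfl⟩; exact ⟨v, rfl, by simpa using hv⟩

lemma imageNorm_zero (J : Z →L[ℝ] X) : imageNorm J 0 = 0 := by
  simpa using imageNorm_apply_le J 0

lemma imageNorm_add_le (J : Z →L[ℝ] X) (x y : X) :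
    imageNorm J (x + y) ≤ imageNorm J x + imageNorm J y := by
  by_cases hx : imageNorm J x = ∞
  · simp [hx]
  by_cases hy : imageNorm J y = ∞
  · simp [hy]
  obtain ⟨v, rfl, hv⟩ := exists_of_imageNorm_ne_top hx
  obtain ⟨w, rfl, hw⟩ := exists_of_imageNorm_ne_top hy
  rw [← hv, ← hw, ← map_add]
  exact (imageNorm_apply_le J _).trans (enorm_add_le v w)

lemma imageNorm_smul_le (J : Z →L[ℝ] X) (c : ℝ) (x : X) :
    imageNorm J (c • x) ≤ ‖c‖ₑ * imageNorm J x := by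
  rcases eq_or_ne c 0 with rfl | hc
  · simp [imageNorm_zero]
  by_cases hx : imageNorm J x = ∞
  · simp [hx, hc]
  obtain ⟨v, rfl, hv⟩ := exists_of_imageNorm_ne_top hx
  rw [← hv, ← map_smul, ← enorm_smul]
  exact imageNorm_apply_le J _

/-- Hahn–Banach: a point outside the closed convex set J(ball M) is strictly separated from it by
some l, and the supremum of l on that set is M‖l ∘ J‖. -/
lemma imageNorm_le_of_forall_dual {J : Z →L[ℝ] X} {x : X} {M : ℝ} (hM : 0 ≤ M)
    (h : ∀ l : StrongDual ℝ X, l x ≤ M * ‖l.comp J‖) : imageNorm J x ≤ ENNReal.ofReal M := by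
  rw [imageNorm_le_ofReal_iff J x hM]
  by_contra hx
  have hx' : x ∉ J '' Metric.closedBall 0 M := by
    rintro ⟨v, hv, rfl⟩
    exact hx ⟨v, rfl, by simpa using hv⟩
  have hconv : Convex ℝ (J '' Metric.closedBall 0 M) :=
    (convex_closedBall 0 M).is_linear_image J.isLinear
  obtain ⟨l, u, hl, hu⟩ := geometric_hahn_banach_closed_point hconv
    (isClosed_image_closedBall J M) hx'
  let w := (InnerProductSpace.toDual ℝ Z).symm (l.comp J)
  have hw : ‖w‖ = ‖l.comp J‖ := LinearIsometryEquiv.norm_map _ _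
  have hlw : ∀ v, l (J v) = inner ℝ w v := fun v =>
    (InnerProductSpace.toDual_symm_apply (𝕜 := ℝ) (x := v) (y := l.comp J)).symm
  have h1 : M * ‖l.comp J‖ < u := by
    rcases eq_or_ne w 0 with h0 | h0
    · have := hl (J 0) ⟨0, by simpa using hM, rfl⟩
      rw [← hw, h0]
      simpa using this
    · have hn : ‖w‖ ≠ 0 := norm_ne_zero_iff.2 h0
      -- This multiple of the Riesz vector maximises l ∘ J on the ball.
      have := hl (J ((M / ‖w‖) • w)) ⟨_, by
        rw [mem_closedBall_zero_iff, norm_smul, Real.norm_of_nonneg (by positivity),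
          div_mul_cancel₀ _ hn], rfl⟩
      rw [hlw, inner_smul_right, real_inner_self_eq_norm_sq] at this
      rw [← hw]
      calc _ = M / ‖w‖ * ‖w‖ ^ 2 := by field_simp
        _ < u := this
  linarith [h l]

/-- Minkowski's inequality for a Bochner integral taken only in the weaker space X: test with
functionals l on X, using |l x| ≤ ‖l ∘ J‖ times the image norm. A non-integrable g has integral 0 by
convention, so it needs no hypothesis. -/
lemma imageNorm_integral_le {α : Type*} [MeasurableSpace α] {μ : Measure α} [CompleteSpace X]
    (J : Z →L[ℝ] X) (g : α → X) : imageNorm J (∫ a, g a ∂μ) ≤ ∫⁻ a, imageNorm J (g a) ∂μ := by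
  borelize X
  by_cases hg : Integrable g μ
  swap
  · rw [integral_undef hg, imageNorm_zero]; exact zero_le
  by_cases hI : ∫⁻ a, imageNorm J (g a) ∂μ = ∞
  · simp [hI]
  rw [← ENNReal.ofReal_toReal hI]
  refine imageNorm_le_of_forall_dual ENNReal.toReal_nonneg fun l => ?_
  have hpt : ∀ x, ‖l x‖ₑ ≤ ‖l.comp J‖ₑ * imageNorm J x ∨ imageNorm J x = ∞ := by
    intro x
    by_cases hx : imageNorm J x = ∞
    · exact Or.inr hx
    obtain ⟨v, rfl, hv⟩ := exists_of_imageNorm_ne_top hx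
    refine Or.inl ?_
    rw [← hv]
    exact (l.comp J).le_opENorm v
  have hmeas : AEMeasurable (fun a => imageNorm J (g a)) μ :=
    (lowerSemicontinuous_imageNorm J).measurable.comp_aemeasurable
      hg.aestronglyMeasurable.aemeasurable
  have hfin : ∀ᵐ a ∂μ, imageNorm J (g a) < ∞ := ae_lt_top' hmeas hI
  have h1 : ‖∫ a, l (g a) ∂μ‖ₑ ≤ ‖l.comp J‖ₑ * ∫⁻ a, imageNorm J (g a) ∂μ := by
    refine (enorm_integral_le_lintegral_enorm _).trans ?_
    rw [← lintegral_const_mul' _ _ enorm_ne_top]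
    refine lintegral_mono_ae ?_
    filter_upwards [hfin] with a ha
    exact (hpt (g a)).resolve_right ha.ne
  rw [l.integral_comp_comm hg] at h1
  have h2 := ENNReal.toReal_mono (ENNReal.mul_ne_top enorm_ne_top hI) h1
  rw [ENNReal.toReal_mul, toReal_enorm, toReal_enorm] at h2
  linarith [le_abs_self (l (∫ a, g a ∂μ)), Real.norm_eq_abs (l (∫ a, g a ∂μ)),
    mul_comm ‖l.comp J‖ (∫⁻ a, imageNorm J (g a) ∂μ).toReal]

end ImageNorm

/-! ### Strongly continuous semigroups -/

namespace C0Semigroup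

variable {E : Type*} [NormedAddCommGroup E] [NormedSpace ℝ E] {T : C0Semigroup E}

lemma op_add_apply (T : C0Semigroup E) {s t : ℝ} (hs : 0 ≤ s) (ht : 0 ≤ t) (x : E) :
    T.op (s + t) x = T.op s (T.op t x) := by
  rw [T.op_add s t hs ht]; rfl

lemma op_zero_apply (T : C0Semigroup E) (x : E) : T.op 0 x = x := by rw [T.op_zero]; rfl

lemma op_comm_apply (T : C0Semigroup E) {s t : ℝ} (hs : 0 ≤ s) (ht : 0 ≤ t) (x : E) :
    T.op s (T.op t x) = T.op t (T.op s x) := by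
  rw [← T.op_add_apply hs ht, ← T.op_add_apply ht hs, add_comm]

lemma ExpStable.exists_bound (hT : T.ExpStable) :
    ∃ M : ℝ, 0 < M ∧ ∀ t : ℝ, 0 ≤ t → ‖T.op t‖ ≤ M := by
  obtain ⟨M, ω, hM, hω, h⟩ := hT
  refine ⟨M, by linarith, fun t ht => (h t ht).trans ?_⟩
  have : Real.exp (-ω * t) ≤ 1 := Real.exp_le_one_iff.2 (by nlinarith)
  nlinarith

lemma ExpStable.continuousOn_op_comp {α : Type*} [TopologicalSpace α] (hT : T.ExpStable)
    {s : Set α} {a : α → ℝ} {g : α → E} (ha : ContinuousOn a s) (ha0 : ∀ x ∈ s, 0 ≤ a x)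
    (hg : ContinuousOn g s) : ContinuousOn (fun x => T.op (a x) (g x)) s := by
  obtain ⟨M, hM, hb⟩ := hT.exists_bound
  intro x hx
  have h1 : Tendsto (fun y => T.op (a y) (g x)) (𝓝[s] x) (𝓝 (T.op (a x) (g x))) :=
    ((T.continuousOn (g x)).comp ha ha0) x hx
  have h2 : Tendsto (fun y => T.op (a y) (g y - g x)) (𝓝[s] x) (𝓝 0) := by
    have h3 : Tendsto (fun y => M * ‖g y - g x‖) (𝓝[s] x) (𝓝 0) := by
      have := ((hg x hx).sub_const (g x)).norm.const_mul M
      simpa using this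
    refine squeeze_zero_norm' ?_ h3
    filter_upwards [self_mem_nhdsWithin] with y hy
    exact ((T.op (a y)).le_opNorm _).trans
      (mul_le_mul_of_nonneg_right (hb _ (ha0 y hy)) (norm_nonneg _))
  have := h1.add h2
  rw [add_zero] at this
  refine this.congr fun y => ?_
  rw [← map_add]; congr 1; abel

lemma generatorGraph_unique {x y y' : E} (h : (x, y) ∈ T.generatorGraph)
    (h' : (x, y') ∈ T.generatorGraph) : y = y' :=
  tendsto_nhds_unique h h'

lemma generatorGraph_add {x y x' y' : E} (h : (x, y) ∈ T.generatorGraph)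
    (h' : (x', y') ∈ T.generatorGraph) : (x + x', y + y') ∈ T.generatorGraph := by
  have := Tendsto.add h h'
  refine this.congr fun t => ?_
  simp only [map_add, ← smul_add]
  congr 1; abel

lemma generatorGraph_smul {x y : E} (c : ℝ) (h : (x, y) ∈ T.generatorGraph) :
    (c • x, c • y) ∈ T.generatorGraph := by
  have := Tendsto.const_smul h c
  refine this.congr fun t => ?_
  simp only [map_smul, ← smul_sub]
  rw [smul_comm]

lemma op_mem_generatorGraph {x y : E} (h : (x, y) ∈ T.generatorGraph) {t : ℝ} (ht : 0 ≤ t) :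
    (T.op t x, T.op t y) ∈ T.generatorGraph := by
  have := ((T.op t).continuous.tendsto y).comp h
  refine this.congr' ?_
  filter_upwards [self_mem_nhdsWithin] with r hr
  simp only [Function.comp, map_smul, map_sub]
  rw [T.op_comm_apply (le_of_lt hr) ht]

lemma continuousOn_op_Icc (T : C0Semigroup E) (x : E) {a b : ℝ} (ha : 0 ≤ a) :
    ContinuousOn (fun τ => T.op τ x) (Icc a b) :=
  (T.continuousOn x).mono fun _ hτ => ha.trans hτ.1

lemma intervalIntegrable_op (T : C0Semigroup E) (x : E) {a b : ℝ} (ha : 0 ≤ a) (hb : 0 ≤ b) :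
    IntervalIntegrable (fun τ => T.op τ x) volume a b :=
  ((T.continuousOn x).mono fun _ hτ => (le_min ha hb).trans hτ.1).intervalIntegrable

variable [CompleteSpace E]

/-- The generator is a one-sided limit, so only the right derivative of the orbit is available; with
continuity this suffices for the fundamental theorem. Two-sided differentiability is then read off
the integral. -/
lemma op_sub_eq_integral {x y : E} (h : (x, y) ∈ T.generatorGraph) {a b : ℝ} (ha : 0 ≤ a)
    (hab : a ≤ b) : T.op b x - T.op a x = ∫ τ in a..b, T.op τ y := by
  refine (intervalIntegral.integral_eq_sub_of_hasDeriv_right_of_le hab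
    (T.continuousOn_op_Icc x ha) (fun t ht => ?_)
    (T.intervalIntegrable_op y ha (ha.trans hab))).symm
  have ht0 : 0 ≤ t := ha.trans ht.1.le
  rw [hasDerivWithinAt_iff_tendsto_slope' (by simp)]
  have h1 : Tendsto (fun u : ℝ => u - t) (𝓝[>] t) (𝓝[>] 0) := by
    refine tendsto_nhdsWithin_iff.2 ⟨?_, ?_⟩
    · have : Tendsto (fun u : ℝ => u - t) (𝓝 t) (𝓝 (t - t)) :=
        (continuous_id.sub continuous_const).tendsto t
      rw [sub_self] at this
      exact this.mono_left nhdsWithin_le_nhds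
    · filter_upwards [self_mem_nhdsWithin] with u hu
      exact mem_Ioi.2 (sub_pos.2 (mem_Ioi.1 hu))
  refine Tendsto.congr' ?_ (Tendsto.comp (op_mem_generatorGraph h ht0) h1)
  filter_upwards [self_mem_nhdsWithin] with u hu
  simp only [Function.comp, slope, vsub_eq_sub]
  rw [← T.op_add_apply (sub_nonneg.2 (le_of_lt hu)) ht0]
  simp

lemma hasDerivAt_op {x y : E} (h : (x, y) ∈ T.generatorGraph) {t : ℝ} (ht : 0 < t) :
    HasDerivAt (fun τ => T.op τ x) (T.op t y) t := by
  have hcont : ContinuousAt (fun τ => T.op τ y) t :=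
    (T.continuousOn y).continuousAt (Ici_mem_nhds ht)
  have hmeas : StronglyMeasurableAtFilter (fun τ => T.op τ y) (𝓝 t) volume :=
    ((T.continuousOn y).mono Ioi_subset_Ici_self).stronglyMeasurableAtFilter isOpen_Ioi t ht
  have h1 := (intervalIntegral.integral_hasDerivAt_right
    (T.intervalIntegrable_op y le_rfl ht.le) hmeas hcont).add_const x
  refine h1.congr_of_eventuallyEq ?_
  filter_upwards [Ioi_mem_nhds ht] with τ hτ
  rw [← op_sub_eq_integral h le_rfl (le_of_lt hτ), T.op_zero_apply]
  abel

lemma tendsto_average (T : C0Semigroup E) (x : E) {a : ℝ} (ha : 0 ≤ a) :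
    Tendsto (fun h : ℝ => h⁻¹ • ∫ τ in a..(a + h), T.op τ x) (𝓝[>] 0) (𝓝 (T.op a x)) := by
  have hmeas : StronglyMeasurableAtFilter (fun τ => T.op τ x) (𝓝[>] a) volume :=
    ⟨Ioi a, self_mem_nhdsWithin, ((T.continuousOn x).mono
      fun _ hτ => ha.trans (le_of_lt hτ)).aestronglyMeasurable measurableSet_Ioi⟩
  have hcont : ContinuousWithinAt (fun τ => T.op τ x) (Ioi a) a :=
    ((T.continuousOn x) a ha).mono fun _ hτ => ha.trans (le_of_lt hτ)
  have h1 := intervalIntegral.integral_hasDerivWithinAt_right (s := Ici a) (t := Ioi a)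
    (T.intervalIntegrable_op x ha ha) hmeas hcont
  have h2 : HasDerivWithinAt (fun u => ∫ τ in a..u, T.op τ x) (T.op a x) (Ioi a) a :=
    h1.mono Ioi_subset_Ici_self
  rw [hasDerivWithinAt_iff_tendsto_slope' (by simp)] at h2
  have h3 : Tendsto (fun h : ℝ => a + h) (𝓝[>] 0) (𝓝[>] a) := by
    refine tendsto_nhdsWithin_iff.2 ⟨?_, ?_⟩
    · have : Tendsto (fun u : ℝ => a + u) (𝓝 0) (𝓝 (a + 0)) :=
        (continuous_const.add continuous_id).tendsto 0
      rw [add_zero] at this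
      exact this.mono_left nhdsWithin_le_nhds
    · filter_upwards [self_mem_nhdsWithin] with u hu
      exact lt_add_of_pos_right a hu
  refine (h2.comp h3).congr fun h => ?_
  simp [slope]

lemma op_integral_eq (T : C0Semigroup E) (x : E) {h t : ℝ} (hh : 0 ≤ h) (ht : 0 ≤ t) :
    T.op h (∫ τ in (0 : ℝ)..t, T.op τ x) = ∫ τ in h..(h + t), T.op τ x := by
  rw [← (T.op h).intervalIntegral_comp_comm (T.intervalIntegrable_op x le_rfl ht)]
  have h1 := intervalIntegral.integral_comp_add_left (fun τ => T.op τ x) h (a := 0) (b := t)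
  rw [add_zero] at h1
  rw [← h1]
  refine intervalIntegral.integral_congr fun τ hτ => ?_
  rw [uIcc_of_le ht] at hτ
  exact (T.op_add_apply hh hτ.1 x).symm

/-- Shifting the integral by h leaves only the averages over [t, t+h] and [0, h]. -/
lemma integral_mem_generatorGraph (T : C0Semigroup E) (x : E) {t : ℝ} (ht : 0 ≤ t) :
    (∫ τ in (0 : ℝ)..t, T.op τ x, T.op t x - x) ∈ T.generatorGraph := by
  have h1 := T.tendsto_average x ht
  have h2 := T.tendsto_average x le_rfl
  rw [T.op_zero_apply] at h2
  refine (h1.sub h2).congr' ?_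
  filter_upwards [self_mem_nhdsWithin] with h hh
  have hh' : 0 ≤ h := le_of_lt hh
  have hi : ∀ a b : ℝ, 0 ≤ a → 0 ≤ b → IntervalIntegrable (fun τ => T.op τ x) volume a b :=
    fun a b ha hb => T.intervalIntegrable_op x ha hb
  rw [T.op_integral_eq x hh' ht, ← smul_sub, zero_add]
  congr 1
  rw [← intervalIntegral.integral_add_adjacent_intervals (hi h t hh' ht)
      (hi t (h + t) ht (by positivity)),
    ← intervalIntegral.integral_add_adjacent_intervals (hi 0 h le_rfl hh') (hi h t hh' ht),
    add_comm h t]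
  abel

lemma dense_domain (T : C0Semigroup E) : Dense {x : E | ∃ y, (x, y) ∈ T.generatorGraph} := by
  intro x
  have h2 := T.tendsto_average x le_rfl
  rw [T.op_zero_apply] at h2
  refine mem_closure_of_tendsto h2 ?_
  filter_upwards [self_mem_nhdsWithin] with h hh
  rw [zero_add]
  exact ⟨_, generatorGraph_smul _ (T.integral_mem_generatorGraph x (le_of_lt hh))⟩

end C0Semigroup

/-! ### Analytic semigroups -/

namespace C0Semigroup

variable {E : Type*} [NormedAddCommGroup E] [NormedSpace ℝ E] {T : C0Semigroup E}

/-- The operators `A T(t)`, `t > 0`, of an analytic semigroup. -/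
lemma IsAnalytic.exists_generator_op (hA : T.IsAnalytic) :
    ∃ (M : ℝ) (D : ℝ → E →L[ℝ] E), 0 < M ∧ ∀ t : ℝ, 0 < t →
      (∀ x, (T.op t x, D t x) ∈ T.generatorGraph) ∧ ‖D t‖ ≤ M / t := by
  obtain ⟨M, hM⟩ := hA
  have key : ∀ t : ℝ, ∃ D : E →L[ℝ] E, 0 < t →
      (∀ x, (T.op t x, D x) ∈ T.generatorGraph) ∧ ‖D‖ ≤ (|M| + 1) / t := by
    intro t
    by_cases ht : 0 < t
    swap
    · exact ⟨0, fun h => absurd h ht⟩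
    choose y hy hb using hM t ht
    have hle : M / t ≤ (|M| + 1) / t := by
      gcongr
      linarith [le_abs_self M]
    let L : E →ₗ[ℝ] E :=
      { toFun := y
        map_add' := fun a b => generatorGraph_unique (hy (a + b)) (by
          rw [map_add]; exact generatorGraph_add (hy a) (hy b))
        map_smul' := fun c a => generatorGraph_unique (hy (c • a)) (by
          rw [map_smul]; exact generatorGraph_smul c (hy a)) }
    refine ⟨L.mkContinuous ((|M| + 1) / t) fun x => (hb x).trans ?_, fun _ => ⟨hy, ?_⟩⟩
    · exact mul_le_mul_of_nonneg_right hle (norm_nonneg _)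
    · exact L.mkContinuous_norm_le (by positivity) _
  choose D hD using key
  exact ⟨|M| + 1, D, by positivity, hD⟩

variable [CompleteSpace E]

/-- T(b) - T(a) is the integral of T(τ)AT(t₀) over [a - t₀, b - t₀], and AT(t₀) is bounded; hence T
is Lipschitz in operator norm on [t₀, ∞). -/
lemma continuousOn_op_norm (hT : T.ExpStable) (hA : T.IsAnalytic) :
    ContinuousOn T.op (Ioi 0) := by
  obtain ⟨M, hM, hb⟩ := hT.exists_bound
  obtain ⟨_, D, -, hD⟩ := hA.exists_generator_op
  have key : ∀ t₀ a b : ℝ, 0 < t₀ → t₀ ≤ a → a ≤ b →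
      ‖T.op b - T.op a‖ ≤ M * ‖D t₀‖ * (b - a) := by
    intro t₀ a b ht₀ ha hab
    refine ContinuousLinearMap.opNorm_le_bound _
      (mul_nonneg (by positivity) (sub_nonneg.2 hab)) fun x => ?_
    have h1 := op_sub_eq_integral ((hD t₀ ht₀).1 x) (sub_nonneg.2 ha) (sub_le_sub_right hab t₀)
    rw [← T.op_add_apply (by linarith) ht₀.le, ← T.op_add_apply (by linarith) ht₀.le,
      sub_add_cancel, sub_add_cancel] at h1
    rw [sub_apply, h1]
    refine (intervalIntegral.norm_integral_le_of_norm_le_const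
      (C := M * (‖D t₀‖ * ‖x‖)) fun τ hτ => ?_).trans_eq ?_
    · rw [uIoc_of_le (by linarith)] at hτ
      exact ((T.op τ).le_opNorm _).trans
        (mul_le_mul (hb τ (by linarith [hτ.1])) ((D t₀).le_opNorm x) (norm_nonneg _) hM.le)
    · rw [abs_of_nonneg (by linarith)]; ring
  intro t ht
  have ht' : (0 : ℝ) < t := ht
  have hL : LipschitzOnWith (M * ‖D (t / 2)‖).toNNReal T.op (Ici (t / 2)) := by
    refine LipschitzOnWith.of_dist_le_mul fun a ha b hb' => ?_
    rw [Real.coe_toNNReal _ (by positivity), dist_eq_norm, dist_eq_norm, Real.norm_eq_abs]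
    rcases le_total a b with h | h
    · rw [norm_sub_rev, abs_sub_comm, abs_of_nonneg (sub_nonneg.2 h)]
      exact key _ _ _ (by positivity) ha h
    · rw [abs_of_nonneg (sub_nonneg.2 h)]
      exact key _ _ _ (by positivity) hb' h
  exact (hL.continuousOn.continuousAt (Ici_mem_nhds (by linarith))).continuousWithinAt

/-- The semigroup is differentiable in operator norm at positive times. -/
lemma hasDerivAt_op_norm (hT : T.ExpStable) (hA : T.IsAnalytic) {D : ℝ → E →L[ℝ] E}
    (hD : ∀ t : ℝ, 0 < t → ∀ x, (T.op t x, D t x) ∈ T.generatorGraph) {t : ℝ} (ht : 0 < t) :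
    HasDerivAt T.op (D t) t := by
  have hfac : ∀ a b : ℝ, 0 < a → 0 ≤ b → D (b + a) = (D a).comp (T.op b) := by
    intro a b ha hb
    ext x
    refine generatorGraph_unique (hD (b + a) (by positivity) x) ?_
    rw [T.op_add_apply hb ha.le, T.op_comm_apply hb ha.le]
    exact hD a ha _
  have hfac' : ∀ a b : ℝ, 0 < a → 0 ≤ b → ∀ x, D (b + a) x = T.op b (D a x) := by
    intro a b ha hb x
    refine generatorGraph_unique (hD (b + a) (by positivity) x) ?_
    rw [T.op_add_apply hb ha.le]
    exact op_mem_generatorGraph (hD a ha x) hb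
  -- Factoring AT(τ) = AT(a/2) T(τ - a/2) transfers norm continuity from T to AT. Then T is a norm
  -- primitive of AT, checked vector by vector.
  have hcont : ContinuousOn D (Ioi 0) := by
    intro a ha
    have ha' : (0 : ℝ) < a := ha
    have h1 : ContinuousAt (fun τ => (D (a / 2)).comp (T.op (τ - a / 2))) a := by
      refine ContinuousAt.clm_comp continuousAt_const ?_
      refine ContinuousAt.comp (f := fun τ : ℝ => τ - a / 2) (g := T.op) ?_
        (continuous_id.sub continuous_const).continuousAt
      exact (continuousOn_op_norm hT hA).continuousAt (Ioi_mem_nhds (by linarith))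
    refine (h1.congr ?_).continuousWithinAt
    filter_upwards [Ioi_mem_nhds (show a / 2 < a by linarith)] with τ hτ
    rw [← hfac _ _ (by positivity) (sub_nonneg.2 (le_of_lt hτ)), sub_add_cancel]
  have hvec : ∀ a : ℝ, 0 < a → ∀ x, HasDerivAt (fun τ => T.op τ x) (D a x) a := by
    intro a ha x
    have h1 := hasDerivAt_op (hD (a / 2) (by positivity) x) (t := a - a / 2) (by linarith)
    have h2 := h1.comp_sub_const a (a / 2)
    rw [← hfac' _ _ (by positivity) (by linarith), sub_add_cancel] at h2
    refine h2.congr_of_eventuallyEq ?_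
    filter_upwards [Ioi_mem_nhds (show a / 2 < a by linarith)] with τ hτ
    rw [← T.op_add_apply (sub_nonneg.2 (le_of_lt hτ)) (by positivity), sub_add_cancel]
  have hsub : ∀ b : ℝ, 0 < b → uIcc (t / 2) b ⊆ Ioi 0 := fun b hb τ hτ =>
    (lt_min (by positivity) hb).trans_le hτ.1
  have hint : ∀ b : ℝ, 0 < b → IntervalIntegrable D volume (t / 2) b := fun b hb =>
    (hcont.mono (hsub b hb)).intervalIntegrable
  have h1 := (intervalIntegral.integral_hasDerivAt_right (hint t ht)
    (hcont.stronglyMeasurableAtFilter isOpen_Ioi t ht)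
    (hcont.continuousAt (Ioi_mem_nhds ht))).add_const (T.op (t / 2))
  refine h1.congr_of_eventuallyEq ?_
  filter_upwards [Ioi_mem_nhds ht] with b hb
  ext x
  rw [add_apply, ContinuousLinearMap.intervalIntegral_apply (hint b hb),
    intervalIntegral.integral_eq_sub_of_hasDerivAt (f := fun τ => T.op τ x)
      (fun τ hτ => hvec τ (hsub b hb hτ) x)]
  · abel
  · exact ((hcont.mono (hsub b hb)).clm_apply continuousOn_const).intervalIntegrable

lemma integrableOn_rpow_smul_op (hT : T.ExpStable) (hA : T.IsAnalytic) {s : ℝ} (hs : 0 < s) :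
    IntegrableOn (fun t : ℝ => t ^ (s - 1) • T.op t) (Ioi 0) := by
  obtain ⟨M, ω, hM, hω, hb⟩ := hT
  have h1 := (integrableOn_rpow_mul_exp_neg_mul_rpow (s := s - 1) (p := 1) (by linarith)
    one_pos hω).const_mul M
  refine Integrable.mono' h1 ?_ ?_
  · refine ContinuousOn.aestronglyMeasurable ?_ measurableSet_Ioi
    have h2 : ContinuousOn (fun t : ℝ => t ^ (s - 1)) (Ioi 0) :=
      continuousOn_id.rpow_const fun t ht => Or.inl (ne_of_gt ht)
    exact h2.smul (continuousOn_op_norm ⟨M, ω, hM, hω, hb⟩ hA)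
  · refine (ae_restrict_iff' measurableSet_Ioi).2 (Eventually.of_forall fun t ht => ?_)
    have ht' : (0 : ℝ) < t := ht
    rw [norm_smul, Real.norm_of_nonneg (by positivity), Real.rpow_one]
    calc t ^ (s - 1) * ‖T.op t‖ ≤ t ^ (s - 1) * (M * Real.exp (-ω * t)) := by
          gcongr; exact hb t ht'.le
      _ = _ := by ring

end C0Semigroup

/-! ### Negative fractional powers -/

section NegPow

variable {Z : Type*} [NormedAddCommGroup Z] [InnerProductSpace ℝ Z] [CompleteSpace Z]
  {T : C0Semigroup Z}

lemma negPow_zero (T : C0Semigroup Z) : negPow T 0 = ContinuousLinearMap.id ℝ Z := if_pos rfl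

lemma negPow_of_pos (T : C0Semigroup Z) {s : ℝ} (hs : 0 < s) :
    negPow T s = (Real.Gamma s)⁻¹ • ∫ t in Ioi (0 : ℝ), t ^ (s - 1) • T.op t :=
  if_neg hs.ne'

lemma negPow_apply (hT : T.ExpStable) (hA : T.IsAnalytic) {s : ℝ} (hs : 0 < s) (x : Z) :
    negPow T s x = (Real.Gamma s)⁻¹ • ∫ t in Ioi (0 : ℝ), t ^ (s - 1) • T.op t x := by
  rw [negPow_of_pos T hs, smul_apply, ContinuousLinearMap.integral_apply
    (C0Semigroup.integrableOn_rpow_smul_op hT hA hs)]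
  rfl

lemma op_negPow (hT : T.ExpStable) (hA : T.IsAnalytic) {s t : ℝ} (hs : 0 ≤ s) (ht : 0 ≤ t)
    (x : Z) : T.op t (negPow T s x) = negPow T s (T.op t x) := by
  rcases hs.eq_or_lt with rfl | hs
  · simp [negPow_zero]
  rw [negPow_apply hT hA hs, negPow_apply hT hA hs, map_smul]
  rw [← ContinuousLinearMap.integral_comp_comm]
  · congr 1
    refine setIntegral_congr_fun measurableSet_Ioi fun τ hτ => ?_
    simp only [map_smul]
    rw [T.op_comm_apply ht (le_of_lt hτ)]
  · exact (C0Semigroup.integrableOn_rpow_smul_op hT hA hs).apply_continuousLinearMap x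

lemma integral_rpow_mul_rpow_sub {a b x : ℝ} (ha : 0 < a) (hb : 0 < b) (hx : 0 < x) :
    ∫ t in (0 : ℝ)..x, t ^ (a - 1) * (x - t) ^ (b - 1) =
      x ^ (a + b - 1) * ProbabilityTheory.beta a b := by
  have h := Complex.betaIntegral_scaled (a : ℂ) (b : ℂ) hx
  have h1 : (∫ t in (0 : ℝ)..x, (t : ℂ) ^ ((a : ℂ) - 1) * ((x : ℂ) - t) ^ ((b : ℂ) - 1)) =
      ((∫ t in (0 : ℝ)..x, t ^ (a - 1) * (x - t) ^ (b - 1) : ℝ) : ℂ) := by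
    rw [← intervalIntegral.integral_ofReal]
    refine intervalIntegral.integral_congr fun t ht => ?_
    rw [uIcc_of_le hx.le] at ht
    rw [Complex.ofReal_mul, Complex.ofReal_cpow ht.1, Complex.ofReal_cpow (sub_nonneg.2 ht.2)]
    push_cast
    rfl
  have h2 : (x : ℂ) ^ ((a : ℂ) + b - 1) = ((x ^ (a + b - 1) : ℝ) : ℂ) := by
    rw [Complex.ofReal_cpow hx.le]; push_cast; rfl
  rw [h1, h2] at h
  have h3 := congrArg Complex.re h
  rw [Complex.ofReal_re, Complex.re_ofReal_mul] at h3
  rw [h3, ProbabilityTheory.beta_eq_betaIntegralReal a b ha hb]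

/-- The product of the two integrals is the integral of a convolution over the half line. The
semigroup law pulls T(y) out, leaving a Beta integral, and B(a,b)Γ(a+b) = Γ(a)Γ(b). -/
lemma negPow_negPow (hT : T.ExpStable) (hA : T.IsAnalytic) {a b : ℝ} (ha : 0 ≤ a) (hb : 0 ≤ b)
    (x : Z) : negPow T a (negPow T b x) = negPow T (a + b) x := by
  rcases ha.eq_or_lt with rfl | ha
  · simp [negPow_zero]
  rcases hb.eq_or_lt with rfl | hb
  · simp [negPow_zero]
  suffices h : (negPow T a).comp (negPow T b) = negPow T (a + b) from
    DFunLike.congr_fun h x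
  have hconv := integral_posConvolution (C0Semigroup.integrableOn_rpow_smul_op hT hA ha)
    (C0Semigroup.integrableOn_rpow_smul_op hT hA hb) (ContinuousLinearMap.compL ℝ Z Z Z)
  have hab : 0 < a + b := by positivity
  have h1 : ∀ y ∈ Ioi (0 : ℝ), (∫ t in (0 : ℝ)..y, ContinuousLinearMap.compL ℝ Z Z Z
      (t ^ (a - 1) • T.op t) ((y - t) ^ (b - 1) • T.op (y - t))) =
      ProbabilityTheory.beta a b • (y ^ (a + b - 1) • T.op y) := by
    intro y hy
    have hy' : (0 : ℝ) < y := hy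
    rw [smul_smul, mul_comm, ← integral_rpow_mul_rpow_sub ha hb hy']
    refine Eq.trans ?_ (intervalIntegral.integral_smul_const _ _)
    refine intervalIntegral.integral_congr fun t ht => ?_
    rw [uIcc_of_le hy'.le] at ht
    have := T.op_add t (y - t) ht.1 (sub_nonneg.2 ht.2)
    rw [add_sub_cancel] at this
    simp only [ContinuousLinearMap.compL_apply, ContinuousLinearMap.smul_comp,
      ContinuousLinearMap.comp_smul, smul_smul, this]
    rw [mul_comm]
  rw [setIntegral_congr_fun measurableSet_Ioi h1, integral_smul,
    ContinuousLinearMap.compL_apply] at hconv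
  rw [negPow_of_pos T ha, negPow_of_pos T hb, negPow_of_pos T hab,
    ContinuousLinearMap.smul_comp, ContinuousLinearMap.comp_smul, ← hconv, smul_smul, smul_smul]
  congr 1
  have := Real.Gamma_pos_of_pos ha
  have := Real.Gamma_pos_of_pos hb
  have := Real.Gamma_pos_of_pos hab
  rw [ProbabilityTheory.beta]
  field_simp

lemma negPow_one_apply (hT : T.ExpStable) (hA : T.IsAnalytic) (x : Z) :
    negPow T 1 x = ∫ t in Ioi (0 : ℝ), T.op t x := by
  rw [negPow_apply hT hA one_pos]
  simp

lemma integrableOn_op_apply (hT : T.ExpStable) (hA : T.IsAnalytic) (x : Z) :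
    IntegrableOn (fun t : ℝ => T.op t x) (Ioi 0) := by
  have := (C0Semigroup.integrableOn_rpow_smul_op hT hA one_pos).apply_continuousLinearMap x
  simpa [IntegrableOn] using this

/-- The generator `A` satisfies `-A⁻¹ = negPow T 1`. -/
lemma mem_generatorGraph_iff (hT : T.ExpStable) (hA : T.IsAnalytic) {x y : Z} :
    (x, y) ∈ T.generatorGraph ↔ x = -negPow T 1 y := by
  -- With R = ∫₀^∞ T the shift by h removes the initial piece: T(h)Ru - Ru = -∫₀ʰ T(τ)u dτ. Dividing
  -- by h shows A(-Ru) = u.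
  have hR : ∀ (u : Z) {h : ℝ}, 0 ≤ h →
      T.op h (negPow T 1 u) - negPow T 1 u = -∫ τ in (0 : ℝ)..h, T.op τ u := by
    intro u h hh
    have hi := integrableOn_op_apply hT hA u
    have h1 : T.op h (negPow T 1 u) = ∫ τ in Ioi h, T.op τ u := by
      rw [op_negPow hT hA zero_le_one hh, negPow_one_apply hT hA]
      have := (measurePreserving_add_right volume h).setIntegral_preimage_emb
        (measurableEmbedding_addRight h) (fun τ => T.op τ u) (Ioi h)
      rw [preimage_add_const_Ioi, sub_self] at this
      rw [← this]
      refine setIntegral_congr_fun measurableSet_Ioi fun τ hτ => ?_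
      exact (T.op_add_apply (le_of_lt hτ) hh u).symm
    rw [h1, negPow_one_apply hT hA, intervalIntegral.integral_of_le hh,
      ← Ioc_union_Ioi_eq_Ioi hh, setIntegral_union (Ioc_disjoint_Ioi_same) measurableSet_Ioi
        (hi.mono_set Ioc_subset_Ioi_self) (hi.mono_set (Ioi_subset_Ioi hh))]
    abel
  have hmem : ∀ u : Z, (-negPow T 1 u, u) ∈ T.generatorGraph := by
    intro u
    have h1 := T.tendsto_average u le_rfl
    rw [T.op_zero_apply] at h1
    refine h1.congr' ?_
    filter_upwards [self_mem_nhdsWithin] with h hh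
    simp only [map_neg]
    rw [zero_add, ← neg_eq_iff_eq_neg.2 (hR u (le_of_lt hh))]
    congr 1; abel
  constructor
  · intro h
    have h1 := T.tendsto_average x le_rfl
    rw [T.op_zero_apply] at h1
    have h2 := ((negPow T 1).continuous.tendsto y).comp h
    -- Conversely, R applied to the difference quotients of x tends to Ry, and by `hR` it is also
    -- minus an average of the orbit, which tends to -x.
    have h3 : Tendsto (fun h : ℝ => -(h⁻¹ • ∫ τ in (0 : ℝ)..(0 + h), T.op τ x)) (𝓝[>] 0)
        (𝓝 (negPow T 1 y)) := by
      refine h2.congr' ?_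
      filter_upwards [self_mem_nhdsWithin] with h hh
      simp only [Function.comp, map_smul, map_sub]
      rw [← op_negPow hT hA zero_le_one (le_of_lt hh), hR x (le_of_lt hh), zero_add, smul_neg]
    exact neg_eq_iff_eq_neg.1 (tendsto_nhds_unique h1.neg h3)
  · rintro rfl
    exact hmem y

lemma negPow_one_injective (hT : T.ExpStable) (hA : T.IsAnalytic) :
    Function.Injective (negPow T 1) := by
  intro u v h
  refine C0Semigroup.generatorGraph_unique (T := T) (x := -negPow T 1 u)
    ((mem_generatorGraph_iff hT hA).2 rfl) ?_
  exact (mem_generatorGraph_iff hT hA).2 (by rw [h])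

lemma negPow_injective (hT : T.ExpStable) (hA : T.IsAnalytic) {s : ℝ} (hs : 0 ≤ s)
    (hs1 : s ≤ 1) : Function.Injective (negPow T s) := by
  intro u v h
  refine negPow_one_injective hT hA ?_
  have h1 := negPow_negPow hT hA (sub_nonneg.2 hs1) hs
  rw [sub_add_cancel] at h1
  rw [← h1, ← h1, h]

lemma denseRange_negPow (hT : T.ExpStable) (hA : T.IsAnalytic) {s : ℝ} (hs : 0 ≤ s)
    (hs1 : s ≤ 1) : DenseRange (negPow T s) := by
  refine T.dense_domain.mono ?_
  rintro x ⟨y, hy⟩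
  rw [(mem_generatorGraph_iff hT hA).1 hy]
  have h1 := negPow_negPow hT hA hs (sub_nonneg.2 hs1) (-y)
  rw [add_sub_cancel] at h1
  exact ⟨_, h1.trans (map_neg _ _)⟩

/-- If `S t = J ∘ W t` for `t > 0` with `J` injective, then `W` is strongly continuous. -/
lemma continuousOn_of_factor {S : C0Semigroup Z} (hS : S.ExpStable) {J : Z →L[ℝ] Z}
    (hJ : Function.Injective J) {W : ℝ → Z →L[ℝ] Z} (hW : ∀ t : ℝ, 0 < t → ∀ x, J (W t x) = S.op t x)
    {α : Type*} [TopologicalSpace α] {s : Set α} {a : α → ℝ} {g : α → Z} (ha : ContinuousOn a s)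
    (ha0 : ∀ x ∈ s, 0 < a x) (hg : ContinuousOn g s) :
    ContinuousOn (fun x => W (a x) (g x)) s := by
  intro x hx
  have hx0 := ha0 x hx
  -- Near x all times exceed a(x)/2, so W(t) is one fixed bounded operator following the strongly
  -- continuous S.
  have hfac : ∀ t : ℝ, a x / 2 ≤ t → ∀ u, W t u = W (a x / 2) (S.op (t - a x / 2) u) := by
    intro t ht u
    refine hJ ?_
    rw [hW t (by linarith), hW _ (by linarith), ← S.op_add_apply (by linarith) (by linarith)]
    congr 2; ring
  have hev : ∀ᶠ y in 𝓝[s] x, a x / 2 ≤ a y :=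
    (ha x hx).eventually (Ici_mem_nhds (by linarith))
  have h1 : ContinuousOn (fun y => S.op (a y - a x / 2) (g y)) (s ∩ {y | a x / 2 ≤ a y}) :=
    hS.continuousOn_op_comp ((ha.mono inter_subset_left).sub continuousOn_const)
      (fun y hy => sub_nonneg.2 hy.2) (hg.mono inter_subset_left)
  have h2 := (W (a x / 2)).continuous.comp_continuousOn h1
  have h3 : ContinuousWithinAt (fun y => W (a x / 2) (S.op (a y - a x / 2) (g y))) s x :=
    (h2 x ⟨hx, by simp only [mem_ofPred_eq]; linarith⟩).mono_of_mem_nhdsWithin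
      (inter_mem self_mem_nhdsWithin hev)
  refine h3.congr_of_eventuallyEq ?_ (hfac _ (by linarith) _)
  filter_upwards [hev] with y hy
  exact hfac _ hy _

end NegPow

/-! ### Smoothing estimates and the perturbation of the generator by a functional -/

section Perturbation

lemma integrableOn_rpow_neg_Ioc {α : ℝ} (hα : α < 1) (t : ℝ) (ht : 0 ≤ t) :
    IntegrableOn (fun τ : ℝ => τ ^ (-α)) (Ioc 0 t) := by
  rw [← intervalIntegrable_iff_integrableOn_Ioc_of_le ht]
  exact intervalIntegral.intervalIntegrable_rpow' (by linarith)

/-- A Gronwall inequality with a weakly singular kernel, on a short interval. -/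
lemma singular_gronwall {α δ κ N : ℝ} (hα0 : 0 < α) (hα : α < 1) (hδ : 0 < δ) (hκ : 0 ≤ κ) (hN : 0 ≤ N)
    (hsmall : κ * (δ ^ (1 - α) * ProbabilityTheory.beta (1 - α) (1 - α)) ≤ 1 / 2)
    {p : ℝ → ℝ} (hp : ContinuousOn p (Icc 0 δ))
    (hle : ∀ t ∈ Ioc 0 δ, p t ≤ N * t ^ (-α) + κ * ∫ τ in (0 : ℝ)..t, (t - τ) ^ (-α) * p τ) :
    ∀ t ∈ Ioc 0 δ, p t ≤ 2 * N * t ^ (-α) := by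
  have hB : 0 < ProbabilityTheory.beta (1 - α) (1 - α) :=
    ProbabilityTheory.beta_pos (by linarith) (by linarith)
  -- Let m be the maximum of t^α p(t). The kernel convolved with t^{-α} is a Beta multiple of
  -- t^{1-2α}, so the smallness of δ yields m ≤ N + m/2.
  have hc : ContinuousOn (fun t : ℝ => t ^ α * p t) (Icc 0 δ) :=
    (continuousOn_id.rpow_const fun _ _ => Or.inr hα0.le).mul hp
  obtain ⟨s, hs, hmax⟩ := isCompact_Icc.exists_isMaxOn (nonempty_Icc.2 hδ.le) hc
  set m := s ^ α * p s with hm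
  have hpm : ∀ t ∈ Ioc 0 δ, p t ≤ m * t ^ (-α) := by
    intro t ht
    have h1 : t ^ α * p t ≤ m := hmax (Ioc_subset_Icc_self ht)
    rw [Real.rpow_neg ht.1.le, ← div_eq_mul_inv, le_div_iff₀ (Real.rpow_pos_of_pos ht.1 _)]
    linarith
  have hm0 : 0 ≤ m := by
    have := hmax (left_mem_Icc.2 hδ.le)
    simp only [mem_ofPred_eq, Real.zero_rpow hα0.ne', zero_mul] at this
    exact this
  suffices hmN : m ≤ 2 * N by
    intro t ht
    refine (hpm t ht).trans ?_
    have := Real.rpow_nonneg ht.1.le (-α)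
    gcongr
  rcases hs.1.eq_or_lt with h0 | h0
  · rw [hm, ← h0, Real.zero_rpow hα0.ne', zero_mul]
    positivity
  have hint : IntervalIntegrable (fun τ : ℝ => (s - τ) ^ (-α)) volume 0 s := by
    have := (intervalIntegral.intervalIntegrable_rpow' (a := 0) (b := s)
      (show -1 < -α by linarith)).comp_sub_left s
    simpa using this.symm
  have hbeta := integral_rpow_mul_rpow_sub (a := 1 - α) (b := 1 - α) (x := s) (by linarith)
    (by linarith) h0
  have hexp : (1 : ℝ) - α - 1 = -α := by ring
  rw [hexp] at hbeta
  have hint2 : IntervalIntegrable (fun τ : ℝ => τ ^ (-α) * (s - τ) ^ (-α)) volume 0 s := by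
    -- Otherwise the integral would be 0 by convention, whereas its Beta value is positive.
    by_contra h
    rw [intervalIntegral.integral_undef h] at hbeta
    have : 0 < s ^ (1 - α + (1 - α) - 1) * ProbabilityTheory.beta (1 - α) (1 - α) := by
      have := Real.rpow_pos_of_pos h0 (1 - α + (1 - α) - 1)
      positivity
    linarith
  have h1 : (∫ τ in (0 : ℝ)..s, (s - τ) ^ (-α) * p τ) ≤
      ∫ τ in (0 : ℝ)..s, m * (τ ^ (-α) * (s - τ) ^ (-α)) := by
    refine intervalIntegral.integral_mono_on_of_le_Ioo h0.le ?_ (hint2.const_mul m) ?_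
    · refine hint.mul_continuousOn ?_
      rw [uIcc_of_le h0.le]
      exact hp.mono (Icc_subset_Icc_right hs.2)
    · intro τ hτ
      have := hpm τ ⟨hτ.1, hτ.2.le.trans hs.2⟩
      have h6 := Real.rpow_nonneg (sub_nonneg.2 hτ.2.le) (-α)
      nlinarith
  rw [intervalIntegral.integral_const_mul, hbeta] at h1
  have h2 := hle s ⟨h0, hs.2⟩
  have hs1 : s ^ α * s ^ (-α) = 1 := by
    rw [← Real.rpow_add h0, add_neg_cancel, Real.rpow_zero]
  have hs2 : s ^ α * s ^ (1 - α + (1 - α) - 1) = s ^ (1 - α) := by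
    rw [← Real.rpow_add h0]; congr 1; ring
  have hs3 : s ^ (1 - α) ≤ δ ^ (1 - α) := Real.rpow_le_rpow h0.le hs.2 (by linarith)
  have hsα := Real.rpow_pos_of_pos h0 α
  set β' := ProbabilityTheory.beta (1 - α) (1 - α)
  have h3 : m ≤ N + κ * (m * (s ^ (1 - α) * β')) := by
    calc m = s ^ α * p s := rfl
      _ ≤ s ^ α * (N * s ^ (-α) + κ * (m * (s ^ (1 - α + (1 - α) - 1) * β'))) := by
          gcongr
          exact h2.trans (by gcongr)
      _ = N * (s ^ α * s ^ (-α)) + κ * (m * ((s ^ α * s ^ (1 - α + (1 - α) - 1)) * β')) := by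
          ring
      _ = _ := by rw [hs1, hs2, mul_one]
  have h4 : κ * (m * (s ^ (1 - α) * β')) ≤ m * (1 / 2) := by
    calc κ * (m * (s ^ (1 - α) * β')) = m * (κ * (s ^ (1 - α) * β')) := by ring
      _ ≤ m * (κ * (δ ^ (1 - α) * β')) := by gcongr
      _ ≤ _ := by gcongr
  linarith

variable {Z : Type*} [NormedAddCommGroup Z] [InnerProductSpace ℝ Z] [CompleteSpace Z]
  {T : C0Semigroup Z}

/-- Take V(t) = (-A)^α T(t) = -(-A)^{-(1-α)} AT(t), write the fractional power as an integral, and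
use ‖AT(τ+t)‖ ≤ M/(τ+t). -/
lemma exists_smoothing (hT : T.ExpStable) (hA : T.IsAnalytic) {α : ℝ} (hα0 : 0 < α)
    (hα : α < 1) : ∃ (M : ℝ) (V : ℝ → Z →L[ℝ] Z), 0 < M ∧ ∀ t : ℝ, 0 < t →
      (∀ x, negPow T α (V t x) = T.op t x) ∧ ‖V t‖ ≤ M * t ^ (-α) := by
  obtain ⟨M, D, hM, hD⟩ := hA.exists_generator_op
  have hΓ := Real.Gamma_pos_of_pos (show 0 < 1 - α by linarith)
  -- The two terms come from splitting at τ = t: M/(τ+t) is at most M/t before and at most M/τ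
  -- after.
  refine ⟨(Real.Gamma (1 - α))⁻¹ * (M / (1 - α) + M / α), fun t => -(negPow T (1 - α)).comp (D t),
    ?_, fun t ht => ⟨fun x => ?_, ?_⟩⟩
  · have : 0 < 1 - α := by linarith
    positivity
  · rw [neg_apply, map_neg, ContinuousLinearMap.comp_apply,
      negPow_negPow hT hA hα0.le (by linarith), add_sub_cancel]
    exact ((mem_generatorGraph_iff hT hA).1 ((hD t ht).1 x)).symm
  rw [norm_neg]
  have h1α : 0 < 1 - α := by linarith
  refine ContinuousLinearMap.opNorm_le_bound _ (by positivity) fun x => ?_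
  rw [ContinuousLinearMap.comp_apply, negPow_apply hT hA h1α, norm_smul,
    Real.norm_of_nonneg (by positivity)]
  have hexp : (1 : ℝ) - α - 1 = -α := by ring
  have hfac : ∀ τ : ℝ, 0 < τ → T.op τ (D t x) = D (τ + t) x := by
    intro τ hτ
    refine C0Semigroup.generatorGraph_unique (T := T)
      (C0Semigroup.op_mem_generatorGraph ((hD t ht).1 x) hτ.le) ?_
    rw [← T.op_add_apply hτ.le ht.le]
    exact (hD _ (by positivity)).1 x
  have hpt : ∀ τ : ℝ, 0 < τ → ‖T.op τ (D t x)‖ ≤ M / (τ + t) * ‖x‖ := by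
    intro τ hτ
    rw [hfac τ hτ]
    exact (D (τ + t)).le_of_opNorm_le (hD _ (by positivity)).2 x
  have hI := (C0Semigroup.integrableOn_rpow_smul_op hT hA h1α).apply_continuousLinearMap (D t x)
  simp only [smul_apply] at hI
  have hsplit : ∫ τ in Ioi (0 : ℝ), τ ^ (1 - α - 1) • T.op τ (D t x) =
      (∫ τ in Ioc 0 t, τ ^ (1 - α - 1) • T.op τ (D t x)) +
        ∫ τ in Ioi t, τ ^ (1 - α - 1) • T.op τ (D t x) := by
    rw [← Ioc_union_Ioi_eq_Ioi ht.le, setIntegral_union Ioc_disjoint_Ioi_same measurableSet_Ioi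
      (IntegrableOn.mono_set hI Ioc_subset_Ioi_self)
      (IntegrableOn.mono_set hI (Ioi_subset_Ioi ht.le))]
  have hle1 : ‖∫ τ in Ioc 0 t, τ ^ (1 - α - 1) • T.op τ (D t x)‖ ≤
      M / (1 - α) * t ^ (-α) * ‖x‖ := by
    refine (norm_integral_le_of_norm_le (g := fun τ => τ ^ (-α) * (M / t * ‖x‖))
      ((integrableOn_rpow_neg_Ioc hα t ht.le).mul_const _) ?_).trans_eq ?_
    · refine (ae_restrict_iff' measurableSet_Ioc).2 (Eventually.of_forall fun τ hτ => ?_)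
      have hτ0 : 0 < τ := hτ.1
      rw [norm_smul, Real.norm_of_nonneg (by positivity), hexp]
      gcongr
      refine (hpt τ hτ0).trans ?_
      gcongr
      linarith
    · rw [integral_mul_const, ← intervalIntegral.integral_of_le ht.le,
        integral_rpow (Or.inl (by linarith)), Real.zero_rpow (by linarith), sub_zero,
        neg_add_eq_sub, Real.rpow_sub ht, Real.rpow_one, Real.rpow_neg ht.le]
      field_simp
  have hle2 : ‖∫ τ in Ioi t, τ ^ (1 - α - 1) • T.op τ (D t x)‖ ≤
      M / α * t ^ (-α) * ‖x‖ := by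
    refine (norm_integral_le_of_norm_le (g := fun τ => τ ^ (-α - 1) * (M * ‖x‖))
      ((integrableOn_Ioi_rpow_of_lt (by linarith) ht).mul_const _) ?_).trans_eq ?_
    · refine (ae_restrict_iff' measurableSet_Ioi).2 (Eventually.of_forall fun τ hτ => ?_)
      have hτ0 : 0 < τ := ht.trans hτ
      rw [norm_smul, Real.norm_of_nonneg (by positivity), hexp, Real.rpow_sub_one hτ0.ne']
      calc τ ^ (-α) * ‖T.op τ (D t x)‖ ≤ τ ^ (-α) * (M / τ * ‖x‖) := by
            gcongr
            refine (hpt τ hτ0).trans ?_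
            gcongr
            linarith
        _ = _ := by ring
    · rw [integral_mul_const, integral_Ioi_rpow_of_lt (by linarith) ht, sub_add_cancel]
      field_simp
  rw [hsplit]
  calc _ ≤ (Real.Gamma (1 - α))⁻¹ * (M / (1 - α) * t ^ (-α) * ‖x‖ + M / α * t ^ (-α) * ‖x‖) := by
        gcongr
        exact (norm_add_le _ _).trans (add_le_add hle1 hle2)
    _ = _ := by ring

end Perturbation

/-! ### The semigroup perturbed by unbounded rank-one feedback -/

section PerturbedSemigroup

variable {Z : Type*} [NormedAddCommGroup Z] [InnerProductSpace ℝ Z] [CompleteSpace Z]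
  {T S : C0Semigroup Z} {α ζ : ℝ} {b : Z} {q : StrongDual ℝ Z}

/-- `S` is the semigroup generated by `A - ζ b q(A ·)`, where `A` generates `T` and `q = C A⁻¹`
extends to the functional `C` given by `C (-A)^{-α} u = c u`. -/
structure IsPerturbation (T S : C0Semigroup Z) (α ζ : ℝ) (b : Z) (c q : StrongDual ℝ Z) :
    Prop where
  stable : T.ExpStable
  analytic : T.IsAnalytic
  pert_stable : S.ExpStable
  α_pos : 0 < α
  α_lt : α < 1
  ζ_nonneg : 0 ≤ ζ
  q_apply : ∀ v, q v = -c (negPow T (1 - α) v)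
  gen : ∀ u w, (u, w) ∈ S.generatorGraph ↔
    ∃ v, u = -negPow T 1 v ∧ w = v - (ζ * q v) • b
  q_b : q b = -1

variable {c : StrongDual ℝ Z}

namespace IsPerturbation

/-- Because q(b) = -1, the feedback only rescales q by 1 + ζ. Hence q(v), with v standing for Au, is
recovered from the perturbed generator's value. -/
lemma q_gen (h : IsPerturbation T S α ζ b c q) (v : Z) :
    q (v - (ζ * q v) • b) = (1 + ζ) * q v := by
  rw [map_sub, map_smul, h.q_b, smul_eq_mul]; ring

lemma negPow_one_eq (h : IsPerturbation T S α ζ b c q) (v : Z) :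
    negPow T α (negPow T (1 - α) v) = negPow T 1 v := by
  rw [negPow_negPow h.stable h.analytic h.α_pos.le (by linarith [h.α_lt]), add_sub_cancel]

lemma injective (h : IsPerturbation T S α ζ b c q) : Function.Injective (negPow T α) :=
  negPow_injective h.stable h.analytic h.α_pos.le h.α_lt.le

/-- Differentiate τ ↦ T(t-τ)S(τ)x: the terms with A cancel and only the feedback term survives. The
product rule uses differentiability of T in operator norm. -/
lemma duhamel (h : IsPerturbation T S α ζ b c q) {v : ℝ → Z} {w x : Z}
    (hx : (x, w) ∈ S.generatorGraph)
    (hv : ∀ t, 0 ≤ t → S.op t x = -negPow T 1 (v t))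
    (hw : ∀ t, 0 ≤ t → S.op t w = v t - (ζ * q (v t)) • b)
    (hvc : ContinuousOn v (Ici 0)) {t : ℝ} (ht : 0 < t) :
    S.op t x = T.op t x - ζ • ∫ τ in (0 : ℝ)..t, q (v τ) • T.op (t - τ) b := by
  obtain ⟨M, D, hM, hD⟩ := h.analytic.exists_generator_op
  have hcb : ContinuousOn (fun τ => q (v τ) • T.op (t - τ) b) (Icc 0 t) := by
    refine (q.continuous.comp_continuousOn (hvc.mono Icc_subset_Ici_self)).smul ?_
    exact h.stable.continuousOn_op_comp (continuousOn_const.sub continuousOn_id)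
      (fun τ hτ => sub_nonneg.2 hτ.2) continuousOn_const
  have hint : IntervalIntegrable (fun τ => q (v τ) • T.op (t - τ) b) volume 0 t :=
    ContinuousOn.intervalIntegrable (by rwa [uIcc_of_le ht.le])
  have h1 := intervalIntegral.integral_eq_sub_of_hasDerivAt_of_le
    (f := fun τ => T.op (t - τ) (S.op τ x)) (f' := fun τ => -(ζ • (q (v τ) • T.op (t - τ) b)))
    ht.le ?_ ?_ (hint.smul ζ).neg
  · simp only [sub_self, sub_zero, T.op_zero_apply, S.op_zero_apply] at h1
    rw [intervalIntegral.integral_neg, intervalIntegral.integral_smul] at h1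
    rw [eq_add_of_sub_eq h1.symm]
    abel
  · exact h.stable.continuousOn_op_comp (continuousOn_const.sub continuousOn_id)
      (fun τ hτ => sub_nonneg.2 hτ.2) (S.continuousOn_op_Icc x le_rfl)
  · intro τ hτ
    have hτ' : 0 < t - τ := sub_pos.2 hτ.2
    have h2 := C0Semigroup.hasDerivAt_op_norm h.stable h.analytic (fun t ht => (hD t ht).1) hτ'
    have h3 := h2.comp_const_sub t τ
    have h4 := h3.clm_apply (C0Semigroup.hasDerivAt_op hx hτ.1)
    convert! h4 using 1
    have h5 : (S.op τ x, v τ) ∈ T.generatorGraph :=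
      (mem_generatorGraph_iff h.stable h.analytic).2 (hv τ hτ.1.le)
    have h6 : D (t - τ) (S.op τ x) = T.op (t - τ) (v τ) :=
      C0Semigroup.generatorGraph_unique ((hD _ hτ').1 _)
        (C0Semigroup.op_mem_generatorGraph h5 hτ'.le)
    rw [neg_apply, h6, hw τ hτ.1.le, map_sub, map_smul, mul_smul]
    abel

/-- For x in the domain, u(t) = (-A)^α S(t)x is continuous up to 0 and satisfies u(t) = V(t)x - ζ∫₀ᵗ
c(u(τ))V(t-τ)b dτ, a Volterra equation with kernel bounded by a multiple of (t-τ)^{-α}. The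
resulting bound involves only ‖x‖. -/
lemma exists_bound_domain (h : IsPerturbation T S α ζ b c q) :
    ∃ K δ : ℝ, 0 < K ∧ 0 < δ ∧ ∀ x w, (x, w) ∈ S.generatorGraph → ∀ t ∈ Ioc 0 δ,
      ∃ u, negPow T α u = S.op t x ∧ ‖u‖ ≤ K * t ^ (-α) * ‖x‖ := by
  obtain ⟨M, V, hM, hV⟩ := exists_smoothing h.stable h.analytic h.α_pos h.α_lt
  have hα1 : 0 < 1 - α := by linarith [h.α_lt]
  set κ : ℝ := ζ * ‖c‖ * M * ‖b‖ with hκ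
  have hκ0 : 0 ≤ κ := by have := h.ζ_nonneg; positivity
  set β' := ProbabilityTheory.beta (1 - α) (1 - α)
  obtain ⟨δ, hδ, hsmall⟩ : ∃ δ : ℝ, 0 < δ ∧ κ * (δ ^ (1 - α) * β') ≤ 1 / 2 := by
    have h1 : Tendsto (fun δ : ℝ => κ * (δ ^ (1 - α) * β')) (𝓝 0) (𝓝 0) := by
      have h2 : ContinuousAt (fun δ : ℝ => δ ^ (1 - α)) 0 :=
        Real.continuousAt_rpow_const _ _ (Or.inr hα1.le)
      have h3 := (h2.tendsto.mul_const β').const_mul κ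
      simpa [Real.zero_rpow hα1.ne'] using h3
    have h2 := (h1.eventually (Iic_mem_nhds (show (0 : ℝ) < 1 / 2 by norm_num)))
    obtain ⟨δ, h3, h4⟩ := ((h2.filter_mono nhdsWithin_le_nhds).and
      (self_mem_nhdsWithin (s := Ioi (0 : ℝ)))).exists
    exact ⟨δ, h4, h3⟩
  -- The factor 2 is the loss in `singular_gronwall`.
  refine ⟨2 * M, δ, by positivity, hδ, fun x w hx => ?_⟩
  have hmem : ∀ t, ∃ v, 0 ≤ t → S.op t x = -negPow T 1 v ∧ S.op t w = v - (ζ * q v) • b := by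
    intro t
    by_cases ht : 0 ≤ t
    · obtain ⟨v, hv⟩ := (h.gen _ _).1 (C0Semigroup.op_mem_generatorGraph hx ht)
      exact ⟨v, fun _ => hv⟩
    · exact ⟨0, fun h' => absurd h' ht⟩
  choose v hv using hmem
  have hζ : (1 : ℝ) + ζ ≠ 0 := by linarith [h.ζ_nonneg]
  have hq : ∀ t, 0 ≤ t → q (v t) = (1 + ζ)⁻¹ * q (S.op t w) := by
    intro t ht
    rw [(hv t ht).2, h.q_gen]
    field_simp
  -- v = AS(t)x equals S(t)w + ζ q(v)b, and `hq` expresses q(v) through the continuous orbit S(t)w.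
  have hvc : ContinuousOn v (Ici 0) := by
    have h1 : ContinuousOn (fun t => S.op t w + (ζ * ((1 + ζ)⁻¹ * q (S.op t w))) • b) (Ici 0) := by
      have h2 := S.continuousOn w
      have h3 := q.continuous.comp_continuousOn h2
      exact h2.add ((continuousOn_const.mul (continuousOn_const.mul h3)).smul continuousOn_const)
    refine h1.congr fun t ht => ?_
    beta_reduce
    rw [← hq t ht, (hv t ht).2]
    abel
  set u : ℝ → Z := fun t => -negPow T (1 - α) (v t) with hu
  have hcu : ∀ t, c (u t) = q (v t) := fun t => by rw [hu, map_neg, h.q_apply]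
  have huS : ∀ t, 0 ≤ t → negPow T α (u t) = S.op t x := fun t ht => by
    rw [hu, map_neg, h.negPow_one_eq, (hv t ht).1]
  have huc : ContinuousOn u (Ici 0) := ((negPow T (1 - α)).continuous.comp_continuousOn hvc).neg
  have hrep : ∀ t ∈ Ioc 0 δ,
      ‖u t‖ ≤ M * ‖x‖ * t ^ (-α) + κ * ∫ τ in (0 : ℝ)..t, (t - τ) ^ (-α) * ‖u τ‖ := by
    intro t ht
    have ht0 : 0 < t := ht.1
    have hgint : IntervalIntegrable (fun τ : ℝ => (t - τ) ^ (-α) * ‖u τ‖) volume 0 t := by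
      have h1 := (intervalIntegral.intervalIntegrable_rpow' (a := 0) (b := t)
        (show -1 < -α by linarith)).comp_sub_left t
      rw [sub_zero, sub_self] at h1
      refine h1.symm.mul_continuousOn ?_
      rw [uIcc_of_le ht0.le]
      exact (huc.mono Icc_subset_Ici_self).norm
    have hbd : ∀ τ ∈ Ioo 0 t, ‖q (v τ) • V (t - τ) b‖ ≤
        ‖c‖ * M * ‖b‖ * ((t - τ) ^ (-α) * ‖u τ‖) := by
      intro τ hτ
      have hτ' : 0 < t - τ := sub_pos.2 hτ.2
      rw [norm_smul, ← hcu]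
      calc ‖c (u τ)‖ * ‖V (t - τ) b‖ ≤ (‖c‖ * ‖u τ‖) * (M * (t - τ) ^ (-α) * ‖b‖) := by
            gcongr
            · exact c.le_opNorm _
            · exact (V (t - τ)).le_of_opNorm_le (hV _ hτ').2 b
        _ = _ := by ring
    have hVint : IntervalIntegrable (fun τ => q (v τ) • V (t - τ) b) volume 0 t := by
      refine (hgint.const_mul (‖c‖ * M * ‖b‖)).mono_fun' ?_ ?_
      · rw [uIoc_of_le ht0.le, ← restrict_Ioo_eq_restrict_Ioc]
        refine ContinuousOn.aestronglyMeasurable ?_ measurableSet_Ioo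
        refine (q.continuous.comp_continuousOn (hvc.mono fun τ hτ => hτ.1.le)).smul ?_
        exact continuousOn_of_factor h.stable h.injective (fun t ht => (hV t ht).1)
          (continuousOn_const.sub continuousOn_id) (fun τ hτ => sub_pos.2 hτ.2) continuousOn_const
      · rw [uIoc_of_le ht0.le, ← restrict_Ioo_eq_restrict_Ioc]
        exact (ae_restrict_iff' measurableSet_Ioo).2 (Eventually.of_forall hbd)
    have hint : u t = V t x - ζ • ∫ τ in (0 : ℝ)..t, q (v τ) • V (t - τ) b := by
      -- Applying the injective (-A)^{-α} reduces the equation for u to Duhamel's formula in Z.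
      refine h.injective ?_
      rw [huS t ht0.le, map_sub, map_smul, (hV t ht0).1,
        ← (negPow T α).intervalIntegral_comp_comm hVint,
        h.duhamel hx (fun t ht => (hv t ht).1) (fun t ht => (hv t ht).2) hvc ht0]
      congr 2
      rw [intervalIntegral.integral_of_le ht0.le, intervalIntegral.integral_of_le ht0.le,
        integral_Ioc_eq_integral_Ioo, integral_Ioc_eq_integral_Ioo]
      refine setIntegral_congr_fun measurableSet_Ioo fun τ hτ => ?_
      simp only [map_smul]
      rw [(hV _ (sub_pos.2 hτ.2)).1]
    rw [hint]
    refine (norm_sub_le _ _).trans (add_le_add ?_ ?_)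
    · refine ((V t).le_of_opNorm_le (hV t ht0).2 x).trans_eq (by ring)
    · rw [norm_smul, Real.norm_of_nonneg h.ζ_nonneg, hκ]
      have h1 : ‖∫ τ in (0 : ℝ)..t, q (v τ) • V (t - τ) b‖ ≤
          ∫ τ in (0 : ℝ)..t, ‖c‖ * M * ‖b‖ * ((t - τ) ^ (-α) * ‖u τ‖) := by
        refine intervalIntegral.norm_integral_le_of_norm_le ht0.le ?_ (hgint.const_mul _)
        have hne : ∀ᵐ τ : ℝ, τ ≠ t := by simp [ae_iff]
        filter_upwards [hne] with τ hne hτ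
        exact hbd τ ⟨hτ.1, lt_of_le_of_ne hτ.2 hne⟩
      rw [intervalIntegral.integral_const_mul] at h1
      calc _ ≤ ζ * (‖c‖ * M * ‖b‖ * ∫ τ in (0 : ℝ)..t, (t - τ) ^ (-α) * ‖u τ‖) :=
            mul_le_mul_of_nonneg_left h1 h.ζ_nonneg
        _ = _ := by ring
  intro t ht
  refine ⟨u t, huS t ht.1.le, ?_⟩
  refine (singular_gronwall h.α_pos h.α_lt hδ hκ0 (by positivity) hsmall
    (huc.mono Icc_subset_Ici_self).norm hrep t ht).trans_eq (by ring)

/-- The domain is dense and, by lower semicontinuity, a bound on the image norm is a closed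
condition. The slack ε makes room for nearby domain vectors, and attainment of the norm recovers u
after ε → 0. -/
lemma exists_bound (h : IsPerturbation T S α ζ b c q) :
    ∃ K δ : ℝ, 0 < K ∧ 0 < δ ∧ ∀ x, ∀ t ∈ Ioc 0 δ,
      ∃ u, negPow T α u = S.op t x ∧ ‖u‖ ≤ K * t ^ (-α) * ‖x‖ := by
  obtain ⟨K, δ, hK, hδ, hb⟩ := h.exists_bound_domain
  refine ⟨K, δ, hK, hδ, fun x t ht => ?_⟩
  have hKt : 0 ≤ K * t ^ (-α) := by
    have := Real.rpow_nonneg ht.1.le (-α)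
    positivity
  rw [← imageNorm_le_ofReal_iff _ _ (by positivity)]
  have key : ∀ ε : ℝ, 0 < ε →
      imageNorm (negPow T α) (S.op t x) ≤ ENNReal.ofReal (K * t ^ (-α) * ‖x‖ + ε) := by
    intro ε hε
    have hcl : IsClosed {y | imageNorm (negPow T α) (S.op t y) ≤
        ENNReal.ofReal (K * t ^ (-α) * ‖x‖ + ε)} :=
      ((lowerSemicontinuous_iff_isClosed_preimage.1
        (lowerSemicontinuous_imageNorm (negPow T α))) _).preimage (S.op t).continuous
    have hop : IsOpen {y : Z | K * t ^ (-α) * ‖y‖ < K * t ^ (-α) * ‖x‖ + ε} :=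
      isOpen_lt (by fun_prop) continuous_const
    refine hcl.closure_subset_iff.2 ?_ (S.dense_domain.open_subset_closure_inter hop
      (by simpa using hε : x ∈ _))
    rintro y ⟨hy, w, hw⟩
    obtain ⟨u, hu, hun⟩ := hb y w hw t ht
    rw [mem_ofPred_eq]
    exact (imageNorm_le_ofReal_iff _ _ (by positivity)).2 ⟨u, hu, hun.trans (le_of_lt hy)⟩
  have hlim : Tendsto (fun ε : ℝ => ENNReal.ofReal (K * t ^ (-α) * ‖x‖ + ε)) (𝓝[>] 0)
      (𝓝 (ENNReal.ofReal (K * t ^ (-α) * ‖x‖ + 0))) :=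
    (ENNReal.continuous_ofReal.comp (continuous_const.add continuous_id)).tendsto 0 |>.mono_left
      nhdsWithin_le_nhds
  rw [add_zero] at hlim
  refine ge_of_tendsto hlim ?_
  filter_upwards [self_mem_nhdsWithin] with ε hε
  exact key ε hε

/-- The perturbed semigroup factors through the range of `(-A)^{-α}` with an integrable bound. -/
lemma exists_factor (h : IsPerturbation T S α ζ b c q) :
    ∃ (k : ℝ → ℝ) (W : ℝ → Z →L[ℝ] Z), IntegrableOn k (Ioi 0) ∧
      ∀ t : ℝ, 0 < t → (∀ x, negPow T α (W t x) = S.op t x) ∧ ‖W t‖ ≤ k t := by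
  obtain ⟨K, δ, hK, hδ, hb⟩ := h.exists_bound
  obtain ⟨M, ω, hM, hω, hS⟩ := h.pert_stable
  refine ⟨fun t => K * M * Real.exp (ω * δ) * (t ^ (-α) * Real.exp (-ω * t)) +
    K * M * Real.exp (ω * δ) * δ ^ (-α) * Real.exp (-ω * t), ?_⟩
  have hW : ∀ t : ℝ, ∃ W : Z →L[ℝ] Z, 0 < t → (∀ x, negPow T α (W x) = S.op t x) ∧
      ‖W‖ ≤ K * M * Real.exp (ω * δ) * (t ^ (-α) * Real.exp (-ω * t)) +
    K * M * Real.exp (ω * δ) * δ ^ (-α) * Real.exp (-ω * t) := by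
    intro t
    by_cases ht : 0 < t
    swap
    · exact ⟨0, fun h' => absurd h' ht⟩
    -- S(t) runs freely for time t - min(t, δ) and smooths during the remainder. The factor exp(ωδ)
    -- pays for the decay not used in the smoothing interval.
    have hm : min t δ ∈ Ioc 0 δ := ⟨lt_min ht hδ, min_le_right _ _⟩
    choose u hu hun using fun x => hb x (min t δ) hm
    let L : Z →ₗ[ℝ] Z :=
      { toFun := u
        map_add' := fun a b => h.injective (by rw [map_add, hu, hu, hu, map_add])
        map_smul' := fun r a => h.injective (by
          rw [map_smul, hu, hu, map_smul, RingHom.id_apply]) }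
    have hL0 : 0 ≤ K * (min t δ) ^ (-α) := by
      have := Real.rpow_nonneg hm.1.le (-α)
      positivity
    let Lc := L.mkContinuous (K * (min t δ) ^ (-α)) hun
    have hsub : 0 ≤ t - min t δ := sub_nonneg.2 (min_le_left _ _)
    refine ⟨Lc.comp (S.op (t - min t δ)), fun _ => ⟨fun x => ?_, ?_⟩⟩
    · refine (hu (S.op (t - min t δ) x)).trans ?_
      rw [← S.op_add_apply hm.1.le hsub, add_sub_cancel]
    · have h1 : ‖Lc‖ ≤ K * (min t δ) ^ (-α) := L.mkContinuous_norm_le hL0 _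
      have h2 : (min t δ) ^ (-α) ≤ t ^ (-α) + δ ^ (-α) := by
        have := Real.rpow_nonneg ht.le (-α)
        have := Real.rpow_nonneg hδ.le (-α)
        rcases min_choice t δ with h' | h' <;> rw [h'] <;> linarith
      have h3 : ‖S.op (t - min t δ)‖ ≤ M * (Real.exp (ω * δ) * Real.exp (-ω * t)) := by
        refine (hS _ hsub).trans ?_
        rw [← Real.exp_add]
        gcongr
        nlinarith [hm.2]
      calc _ ≤ ‖Lc‖ * ‖S.op (t - min t δ)‖ := ContinuousLinearMap.opNorm_comp_le _ _
        _ ≤ (K * (t ^ (-α) + δ ^ (-α))) * (M * (Real.exp (ω * δ) * Real.exp (-ω * t))) := by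
            gcongr
            exact h1.trans (by gcongr)
        _ = _ := by ring
  choose W hW using hW
  refine ⟨W, ?_, hW⟩
  have h1 := integrableOn_rpow_mul_exp_neg_mul_rpow (s := -α) (p := 1) (by linarith [h.α_lt])
    one_pos hω
  have h2 := integrableOn_rpow_mul_exp_neg_mul_rpow (s := 0) (p := 1) (by linarith)
    one_pos hω
  simp only [Real.rpow_one, Real.rpow_zero, one_mul] at h1 h2
  exact (h1.const_mul _).add (h2.const_mul _)

/-- `C ∫₀ᵗ S τ x dτ = (1 + ζ)⁻¹ C A⁻¹ (S t x - x)`. -/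
lemma integral_factor (h : IsPerturbation T S α ζ b c q) {k : ℝ → ℝ} {W : ℝ → Z →L[ℝ] Z}
    (hk : IntegrableOn k (Ioi 0))
    (hW : ∀ t : ℝ, 0 < t → (∀ x, negPow T α (W t x) = S.op t x) ∧ ‖W t‖ ≤ k t) (x : Z) :
    IntegrableOn (fun τ => W τ x) (Ioi 0) ∧ ∀ t : ℝ, 0 ≤ t →
      (1 + ζ) * ∫ τ in (0 : ℝ)..t, c (W τ x) = q (S.op t x) - q x := by
  have hint : IntegrableOn (fun τ => W τ x) (Ioi 0) := by
    refine Integrable.mono' (hk.mul_const ‖x‖) ?_ ?_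
    · refine ContinuousOn.aestronglyMeasurable ?_ measurableSet_Ioi
      exact continuousOn_of_factor h.pert_stable h.injective (fun t ht => (hW t ht).1)
        continuousOn_id (fun t ht => ht) continuousOn_const
    · refine (ae_restrict_iff' measurableSet_Ioi).2 (Eventually.of_forall fun t ht => ?_)
      exact (W t).le_of_opNorm_le (hW t ht).2 x
  refine ⟨hint, fun t ht => ?_⟩
  have hI : IntervalIntegrable (fun τ => W τ x) volume 0 t := by
    rw [intervalIntegrable_iff_integrableOn_Ioc_of_le ht]
    exact hint.mono_set Ioc_subset_Ioi_self
  obtain ⟨v, hv1, hv2⟩ := (h.gen _ _).1 (S.integral_mem_generatorGraph x ht)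
  -- The integral of S(τ)x lies in the generator's domain with image S(t)x - x, so its (-A)^α is
  -- determined by v.
  have h1 : ∫ τ in (0 : ℝ)..t, W τ x = -negPow T (1 - α) v := by
    refine h.injective ?_
    rw [map_neg, h.negPow_one_eq, ← hv1, ← (negPow T α).intervalIntegral_comp_comm hI]
    rw [intervalIntegral.integral_of_le ht, intervalIntegral.integral_of_le ht]
    exact setIntegral_congr_fun measurableSet_Ioc fun τ hτ => (hW τ hτ.1).1 x
  rw [c.intervalIntegral_comp_comm hI, h1, ← map_sub, hv2, h.q_gen, map_neg, h.q_apply]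

end IsPerturbation
end PerturbedSemigroup

/-! ### Identification of the extrapolation space with the state space -/

section Transport

variable {Z : Type*} [NormedAddCommGroup Z] [InnerProductSpace ℝ Z] [CompleteSpace Z]
  {T : C0Semigroup Z} {s : ℝ}

/-- The inclusion `Z ⊆ Z^{-s}` as a bounded operator. -/
def inclL (T : C0Semigroup Z) (s : ℝ) : Z →L[ℝ] NegSpace T s :=
  LinearMap.mkContinuous
    { toFun := incl T s
      map_add' := fun φ ψ => by
        rw [incl, incl, incl, map_add, UniformSpace.Completion.coe_add]
      map_smul' := fun r φ => by
        rw [incl, incl, map_smul, UniformSpace.Completion.coe_smul, RingHom.id_apply] }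
    ‖negPow T s‖ (fun φ => by
      change ‖incl T s φ‖ ≤ _
      rw [incl, UniformSpace.Completion.norm_coe]
      exact (negPow T s).le_opNorm φ)

@[simp] lemma inclL_apply (T : C0Semigroup Z) (s : ℝ) (φ : Z) : inclL T s φ = incl T s φ := rfl

lemma denseRange_incl (T : C0Semigroup Z) (s : ℝ) : DenseRange (incl T s) :=
  UniformSpace.Completion.denseRange_coe.comp (toPreNeg T s).surjective.denseRange
    (UniformSpace.Completion.continuous_coe _)

/-- The isometry `(-A)^{-s} : Z^{-s} → Z`. -/
lemma exists_negIso (hT : T.ExpStable) (hA : T.IsAnalytic) (hs : 0 ≤ s) (hs1 : s ≤ 1) :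
    ∃ Λ : NegSpace T s ≃ₗᵢ[ℝ] Z, ∀ φ, Λ (incl T s φ) = negPow T s φ := by
  refine ⟨(LinearEquiv.refl ℝ Z).extendOfIsometry (inclL T s : Z →ₗ[ℝ] NegSpace T s)
    (negPow T s : Z →ₗ[ℝ] Z) (denseRange_incl T s) (denseRange_negPow hT hA hs hs1)
    (fun φ => ?_), fun φ => ?_⟩
  · change ‖negPow T s φ‖ = ‖incl T s φ‖
    rw [incl, UniformSpace.Completion.norm_coe]
    rfl
  · exact LinearEquiv.extendOfIsometry_eq _ (inclL T s : Z →ₗ[ℝ] NegSpace T s) _ _ _ _ φ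

variable {Λ : NegSpace T s ≃ₗᵢ[ℝ] Z}

lemma incl_injective (hT : T.ExpStable) (hA : T.IsAnalytic) (hs : 0 ≤ s) (hs1 : s ≤ 1) :
    Function.Injective (incl T s) := by
  obtain ⟨Λ, hΛ⟩ := exists_negIso hT hA hs hs1
  intro φ ψ h
  refine negPow_injective hT hA hs hs1 ?_
  rw [← hΛ, ← hΛ, h]

/-- Λ intertwines A⁻¹ on Z with itself, since powers commute. The right side is a closed condition
that holds on the graph of A, and every point satisfying it is a limit of such graph points by
density of Z. -/
lemma mem_extGraph_iff (hT : T.ExpStable) (hA : T.IsAnalytic) (hs : 0 ≤ s)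
    (hΛ : ∀ φ, Λ (incl T s φ) = negPow T s φ) {x y : NegSpace T s} :
    (x, y) ∈ extGraph T s ↔ Λ x = -negPow T 1 (Λ y) := by
  have hcomm : ∀ ψ, negPow T s (negPow T 1 ψ) = negPow T 1 (negPow T s ψ) := fun ψ => by
    rw [negPow_negPow hT hA hs zero_le_one, negPow_negPow hT hA zero_le_one hs, add_comm]
  constructor
  · intro h
    have hcl : IsClosed {p : NegSpace T s × NegSpace T s | Λ p.1 = -negPow T 1 (Λ p.2)} :=
      isClosed_eq (by fun_prop) (by fun_prop)
    refine hcl.closure_subset_iff.2 ?_ h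
    rintro _ ⟨⟨φ, ψ⟩, hφ, rfl⟩
    simp only [Prod.map, mem_ofPred_eq]
    rw [hΛ, hΛ, (mem_generatorGraph_iff hT hA).1 hφ, map_neg, hcomm]
  · intro h
    have hx : x = Λ.symm (-negPow T 1 (Λ y)) := by rw [← h, Λ.symm_apply_apply]
    rw [hx]
    refine (denseRange_incl T s).induction_on
      (p := fun y => (Λ.symm (-negPow T 1 (Λ y)), y) ∈ extGraph T s) y ?_ ?_
    · exact isClosed_closure.preimage (by fun_prop)
    · intro ψ
      refine subset_closure ⟨(-negPow T 1 ψ, ψ), (mem_generatorGraph_iff hT hA).2 rfl, ?_⟩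
      simp only [Prod.map]
      congr 1
      rw [Λ.eq_symm_apply, hΛ, hΛ, map_neg, hcomm]

lemma graphInv_eq {X : Type*} [Zero X] {L : Set (X × X)} {x y : X} (h : (y, x) ∈ L)
    (huniq : ∀ y', (y', x) ∈ L → y' = y) : graphInv L x = y := by
  have hex : ∃ y : X, (y, x) ∈ L := ⟨y, h⟩
  rw [graphInv, dif_pos hex]
  exact huniq _ hex.choose_spec

/-- Transport of a semigroup along an isometric isomorphism. -/
def C0Semigroup.conj {E F : Type*} [NormedAddCommGroup E] [NormedSpace ℝ E]
    [NormedAddCommGroup F] [NormedSpace ℝ F] (S : C0Semigroup E) (Λ : E ≃ₗᵢ[ℝ] F) :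
    C0Semigroup F where
  op t := (Λ.toContinuousLinearEquiv : E →L[ℝ] F).comp
    ((S.op t).comp (Λ.symm.toContinuousLinearEquiv : F →L[ℝ] E))
  op_zero := by ext x; simp [S.op_zero]
  op_add s t hs ht := by ext x; simp [S.op_add s t hs ht]
  continuousOn x := Λ.continuous.comp_continuousOn (S.continuousOn (Λ.symm x))

namespace C0Semigroup

variable {E F : Type*} [NormedAddCommGroup E] [NormedSpace ℝ E]
    [NormedAddCommGroup F] [NormedSpace ℝ F] {S : C0Semigroup E} (Λ : E ≃ₗᵢ[ℝ] F)

lemma conj_op_apply (t : ℝ) (x : F) : (S.conj Λ).op t x = Λ (S.op t (Λ.symm x)) := rfl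

lemma mem_generatorGraph_conj {u w : F} :
    (u, w) ∈ (S.conj Λ).generatorGraph ↔ (Λ.symm u, Λ.symm w) ∈ S.generatorGraph := by
  simp only [generatorGraph, mem_ofPred_eq, conj_op_apply]
  constructor
  · intro h
    refine ((Λ.symm.continuous.tendsto w).comp h).congr fun t => ?_
    simp [Function.comp]
  · intro h
    have := (Λ.continuous.tendsto (Λ.symm w)).comp h
    rw [Λ.apply_symm_apply] at this
    refine this.congr fun t => ?_
    simp [Function.comp]

lemma ExpStable.conj (h : S.ExpStable) : (S.conj Λ).ExpStable := by
  obtain ⟨M, ω, hM, hω, hb⟩ := h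
  refine ⟨M, ω, hM, hω, fun t ht => ContinuousLinearMap.opNorm_le_bound _ (by positivity)
    fun x => ?_⟩
  rw [conj_op_apply, Λ.norm_map]
  refine ((S.op t).le_of_opNorm_le (hb t ht) _).trans_eq ?_
  rw [Λ.symm.norm_map]

end C0Semigroup
end Transport

/-! ### The output of the closed loop semigroup -/

namespace Plant

variable {Z : Type*} [NormedAddCommGroup Z] [InnerProductSpace ℝ Z] [CompleteSpace Z]
  {P : Plant Z}

namespace Assumptions

lemma s_nonneg (hP : P.Assumptions) : 0 ≤ max P.sb P.sd := le_max_of_le_left hP.sb_nonneg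

lemma s_lt (hP : P.Assumptions) : max P.sb P.sd < 1 := max_lt hP.sb_lt hP.sd_lt

lemma sc_add_s_lt (hP : P.Assumptions) : P.sc + max P.sb P.sd < 1 := by
  rcases max_choice P.sb P.sd with h | h <;> rw [h]
  exacts [hP.scb, hP.scd]

lemma ι_injective (hP : P.Assumptions) : Function.Injective P.ι :=
  incl_injective hP.stable hP.analytic hP.s_nonneg hP.s_lt.le

/-- The functional `C (-A)^{-s_c}` on `Z`. -/
def outBase (hP : P.Assumptions) : StrongDual ℝ Z :=
  LinearMap.mkContinuousOfExistsBound
    (P.C ∘ₗ (negPow P.T P.sc : Z →ₗ[ℝ] Z).rangeRestrict) hP.C_bounded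

lemma out_ι_negPow (hP : P.Assumptions) (v : Z) :
    P.out (P.ι (negPow P.T P.sc v)) = hP.outBase v := by
  have hex : ∃ φ : posSpace P.T P.sc, P.ι (φ : Z) = P.ι (negPow P.T P.sc v) :=
    ⟨⟨negPow P.T P.sc v, LinearMap.mem_range.2 ⟨v, rfl⟩⟩, rfl⟩
  rw [out, dif_pos hex]
  have h1 : hex.choose = (negPow P.T P.sc : Z →ₗ[ℝ] Z).rangeRestrict v :=
    Subtype.ext (hP.ι_injective hex.choose_spec)
  rw [h1]
  rfl

end Assumptions

/-- The semigroup `S` generated by `A_β`, seen on `Z` through the isometry `Λ = (-A)^{-s}`. -/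
structure Realization (P : Plant Z) (S : C0Semigroup P.X) where
  Λ : P.X ≃ₗᵢ[ℝ] Z
  α : ℝ
  c : StrongDual ℝ Z
  q : StrongDual ℝ Z
  Λ_ι : ∀ φ, Λ (P.ι φ) = negPow P.T (max P.sb P.sd) φ
  pert : IsPerturbation P.T (S.conj Λ) α P.ζ (Λ P.B) c q
  out_symm : ∀ u, P.out (Λ.symm (negPow P.T α u)) = c u
  out_Ainv : ∀ x, P.out (P.Ainv x) = q (Λ x)
  out_Aβinv : ∀ x, P.out (P.Aβinv x) = P.β * q (Λ x)

lemma Assumptions.one_add_ζ (hP : P.Assumptions) : 1 + P.ζ = P.β⁻¹ := by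
  have := hP.β_pos.ne'
  rw [ζ]; field_simp; ring

/-- The gap s_c + s < 1 leaves room for α. Then C Λ⁻¹(-A)^{-α} is C(-A)^{-s_c} followed on the right
by the bounded power (-A)^{-(α-s_c-s)}, and dividing B_in by the gain is exactly q(ΛB) = -1. -/
lemma Assumptions.exists_realization (hP : P.Assumptions) {S : C0Semigroup P.X}
    (hS : S.generatorGraph = P.AβGraph) (hSs : S.ExpStable) : Nonempty (P.Realization S) := by
  have hT := hP.stable
  have hA := hP.analytic
  obtain ⟨Λ, hΛ⟩ := exists_negIso hT hA hP.s_nonneg hP.s_lt.le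
  have hsα := hP.sc_add_s_lt
  obtain ⟨α, hα, hα1⟩ := exists_between hsα
  have hα0 : 0 < α := by linarith [hP.sc_nonneg, hP.s_nonneg]
  set c : StrongDual ℝ Z := hP.outBase.comp (negPow P.T (α - (P.sc + max P.sb P.sd))) with hc
  set q : StrongDual ℝ Z := -c.comp (negPow P.T (1 - α)) with hq
  have hqa : ∀ v, q v = -c (negPow P.T (1 - α) v) := fun v => rfl
  have hout : ∀ u, P.out (Λ.symm (negPow P.T α u)) = c u := by
    intro u
    have h1 : Λ.symm (negPow P.T α u) =
        P.ι (negPow P.T P.sc (negPow P.T (α - (P.sc + max P.sb P.sd)) u)) := by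
      rw [Λ.symm_apply_eq, ι, hΛ, negPow_negPow hT hA hP.sc_nonneg (by linarith),
        negPow_negPow hT hA hP.s_nonneg (by linarith [hP.sc_nonneg])]
      congr 2; ring
    rw [h1, hP.out_ι_negPow]
    rfl
  have hnp : ∀ v, negPow P.T 1 v = negPow P.T α (negPow P.T (1 - α) v) := fun v => by
    rw [negPow_negPow hT hA hα0.le (by linarith), add_sub_cancel]
  have houtR : ∀ v, P.out (Λ.symm (-negPow P.T 1 v)) = q v := fun v => by
    rw [hnp, ← map_neg, hout, map_neg, hqa]
  have hAinv : ∀ x, P.Ainv x = Λ.symm (-negPow P.T 1 (Λ x)) := by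
    intro x
    refine graphInv_eq ((mem_extGraph_iff hT hA hP.s_nonneg hΛ).2 (by simp)) fun y hy => ?_
    rw [Λ.eq_symm_apply]
    exact (mem_extGraph_iff hT hA hP.s_nonneg hΛ).1 hy
  have houtA : ∀ x, P.out (P.Ainv x) = q (Λ x) := fun x => by rw [hAinv, houtR]
  have hqb : q (Λ P.B) = -1 := by
    have hg : P.gain = -q (Λ P.bInX) := by
      rw [gain, hAinv, ← map_neg, neg_neg, ← neg_neg (negPow P.T 1 _), ← map_neg, houtR, map_neg]
    have := hP.gain_ne
    have h2 : q (Λ P.bInX) = -P.gain := by rw [hg, neg_neg]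
    rw [B, map_smul, map_smul, h2, smul_eq_mul]
    field_simp
  have hgraph : ∀ x y : P.X, (x, y) ∈ P.AβGraph ↔
      ∃ v, Λ x = -negPow P.T 1 v ∧ Λ y = v - (P.ζ * q v) • Λ P.B := by
    intro x y
    constructor
    · rintro ⟨w, hw, hy⟩
      have h1 := (mem_extGraph_iff hT hA hP.s_nonneg hΛ).1 hw
      refine ⟨Λ w, h1, ?_⟩
      have h2 : P.out x = q (Λ w) := by rw [← houtR, ← h1, Λ.symm_apply_apply]
      simp only at hy
      rw [hy, h2, map_sub, map_smul]
    · rintro ⟨v, hx, hy⟩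
      refine ⟨Λ.symm v, (mem_extGraph_iff hT hA hP.s_nonneg hΛ).2 (by simpa using hx), ?_⟩
      have h2 : P.out x = q v := by rw [← houtR, ← hx, Λ.symm_apply_apply]
      simp only
      rw [h2]
      refine Λ.injective ?_
      rw [hy, map_sub, map_smul, Λ.apply_symm_apply]
  have hζ : 0 ≤ P.ζ := div_nonneg (by linarith [hP.β_lt]) hP.β_pos.le
  have hpert : IsPerturbation P.T (S.conj Λ) α P.ζ (Λ P.B) c q :=
    { stable := hT
      analytic := hA
      pert_stable := hSs.conj Λ
      α_pos := hα0
      α_lt := hα1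
      ζ_nonneg := hζ
      q_apply := hqa
      gen := fun u w => by
        rw [C0Semigroup.mem_generatorGraph_conj, hS, hgraph, Λ.apply_symm_apply,
          Λ.apply_symm_apply]
      q_b := hqb }
  refine ⟨⟨Λ, α, c, q, hΛ, hpert, hout, houtA, fun x => ?_⟩⟩
  have hζ1 := hP.one_add_ζ
  have hβ := hP.β_pos
  -- Inverting A_β means solving v - ζ q(v)ΛB = Λx. Applying q gives (1+ζ)q(v) = q(Λx), and 1 + ζ =
  -- β⁻¹, which determines v.
  set v := Λ x + (P.ζ * (P.β * q (Λ x))) • Λ P.B with hv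
  have hqv : q v = P.β * q (Λ x) := by
    rw [hv, map_add, map_smul, hqb, smul_eq_mul]
    have h3 : P.ζ = P.β⁻¹ - 1 := by linarith
    rw [h3]; field_simp; ring
  have huniq : ∀ v', Λ x = v' - (P.ζ * q v') • Λ P.B → v' = v := by
    intro v' h
    have h1 := hpert.q_gen v'
    rw [← h, hζ1] at h1
    have h2 : q v' = P.β * q (Λ x) := by rw [h1]; field_simp
    rw [hv, ← h2, h]
    abel
  have h1 : P.Aβinv x = Λ.symm (-negPow P.T 1 v) := by
    refine graphInv_eq ((hgraph _ _).2 ⟨v, by simp, ?_⟩) fun y hy => ?_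
    · rw [hqv, hv]; abel
    · obtain ⟨v', h1, h2⟩ := (hgraph _ _).1 hy
      rw [Λ.eq_symm_apply, h1, huniq v' h2]
  rw [h1, houtR, hqv]

end Plant
-- Bounded output operators of the closed loop
namespace Plant

variable {Z : Type*} [NormedAddCommGroup Z] [InnerProductSpace ℝ Z] [CompleteSpace Z]
  {P : Plant Z} {S : C0Semigroup P.X}

/-- The operators `O t = C e^{A_β t}`, `κ = C A⁻¹` and `J = I_0` as bounded operators on `X`, with
an integrable bound `k` of `‖O t‖`. -/
structure IsOutput (P : Plant Z) (S : C0Semigroup P.X) (k : ℝ → ℝ) (O : ℝ → StrongDual ℝ P.X)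
    (κ : StrongDual ℝ P.X) (J : P.X →L[ℝ] P.X) : Prop where
  stable : S.ExpStable
  integrable : IntegrableOn k (Ioi 0)
  out_op : ∀ t, 0 < t → ∀ x, P.out (S.op t x) = O t x
  norm_le : ∀ t, 0 < t → ‖O t‖ ≤ k t
  continuousOn : ContinuousOn (fun p : ℝ × P.X => O p.1 p.2) (Ioi 0 ×ˢ univ)
  out_integral : ∀ (y : Z) (t : ℝ) (G : ℝ → P.X), 0 ≤ t → ContinuousOn G (Icc 0 t) →
    P.ι y = ∫ τ in (0 : ℝ)..t, S.op (t - τ) (G τ) →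
    P.out (P.ι y) = ∫ τ in (0 : ℝ)..t, O (t - τ) (G τ)
  I0_eq : ∀ x, P.I0 x = J x
  out_Aβinv : ∀ x, P.out (P.Aβinv x) = P.β * κ x
  κ_B : κ P.B = -1
  integral_eq : ∀ x t, 0 ≤ t → ∫ τ in (0 : ℝ)..t, O τ x = P.β * (κ (S.op t x) - κ x)

namespace IsOutput

variable {k : ℝ → ℝ} {O : ℝ → StrongDual ℝ P.X} {κ : StrongDual ℝ P.X} {J : P.X →L[ℝ] P.X}

lemma continuousOn_comp (h : IsOutput P S k O κ J) {t : ℝ} {s : Set ℝ} (hs : ∀ τ ∈ s, τ < t)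
    {G : ℝ → P.X} (hG : ContinuousOn G s) : ContinuousOn (fun τ => O (t - τ) (G τ)) s :=
  h.continuousOn.comp ((continuousOn_const.sub continuousOn_id).prodMk hG)
    fun τ hτ => ⟨sub_pos.2 (hs τ hτ), mem_univ _⟩

lemma continuousOn_apply (h : IsOutput P S k O κ J) (x : P.X) :
    ContinuousOn (fun τ => O τ x) (Ioi 0) :=
  h.continuousOn.comp (continuousOn_id.prodMk continuousOn_const)
    fun _ hτ => ⟨hτ, mem_univ _⟩

lemma integrableOn_apply (h : IsOutput P S k O κ J) (x : P.X) :
    IntegrableOn (fun τ => O τ x) (Ioi 0) := by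
  refine Integrable.mono' (h.integrable.mul_const ‖x‖)
    ((h.continuousOn_apply x).aestronglyMeasurable measurableSet_Ioi) ?_
  refine (ae_restrict_iff' measurableSet_Ioi).2 (Eventually.of_forall fun t ht => ?_)
  exact (O t).le_of_opNorm_le (h.norm_le t ht) x

lemma intervalIntegrable_reflect {E : Type*} [NormedAddCommGroup E] {g : ℝ → E}
    (hg : IntegrableOn g (Ioi 0)) {a t : ℝ} (hat : a ≤ t) :
    IntervalIntegrable (fun τ => g (t - τ)) volume a t := by
  have h1 : IntervalIntegrable g volume 0 (t - a) := by
    rw [intervalIntegrable_iff_integrableOn_Ioc_of_le (sub_nonneg.2 hat)]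
    exact hg.mono_set Ioc_subset_Ioi_self
  have := h1.comp_sub_left t
  simpa using this.symm

lemma intervalIntegrable (h : IsOutput P S k O κ J) {t : ℝ} (ht : 0 ≤ t) {G : ℝ → P.X}
    (hG : ContinuousOn G (Icc 0 t)) :
    IntervalIntegrable (fun τ => O (t - τ) (G τ)) volume 0 t := by
  obtain ⟨C, hC⟩ := isCompact_Icc.exists_bound_of_continuousOn hG
  refine ((intervalIntegrable_reflect h.integrable ht).mul_const C).mono_fun' ?_ ?_
  · rw [uIoc_of_le ht, ← restrict_Ioo_eq_restrict_Ioc]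
    exact (h.continuousOn_comp (fun τ hτ => hτ.2)
      (hG.mono Ioo_subset_Icc_self)).aestronglyMeasurable measurableSet_Ioo
  · rw [uIoc_of_le ht, ← restrict_Ioo_eq_restrict_Ioc]
    refine (ae_restrict_iff' measurableSet_Ioo).2 (Eventually.of_forall fun τ hτ => ?_)
    have h1 := h.norm_le _ (sub_pos.2 hτ.2)
    refine ((O (t - τ)).le_opNorm _).trans ?_
    exact mul_le_mul h1 (hC τ (Ioo_subset_Icc_self hτ)) (norm_nonneg _)
      ((norm_nonneg _).trans h1)

end IsOutput

/-- The output operator is O(t) = c W(t) Λ, so its integrable bound comes from W. -/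
lemma Assumptions.exists_isOutput (hP : P.Assumptions)
    (hS : S.generatorGraph = P.AβGraph) (hSs : S.ExpStable) :
    ∃ k O κ J, IsOutput P S k O κ J := by
  obtain ⟨ρ⟩ := hP.exists_realization hS hSs
  obtain ⟨k, W, hk, hW⟩ := ρ.pert.exists_factor
  let L : P.X →L[ℝ] Z := ρ.Λ.toContinuousLinearEquiv
  have hL : ∀ x, L x = ρ.Λ x := fun x => rfl
  have hop : ∀ t, 0 < t → ∀ x, S.op t x = ρ.Λ.symm (negPow P.T ρ.α (W t (ρ.Λ x))) := by
    intro t ht x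
    rw [(hW t ht).1, C0Semigroup.conj_op_apply, ρ.Λ.symm_apply_apply, ρ.Λ.symm_apply_apply]
  have hLn : ‖L‖ ≤ 1 := ContinuousLinearMap.opNorm_le_bound _ zero_le_one fun x => by
    rw [hL, ρ.Λ.norm_map, one_mul]
  have hcont : ∀ {A : Type} [TopologicalSpace A] {s : Set A} {a : A → ℝ} {g : A → P.X},
      ContinuousOn a s → (∀ x ∈ s, 0 < a x) → ContinuousOn g s →
      ContinuousOn (fun x => W (a x) (ρ.Λ (g x))) s := fun ha ha0 hg =>
    continuousOn_of_factor ρ.pert.pert_stable ρ.pert.injective (fun t ht => (hW t ht).1) ha ha0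
      (ρ.Λ.continuous.comp_continuousOn hg)
  have hβ := hP.β_pos
  refine ⟨fun t => ‖ρ.c‖ * k t, fun t => ρ.c.comp ((W t).comp L), ρ.q.comp L,
    ContinuousLinearMap.id ℝ _ + (ρ.q.comp L).smulRight P.B, ?_⟩
  refine
    { stable := hSs
      integrable := hk.const_mul _
      out_op := fun t ht x => by rw [hop t ht, ρ.out_symm]; rfl
      norm_le := fun t ht => ?_
      continuousOn := ?_
      out_integral := ?_
      I0_eq := fun x => by rw [I0, ρ.out_Ainv]; rfl
      out_Aβinv := ρ.out_Aβinv
      κ_B := ρ.pert.q_b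
      integral_eq := fun x t ht => ?_ }
  · calc _ ≤ ‖ρ.c‖ * (‖W t‖ * ‖L‖) := (ContinuousLinearMap.opNorm_comp_le _ _).trans (by
          gcongr; exact ContinuousLinearMap.opNorm_comp_le _ _)
      _ ≤ ‖ρ.c‖ * (k t * 1) := by
          have := (norm_nonneg _).trans (hW t ht).2
          gcongr
          exact (hW t ht).2
      _ = _ := by rw [mul_one]
  · refine ρ.c.continuous.comp_continuousOn ?_
    have h1 := continuousOn_of_factor ρ.pert.pert_stable ρ.pert.injective
      (fun t ht => (hW t ht).1) (s := Ioi 0 ×ˢ univ) (a := fun p : ℝ × P.X => p.1)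
      (g := fun p => ρ.Λ p.2) continuous_fst.continuousOn (fun p hp => hp.1)
      (ρ.Λ.continuous.comp continuous_snd).continuousOn
    exact h1
  · intro y t G ht hG hy
    have hint : IntervalIntegrable (fun τ => W (t - τ) (ρ.Λ (G τ))) volume 0 t := by
      obtain ⟨C, hC⟩ := isCompact_Icc.exists_bound_of_continuousOn hG
      refine ((IsOutput.intervalIntegrable_reflect hk ht).mul_const C).mono_fun' ?_ ?_
      · rw [uIoc_of_le ht, ← restrict_Ioo_eq_restrict_Ioc]
        exact (hcont (continuousOn_const.sub continuousOn_id) (fun τ hτ => sub_pos.2 hτ.2)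
          (hG.mono Ioo_subset_Icc_self)).aestronglyMeasurable measurableSet_Ioo
      · rw [uIoc_of_le ht, ← restrict_Ioo_eq_restrict_Ioc]
        refine (ae_restrict_iff' measurableSet_Ioo).2 (Eventually.of_forall fun τ hτ => ?_)
        have h1 := (hW _ (sub_pos.2 hτ.2)).2
        refine ((W (t - τ)).le_opNorm _).trans ?_
        rw [ρ.Λ.norm_map]
        exact mul_le_mul h1 (hC τ (Ioo_subset_Icc_self hτ)) (norm_nonneg _)
          ((norm_nonneg _).trans h1)
    -- The state integral equals R applied to a Bochner integral of W. This is what moves the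
    -- unbounded C under the integral sign.
    let R : Z →L[ℝ] P.X :=
      (ρ.Λ.symm.toContinuousLinearEquiv : Z →L[ℝ] P.X).comp (negPow P.T ρ.α)
    have h1 : P.ι y = R (∫ τ in (0 : ℝ)..t, W (t - τ) (ρ.Λ (G τ))) := by
      rw [hy, ← R.intervalIntegral_comp_comm hint, intervalIntegral.integral_of_le ht,
        intervalIntegral.integral_of_le ht, integral_Ioc_eq_integral_Ioo,
        integral_Ioc_eq_integral_Ioo]
      exact setIntegral_congr_fun measurableSet_Ioo fun τ hτ => hop _ (sub_pos.2 hτ.2) _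
    rw [h1]
    refine (ρ.out_symm _).trans ?_
    rw [← ρ.c.intervalIntegral_comp_comm hint]
    rfl
  · have h1 := (ρ.pert.integral_factor hk hW (ρ.Λ x)).2 t ht
    rw [hP.one_add_ζ, C0Semigroup.conj_op_apply, ρ.Λ.symm_apply_apply] at h1
    change ∫ τ in (0 : ℝ)..t, ρ.c (W τ (ρ.Λ x)) = P.β * (ρ.q (ρ.Λ (S.op t x)) - ρ.q (ρ.Λ x))
    rw [← h1]
    field_simp

end Plant

/-! ### Estimates of convolutions -/

section Convolution

lemma setLIntegral_reflect (g : ℝ → ℝ≥0∞) (t : ℝ) (s : Set ℝ) :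
    ∫⁻ τ in (fun τ => t - τ) ⁻¹' s, g (t - τ) = ∫⁻ τ in s, g τ :=
  (volume.measurePreserving_sub_left t).setLIntegral_comp_preimage_emb
    (MeasurableEquiv.subLeft t).measurableEmbedding g s

lemma setLIntegral_reflect_Ioo (g : ℝ → ℝ≥0∞) (a t : ℝ) :
    ∫⁻ τ in Ioo a t, g (t - τ) = ∫⁻ τ in Ioo 0 (t - a), g τ := by
  rw [← setLIntegral_reflect g t]
  simp

lemma setLIntegral_conv_le (g u : ℝ → ℝ≥0∞) {a t : ℝ} {C : ℝ≥0∞} (hC : C ≠ ∞)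
    (hu : ∀ τ ∈ Ioo a t, u τ ≤ C) :
    ∫⁻ τ in Ioo a t, g (t - τ) * u τ ≤ (∫⁻ τ in Ioo 0 (t - a), g τ) * C := by
  rw [← setLIntegral_reflect_Ioo g a t, ← lintegral_mul_const' _ _ hC]
  refine setLIntegral_mono' measurableSet_Ioo fun τ hτ => ?_
  gcongr
  exact hu τ hτ

/-- Continuity from above of the measure with density g. Measurability of g is not required, which
matters because the operator norms used as kernels are suprema over a whole ball. -/
lemma tendsto_setLIntegral_Ioi {g : ℝ → ℝ≥0∞} (hg : ∫⁻ τ in Ioi (0 : ℝ), g τ ≠ ∞) :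
    Tendsto (fun a => ∫⁻ τ in Ioi a, g τ) atTop (𝓝 0) := by
  have h1 := tendsto_measure_iInter_atTop (μ := volume.withDensity g) (s := fun a : ℝ => Ioi a)
    (fun a => measurableSet_Ioi.nullMeasurableSet) (fun a b hab => Ioi_subset_Ioi hab)
    ⟨0, by rwa [withDensity_apply _ measurableSet_Ioi]⟩
  have h2 : ⋂ a : ℝ, Ioi a = ∅ := by
    ext x
    simp only [mem_iInter, mem_Ioi, mem_empty_iff_false, iff_false, not_forall, not_lt]
    exact ⟨x, le_rfl⟩
  rw [h2, measure_empty] at h1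
  refine h1.congr fun a => ?_
  exact withDensity_apply _ measurableSet_Ioi

lemma tendsto_setLIntegral_conv_head {g u : ℝ → ℝ≥0∞} (hg : ∫⁻ τ in Ioi (0 : ℝ), g τ ≠ ∞)
    {a : ℝ} {C : ℝ≥0∞} (hC : C ≠ ∞) (hu : ∀ τ ∈ Ioc 0 a, u τ ≤ C) :
    Tendsto (fun t => ∫⁻ τ in Ioc 0 a, g (t - τ) * u τ) atTop (𝓝 0) := by
  -- For τ ≤ a the kernel is evaluated at t - τ ≥ t - a; the extra 1 places it strictly inside the
  -- open tail.
  have h1 : Tendsto (fun t : ℝ => t - a - 1) atTop atTop := by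
    refine (tendsto_atTop_add_const_right atTop (-(a + 1)) tendsto_id).congr fun t => ?_
    simp only [id]; ring
  have h2 := ENNReal.Tendsto.mul_const (b := C) ((tendsto_setLIntegral_Ioi hg).comp h1)
    (Or.inr hC)
  rw [zero_mul] at h2
  refine tendsto_of_tendsto_of_tendsto_of_le_of_le tendsto_const_nhds h2
    (fun _ => zero_le) fun t => ?_
  simp only [Function.comp]
  rw [← setLIntegral_reflect g t, ← lintegral_mul_const' _ _ hC]
  calc _ ≤ ∫⁻ τ in Ioc 0 a, g (t - τ) * C := by
        refine setLIntegral_mono' measurableSet_Ioc fun τ hτ => ?_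
        gcongr
        exact hu τ hτ
    _ ≤ _ := lintegral_mono_set fun τ hτ => by
        simp only [mem_preimage, mem_Ioi]
        linarith [hτ.2]

lemma limsup_add_le_add {α : Type*} {f : Filter α} (u v : α → ℝ≥0∞) :
    limsup (fun x => u x + v x) f ≤ limsup u f + limsup v f := by
  by_cases hU : limsup u f = ∞
  · simp [hU]
  by_cases hV : limsup v f = ∞
  · simp [hV]
  refine ENNReal.le_of_forall_pos_le_add fun η hη _ => ?_
  have hη2 : ((η / 2 : NNReal) : ℝ≥0∞) ≠ 0 := by
    have : η / 2 ≠ 0 := (half_pos hη).ne'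
    exact_mod_cast this
  have h1 := eventually_lt_of_limsup_lt (ENNReal.lt_add_right hU hη2)
  have h2 := eventually_lt_of_limsup_lt (ENNReal.lt_add_right hV hη2)
  refine limsup_le_of_le (by isBoundedDefault) ?_
  filter_upwards [h1, h2] with x hx1 hx2
  calc u x + v x ≤ (limsup u f + (η / 2 : NNReal)) + (limsup v f + (η / 2 : NNReal)) :=
        add_le_add hx1.le hx2.le
    _ = limsup u f + limsup v f + ((η / 2 : NNReal) + (η / 2 : NNReal) : ℝ≥0∞) := by ring
    _ = _ := by rw [← ENNReal.coe_add, add_halves]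

lemma le_mul_of_forall_lt {x c L : ℝ≥0∞} (hL : L ≠ ∞)
    (h : ∀ L', L < L' → L' ≠ ∞ → x ≤ c * L') (h0 : c ≠ ∞) : x ≤ c * L := by
  have h1 : Tendsto (fun η : ℝ≥0∞ => c * (L + η)) (𝓝[>] 0) (𝓝 (c * (L + 0))) := by
    refine ENNReal.Tendsto.const_mul ?_ (Or.inr h0)
    exact ((continuous_const.add continuous_id).tendsto 0).mono_left nhdsWithin_le_nhds
  rw [add_zero] at h1
  refine ge_of_tendsto h1 ?_
  have h2 : ∀ᶠ η : ℝ≥0∞ in 𝓝[>] 0, η < 1 :=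
    nhdsWithin_le_nhds (Iio_mem_nhds one_pos)
  filter_upwards [self_mem_nhdsWithin, h2] with η hη hη1
  exact h _ (ENNReal.lt_add_right hL (ne_of_gt hη))
    (ENNReal.add_ne_top.2 ⟨hL, (hη1.trans ENNReal.one_lt_top).ne⟩)

/-- The limit superior of a convolution with a kernel of finite mass. -/
lemma limsup_conv_le {g u : ℝ → ℝ≥0∞} (hg : ∫⁻ τ in Ioi (0 : ℝ), g τ ≠ ∞) {C : ℝ≥0∞}
    (hC : C ≠ ∞) (hu : ∀ τ, 0 < τ → u τ ≤ C) :
    limsup (fun t => ∫⁻ τ in Ioo 0 t, g (t - τ) * u τ) atTop ≤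
      (∫⁻ τ in Ioi (0 : ℝ), g τ) * limsup u atTop := by
  have hL : limsup u atTop ≠ ∞ := by
    refine ((limsup_le_of_le (by isBoundedDefault) ?_).trans_lt hC.lt_top).ne
    filter_upwards [Ioi_mem_atTop 0] with τ hτ
    exact hu τ hτ
  refine le_mul_of_forall_lt hL (fun L' hL' hL't => ?_) hg
  obtain ⟨a, ha⟩ := eventually_atTop.1 (eventually_lt_of_limsup_lt hL')
  set a' := max a 0
  -- Past a' the input is at most L'; the window before a' meets only the vanishing tail of the
  -- kernel.
  have h1 := tendsto_setLIntegral_conv_head hg hC (u := u) (a := a') fun τ hτ => hu τ hτ.1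
  have h2 : ∀ᶠ t in atTop, ∫⁻ τ in Ioo 0 t, g (t - τ) * u τ ≤
      (∫⁻ τ in Ioc 0 a', g (t - τ) * u τ) + (∫⁻ τ in Ioi (0 : ℝ), g τ) * L' := by
    filter_upwards with t
    have hsub : Ioo 0 t ⊆ Ioc 0 a' ∪ Ioo a' t := by
      intro τ hτ
      rcases le_or_gt τ a' with h | h
      · exact Or.inl ⟨hτ.1, h⟩
      · exact Or.inr ⟨h, hτ.2⟩
    refine (lintegral_mono_set hsub).trans ((lintegral_union_le _ _ _).trans ?_)
    gcongr
    refine (setLIntegral_conv_le g u hL't fun τ hτ =>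
      (ha τ ((le_max_left a 0).trans hτ.1.le)).le).trans ?_
    gcongr
    exact Ioo_subset_Ioi_self
  refine (limsup_le_limsup h2).trans ?_
  refine (limsup_add_le_add _ _).trans ?_
  rw [h1.limsup_eq, zero_add, limsup_const]

end Convolution

/-! ### Integration by parts in the error equation -/

/-- K' = -kB and K(0) = 1, so K(t-τ)e(τ) has derivative kB(t-τ)e(τ) + K(t-τ)e'(τ). The starting time
a is free so that the asymptotic estimate can discard an early interval; the bound on e' makes it
integrable. -/
lemma error_integral_eq {K kB e : ℝ → ℝ} (hkc : ContinuousOn kB (Ioi 0))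
    (hki : IntegrableOn kB (Ioi 0)) (hK : ∀ t, 0 ≤ t → K t = 1 - ∫ τ in (0 : ℝ)..t, kB τ)
    {a t C : ℝ} (hat : a ≤ t) (he : ContinuousOn e (Icc a t))
    (hd : ∀ τ ∈ Ioo a t, DifferentiableAt ℝ e τ) (hC : ∀ τ ∈ Ioo a t, ‖deriv e τ‖ ≤ C) :
    e t - ∫ τ in a..t, kB (t - τ) * e τ =
      K (t - a) * e a + ∫ τ in a..t, K (t - τ) * deriv e τ := by
  have hkI : ∀ x, 0 ≤ x → IntervalIntegrable kB volume 0 x := fun x hx => by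
    rw [intervalIntegrable_iff_integrableOn_Ioc_of_le hx]
    exact hki.mono_set Ioc_subset_Ioi_self
  have hK' : ∀ x, 0 < x → HasDerivAt K (-kB x) x := by
    intro x hx
    have h1 := (intervalIntegral.integral_hasDerivAt_right (hkI x hx.le)
      (hkc.stronglyMeasurableAtFilter isOpen_Ioi x hx)
      (hkc.continuousAt (Ioi_mem_nhds hx))).const_sub 1
    refine h1.congr_of_eventuallyEq ?_
    filter_upwards [Ioi_mem_nhds hx] with y hy
    exact hK y (le_of_lt hy)
  have hKc : ContinuousOn K (Icc 0 (t - a)) := by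
    have h1 := intervalIntegral.continuousOn_primitive_interval' (hkI (t - a) (sub_nonneg.2 hat))
      left_mem_uIcc
    rw [uIcc_of_le (sub_nonneg.2 hat)] at h1
    exact (continuousOn_const.sub h1).congr fun x hx => hK x hx.1
  have hKr : ContinuousOn (fun τ => K (t - τ)) (Icc a t) :=
    hKc.comp (continuousOn_const.sub continuousOn_id) fun τ hτ =>
      ⟨sub_nonneg.2 hτ.2, sub_le_sub_left hτ.1 t⟩
  have hI1 : IntervalIntegrable (fun τ => kB (t - τ) * e τ) volume a t := by
    refine (Plant.IsOutput.intervalIntegrable_reflect hki hat).mul_continuousOn ?_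
    rwa [uIcc_of_le hat]
  have hde : IntervalIntegrable (deriv e) volume a t := by
    refine (intervalIntegrable_const (c := C)).mono_fun' (measurable_deriv e).aestronglyMeasurable ?_
    rw [uIoc_of_le hat, ← restrict_Ioo_eq_restrict_Ioc]
    exact (ae_restrict_iff' measurableSet_Ioo).2 (Eventually.of_forall hC)
  have hI2 : IntervalIntegrable (fun τ => K (t - τ) * deriv e τ) volume a t := by
    refine hde.continuousOn_mul ?_
    rwa [uIcc_of_le hat]
  have h1 := intervalIntegral.integral_eq_sub_of_hasDerivAt_of_le (f := fun τ => K (t - τ) * e τ)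
    (f' := fun τ => kB (t - τ) * e τ + K (t - τ) * deriv e τ) hat (hKr.mul he)
    (fun τ hτ => ?_) (hI1.add hI2)
  · rw [intervalIntegral.integral_add hI1 hI2, sub_self, hK 0 le_rfl,
      intervalIntegral.integral_same] at h1
    linarith
  · have h2 := ((hK' _ (sub_pos.2 hτ.2)).comp_const_sub t τ).mul (hd τ hτ).hasDerivAt
    rw [neg_neg] at h2
    exact h2

namespace Plant

/-! ### Bounds for one step of the iteration -/

variable {Z : Type*} [NormedAddCommGroup Z] [InnerProductSpace ℝ Z] [CompleteSpace Z]
  {P : Plant Z} {S : C0Semigroup P.X}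

lemma posNormNeg_eq_imageNorm (T : C0Semigroup Z) (s σ : ℝ) (x : NegSpace T s) :
    posNormNeg T s σ x = imageNorm ((inclL T s).comp (negPow T σ)) x := by
  refine le_antisymm ?_ ?_
  · refine le_iInf₂ fun v hv => ?_
    exact iInf_le_of_le (negPow T σ v) (iInf_le_of_le hv
      (iInf_le_of_le v (iInf_le_of_le rfl le_rfl)))
  · refine le_iInf₂ fun φ hφ => le_iInf₂ fun v hv => ?_
    refine iInf_le_of_le v (iInf_le_of_le ?_ le_rfl)
    rw [ContinuousLinearMap.comp_apply, hv, inclL_apply, hφ]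

lemma posNorm_negPow_le (T : C0Semigroup Z) (s : ℝ) (v : Z) :
    posNorm T s (negPow T s v) ≤ ‖v‖ₑ :=
  imageNorm_apply_le (negPow T s) v

lemma Assumptions.posNorm_le_posNormNeg (hP : P.Assumptions) (φ : Z) :
    posNorm P.T P.s1 φ ≤ posNormNeg P.T (max P.sb P.sd) P.s1 (P.ι φ) := by
  refine le_iInf₂ fun ψ hψ => ?_
  rw [hP.ι_injective hψ]

/-- A positively homogeneous function is controlled by its supremum over the unit ball. -/
lemma le_iSup_mul_enorm {N : Z → ℝ≥0∞} (hN : ∀ (r : ℝ) φ, N (r • φ) ≤ ‖r‖ₑ * N φ) (φ : Z) :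
    N φ ≤ (⨆ (ψ : Z) (_ : ‖ψ‖ ≤ 1), N ψ) * ‖φ‖ₑ := by
  rcases eq_or_ne φ 0 with rfl | hφ
  · have := hN 0 0
    simpa using this
  have hn : ‖φ‖ ≠ 0 := norm_ne_zero_iff.2 hφ
  have h1 : φ = ‖φ‖ • (‖φ‖⁻¹ • φ) := by rw [smul_smul, mul_inv_cancel₀ hn, one_smul]
  have h2 : ‖‖φ‖⁻¹ • φ‖ ≤ 1 := by
    rw [norm_smul, norm_inv, norm_norm, inv_mul_cancel₀ hn]
  calc N φ = N (‖φ‖ • (‖φ‖⁻¹ • φ)) := by rw [← h1]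
    _ ≤ ‖‖φ‖‖ₑ * N (‖φ‖⁻¹ • φ) := hN _ _
    _ ≤ ‖φ‖ₑ * ⨆ (ψ : Z) (_ : ‖ψ‖ ≤ 1), N ψ := by
        rw [enorm_norm]
        gcongr
        exact le_iSup₂ (f := fun (ψ : Z) (_ : ‖ψ‖ ≤ 1) => N ψ) _ h2
    _ = _ := mul_comm _ _

lemma ι_smul (r : ℝ) (φ : Z) : P.ι (r • φ) = r • P.ι φ := map_smul (inclL _ _) r φ

lemma ι_zero : P.ι 0 = 0 := map_zero (inclL P.T (max P.sb P.sd))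

lemma continuous_ι : Continuous P.ι := (inclL P.T (max P.sb P.sd)).continuous

namespace IsOutput

variable {k : ℝ → ℝ} {O : ℝ → StrongDual ℝ P.X} {κ : StrongDual ℝ P.X} {J : P.X →L[ℝ] P.X}

lemma K_eq (h : IsOutput P S k O κ J) (hP : P.Assumptions) (t : ℝ) :
    P.K S t = -κ (S.op t P.B) := by
  have := hP.β_pos.ne'
  rw [K, h.out_Aβinv]
  field_simp

/-- The output integral of S(τ)B is β(κ S(t)B - κ B) with κ B = -1, so K is one minus the step
response from the previous error. -/
lemma K_eq_integral (h : IsOutput P S k O κ J) (hP : P.Assumptions) {t : ℝ} (ht : 0 ≤ t) :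
    P.K S t = 1 - ∫ τ in (0 : ℝ)..t, P.β⁻¹ * O τ P.B := by
  have := hP.β_pos.ne'
  rw [h.K_eq hP, intervalIntegral.integral_const_mul, h.integral_eq _ _ ht, h.κ_B]
  field_simp
  ring

lemma continuousOn_K (h : IsOutput P S k O κ J) (hP : P.Assumptions) :
    ContinuousOn (P.K S) (Ici 0) :=
  ((κ.continuous.comp_continuousOn (S.continuousOn P.B)).neg).congr fun t _ => h.K_eq hP t

lemma exists_K_bound (h : IsOutput P S k O κ J) (hP : P.Assumptions) :
    ∃ M ω : ℝ, 0 < ω ∧ ∀ t, 0 ≤ t → ‖P.K S t‖ ≤ M * Real.exp (-ω * t) := by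
  obtain ⟨M, ω, -, hω, hb⟩ := h.stable
  refine ⟨‖κ‖ * M * ‖P.B‖, ω, hω, fun t ht => ?_⟩
  rw [h.K_eq hP, norm_neg]
  calc ‖κ (S.op t P.B)‖ ≤ ‖κ‖ * (M * Real.exp (-ω * t) * ‖P.B‖) :=
        (κ.le_opNorm _).trans (by gcongr; exact (S.op t).le_of_opNorm_le (hb t ht) _)
    _ = _ := by ring

lemma tendsto_K (h : IsOutput P S k O κ J) (hP : P.Assumptions) :
    Tendsto (P.K S) atTop (𝓝 0) := by
  obtain ⟨M, ω, hω, hb⟩ := h.exists_K_bound hP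
  have h1 : Tendsto (fun t => M * Real.exp (-ω * t)) atTop (𝓝 (M * 0)) := by
    refine (Real.tendsto_exp_atBot.comp ?_).const_mul M
    exact tendsto_id.const_mul_atTop_of_neg (neg_lt_zero.2 hω)
  rw [mul_zero] at h1
  refine squeeze_zero_norm' ?_ h1
  filter_upwards [Ici_mem_atTop 0] with t ht
  exact hb t ht

lemma D_lt_top (h : IsOutput P S k O κ J) (hP : P.Assumptions) : P.D S < ∞ := by
  obtain ⟨M, ω, hω, hb⟩ := h.exists_K_bound hP
  have hi : IntegrableOn (P.K S) (Ioi 0) := by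
    refine Integrable.mono' ((integrableOn_exp_mul_Ioi (neg_lt_zero.2 hω) 0).const_mul M)
      (((h.continuousOn_K hP).mono Ioi_subset_Ici_self).aestronglyMeasurable measurableSet_Ioi) ?_
    exact (ae_restrict_iff' measurableSet_Ioi).2
      (Eventually.of_forall fun t ht => hb t (le_of_lt ht))
  exact hi.hasFiniteIntegral

/-- K is continuous with K(0) = 1. Nonvanishing of D makes the final bound trivial when the signal
norm is infinite, despite 0·∞ = 0. -/
lemma D_ne_zero (h : IsOutput P S k O κ J) (hP : P.Assumptions) : P.D S ≠ 0 := by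
  have h0 : P.K S 0 = 1 := by rw [h.K_eq hP, S.op_zero_apply, h.κ_B, neg_neg]
  have h1 : Tendsto (P.K S) (𝓝[≥] 0) (𝓝 1) := h0 ▸ (h.continuousOn_K hP) 0 self_mem_Ici
  have h2 : ∀ᶠ t in 𝓝[≥] (0 : ℝ), (1 / 2 : ℝ) < P.K S t :=
    h1.eventually (Ioi_mem_nhds (by norm_num))
  obtain ⟨δ, hδ, hsub⟩ := mem_nhdsGE_iff_exists_Ico_subset.1 h2
  have hδ' : (0 : ℝ) < δ := hδ
  have h3 : ∫⁻ _ in Ioo 0 δ, ENNReal.ofReal (1 / 2) ≤ P.D S := by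
    refine le_trans (setLIntegral_mono' measurableSet_Ioo fun t ht => ?_)
      (lintegral_mono_set Ioo_subset_Ioi_self)
    rw [← ofReal_norm]
    refine ENNReal.ofReal_le_ofReal ((le_of_lt ?_).trans (le_abs_self _))
    exact hsub ⟨ht.1.le, ht.2⟩
  intro hD
  rw [hD, setLIntegral_const, Real.volume_Ioo, nonpos_iff_eq_zero, mul_eq_zero] at h3
  rcases h3 with h3 | h3 <;> rw [ENNReal.ofReal_eq_zero] at h3 <;> linarith

/-- The operator norm of `C e^{A_β t} I_0 : Z → ℝ`. -/
def outNorm (S : C0Semigroup P.X) (t : ℝ) : ℝ≥0∞ :=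
  ⨆ (φ : Z) (_ : ‖φ‖ ≤ 1), ‖P.out (S.op t (P.I0 (P.ι φ)))‖ₑ

lemma DH_lt_top (h : IsOutput P S k O κ J) : P.DH S < ∞ := by
  set Q : Z →L[ℝ] P.X := J.comp (inclL P.T (max P.sb P.sd))
  have h1 : P.DH S ≤ ∫⁻ t in Ioi (0 : ℝ), ‖k t‖ₑ * ‖Q‖ₑ := by
    refine setLIntegral_mono' measurableSet_Ioi fun t ht => iSup₂_le fun φ hφ => ?_
    rw [h.I0_eq, h.out_op t ht]
    have hφ' : ‖φ‖ₑ ≤ 1 := by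
      rw [← ofReal_norm, ← ENNReal.ofReal_one]; exact ENNReal.ofReal_le_ofReal hφ
    have hO : ‖O t‖ₑ ≤ ‖k t‖ₑ := by
      rw [← ofReal_norm, ← ofReal_norm]
      exact ENNReal.ofReal_le_ofReal ((h.norm_le t ht).trans (le_abs_self _))
    calc ‖O t (Q φ)‖ₑ ≤ ‖O t‖ₑ * (‖Q‖ₑ * ‖φ‖ₑ) :=
          ((O t).le_opENorm _).trans (by gcongr; exact Q.le_opENorm φ)
      _ ≤ ‖k t‖ₑ * (‖Q‖ₑ * 1) := by gcongr
      _ = _ := by rw [mul_one]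
  refine h1.trans_lt ?_
  rw [lintegral_mul_const' _ _ enorm_ne_top]
  exact ENNReal.mul_lt_top h.integrable.hasFiniteIntegral enorm_lt_top

end IsOutput

/-- One step of the iteration: the state `y` is driven by the nonlinear increment `F` and by the
previous error `e`. -/
structure IsStep (P : Plant Z) (S : C0Semigroup P.X) (e : ℝ → ℝ) (F y : ℝ → Z) : Prop where
  e_cont : ContinuousOn e (Ici 0)
  F_cont : ContinuousOn F (Ici 0)
  F_le : ∀ t, ‖F t‖ₑ ≤ ENNReal.ofReal P.ε * posNorm P.T P.s1 (y t)
  y_bdd : ∀ t, ∃ C : ℝ≥0∞, C ≠ ∞ ∧ ∀ τ ∈ Icc 0 t, posNorm P.T P.s1 (y τ) ≤ C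
  formula : ∀ t, 0 ≤ t → P.ι (y t) = ∫ τ in (0 : ℝ)..t,
    S.op (t - τ) (P.I0 (P.ι (F τ)) + (P.β⁻¹ * e τ) • P.B)

/-! ### A priori, finite-time and asymptotic estimates for one step -/

namespace IsStep

variable {k : ℝ → ℝ} {O : ℝ → StrongDual ℝ P.X} {κ : StrongDual ℝ P.X} {J : P.X →L[ℝ] P.X}
  {e : ℝ → ℝ} {F y : ℝ → Z}

/-- The operator norm of `e^{A_β t} I_0 : Z → Z^{s_1}`. -/
def stateNorm (S : C0Semigroup P.X) (t : ℝ) : ℝ≥0∞ :=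
  ⨆ (φ : Z) (_ : ‖φ‖ ≤ 1), posNormNeg P.T (max P.sb P.sd) P.s1 (S.op t (P.I0 (P.ι φ)))

/-- The norm of `β⁻¹ e^{A_β t} B` in `Z^{s_1}`. -/
def inputNorm (S : C0Semigroup P.X) (t : ℝ) : ℝ≥0∞ :=
  posNormNeg P.T (max P.sb P.sd) P.s1 (P.β⁻¹ • S.op t P.B)

lemma posNorm_le (hs : IsStep P S e F y) (h : IsOutput P S k O κ J) (hP : P.Assumptions)
    {t : ℝ} (ht : 0 ≤ t) :
    posNorm P.T P.s1 (y t) ≤ (∫⁻ τ in Ioo 0 t, stateNorm S (t - τ) * ‖F τ‖ₑ) +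
      ∫⁻ τ in Ioo 0 t, inputNorm S (t - τ) * ‖e τ‖ₑ := by
  refine (hP.posNorm_le_posNormNeg _).trans ?_
  rw [posNormNeg_eq_imageNorm, hs.formula t ht, intervalIntegral.integral_of_le ht,
    integral_Ioc_eq_integral_Ioo]
  refine (imageNorm_integral_le _ _).trans ?_
  -- Additivity needs only one measurable summand. The input term is chosen: a lower semicontinuous
  -- norm along a continuous orbit, times |e|.
  rw [← lintegral_add_right']
  · refine lintegral_mono fun τ => ?_
    rw [map_add, map_smul, mul_comm P.β⁻¹, mul_smul]
    refine (imageNorm_add_le _ _ _).trans (add_le_add ?_ ?_)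
    · have h1 := le_iSup_mul_enorm
        (N := fun φ => posNormNeg P.T (max P.sb P.sd) P.s1 (S.op (t - τ) (P.I0 (P.ι φ))))
        (fun r φ => by
          rw [posNormNeg_eq_imageNorm, posNormNeg_eq_imageNorm, ι_smul, h.I0_eq, h.I0_eq,
            map_smul, map_smul]
          exact imageNorm_smul_le _ _ _) (F τ)
      rw [posNormNeg_eq_imageNorm] at h1
      exact h1
    · rw [inputNorm, posNormNeg_eq_imageNorm, mul_comm]
      exact imageNorm_smul_le _ _ _
  · refine AEMeasurable.mul ?_ ?_
    · simp only [inputNorm, posNormNeg_eq_imageNorm]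
      borelize P.X
      refine (lowerSemicontinuous_imageNorm _).measurable.comp_aemeasurable ?_
      have hc : ContinuousOn (fun τ => S.op (t - τ) P.B) (Ioo 0 t) :=
        h.stable.continuousOn_op_comp (continuousOn_const.sub continuousOn_id)
          (fun τ hτ => sub_nonneg.2 hτ.2.le) continuousOn_const
      exact ((hc.const_smul P.β⁻¹).aestronglyMeasurable measurableSet_Ioo).aemeasurable
    · exact ((hs.e_cont.mono fun τ hτ => hτ.1.le).aestronglyMeasurable
        measurableSet_Ioo).aemeasurable.enorm

lemma out_eq (hs : IsStep P S e F y) (h : IsOutput P S k O κ J) {t : ℝ} (ht : 0 ≤ t) :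
    P.out (P.ι (y t)) = (∫ τ in (0 : ℝ)..t, O (t - τ) (J (P.ι (F τ)))) +
      ∫ τ in (0 : ℝ)..t, (P.β⁻¹ * O (t - τ) P.B) * e τ := by
  have hF : ContinuousOn (fun τ => J (P.ι (F τ))) (Icc 0 t) :=
    (J.continuous.comp continuous_ι).comp_continuousOn (hs.F_cont.mono Icc_subset_Ici_self)
  have he : ContinuousOn (fun τ => (P.β⁻¹ * e τ) • P.B) (Icc 0 t) :=
    (continuousOn_const.mul (hs.e_cont.mono Icc_subset_Ici_self)).smul continuousOn_const
  have h1 := h.out_integral (y t) t (fun τ => J (P.ι (F τ)) + (P.β⁻¹ * e τ) • P.B) ht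
    (hF.add he) (by rw [hs.formula t ht]; simp only [h.I0_eq])
  rw [h1]
  simp only [map_add]
  rw [intervalIntegral.integral_add (h.intervalIntegrable ht hF) (h.intervalIntegrable ht he)]
  congr 1
  refine intervalIntegral.integral_congr fun τ _ => ?_
  simp only [map_smul, smul_eq_mul]
  ring

lemma enorm_integral_out_le (h : IsOutput P S k O κ J) {t : ℝ} (ht : 0 ≤ t) :
    ‖∫ τ in (0 : ℝ)..t, O (t - τ) (J (P.ι (F τ)))‖ₑ ≤
      ∫⁻ τ in Ioo 0 t, IsOutput.outNorm S (t - τ) * ‖F τ‖ₑ := by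
  rw [intervalIntegral.integral_of_le ht, integral_Ioc_eq_integral_Ioo]
  refine (enorm_integral_le_lintegral_enorm _).trans
    (setLIntegral_mono' measurableSet_Ioo fun τ hτ => ?_)
  have h1 := le_iSup_mul_enorm (N := fun φ => ‖P.out (S.op (t - τ) (P.I0 (P.ι φ)))‖ₑ)
    (fun r φ => by
      have hpos := sub_pos.2 hτ.2
      rw [ι_smul, h.I0_eq, h.I0_eq, map_smul, h.out_op _ hpos, h.out_op _ hpos, map_smul,
        enorm_smul]) (F τ)
  rw [← h.out_op _ (sub_pos.2 hτ.2), ← h.I0_eq]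
  exact h1

/-- The a priori bound of the state by the previous error. -/
lemma posNorm_le_of_bound (hs : IsStep P S e F y) (h : IsOutput P S k O κ J) (hP : P.Assumptions)
    {t : ℝ} {I : Set ℝ} (hI : Ioo 0 t ⊆ I) (hA : ENNReal.ofReal P.ε * P.DA S I < 1)
    {E : ℝ≥0∞} (hE : E ≠ ∞) (he : ∀ τ ∈ Ioo 0 t, ‖e τ‖ₑ ≤ E) :
    ∀ τ ∈ Ioo 0 t, posNorm P.T P.s1 (y τ) ≤
      P.DB S I * E / (1 - ENNReal.ofReal P.ε * P.DA S I) := by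
  set m : ℝ≥0∞ := ⨆ τ ∈ Ioo 0 t, posNorm P.T P.s1 (y τ) with hm
  have hle : ∀ τ ∈ Ioo 0 t, posNorm P.T P.s1 (y τ) ≤ m := fun τ hτ =>
    le_iSup₂ (f := fun τ (_ : τ ∈ Ioo 0 t) => posNorm P.T P.s1 (y τ)) τ hτ
  -- Continuity of y into Z^{s_1} makes m finite beforehand; otherwise it could not be absorbed.
  have hmt : m ≠ ∞ := by
    obtain ⟨C, hC, hb⟩ := hs.y_bdd t
    exact ((iSup₂_le fun τ hτ => hb τ (Ioo_subset_Icc_self hτ)).trans_lt hC.lt_top).ne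
  have key : m ≤ m * (ENNReal.ofReal P.ε * P.DA S I) + P.DB S I * E := by
    refine iSup₂_le fun τ hτ => ?_
    have hsub : Ioo 0 (τ - 0) ⊆ I := by
      rw [sub_zero]; exact (Ioo_subset_Ioo_right hτ.2.le).trans hI
    have h1 := setLIntegral_conv_le (stateNorm S) (fun σ => ‖F σ‖ₑ) (a := 0) (t := τ)
      (C := ENNReal.ofReal P.ε * m) (ENNReal.mul_ne_top ENNReal.ofReal_ne_top hmt)
      (fun σ hσ => (hs.F_le σ).trans (by gcongr; exact hle σ ⟨hσ.1, hσ.2.trans hτ.2⟩))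
    have h2 := setLIntegral_conv_le (inputNorm S) (fun σ => ‖e σ‖ₑ) (a := 0) (t := τ)
      hE (fun σ hσ => he σ ⟨hσ.1, hσ.2.trans hτ.2⟩)
    refine (hs.posNorm_le h hP hτ.1.le).trans (add_le_add (h1.trans ?_) (h2.trans ?_))
    · calc _ ≤ P.DA S I * (ENNReal.ofReal P.ε * m) := by
            gcongr
            exact lintegral_mono_set hsub
        _ = _ := by ring
    · gcongr
      exact lintegral_mono_set hsub
  intro τ hτ
  refine (hle τ hτ).trans ?_
  rw [ENNReal.le_div_iff_mul_le (Or.inl (tsub_pos_of_lt hA).ne')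
    (Or.inl (ENNReal.sub_ne_top ENNReal.one_ne_top)), ENNReal.mul_sub fun _ _ => hmt, mul_one,
    tsub_le_iff_left]
  exact key

lemma integral_parts (hs : IsStep P S e F y) (h : IsOutput P S k O κ J) (hP : P.Assumptions)
    {a t C : ℝ} (ha : 0 ≤ a) (hat : a ≤ t) (hd : ∀ τ ∈ Ioo a t, DifferentiableAt ℝ e τ)
    (hC : ∀ τ ∈ Ioo a t, ‖deriv e τ‖ ≤ C) :
    e t - ∫ τ in a..t, (P.β⁻¹ * O (t - τ) P.B) * e τ =
      P.K S (t - a) * e a + ∫ τ in a..t, P.K S (t - τ) * deriv e τ :=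
  error_integral_eq (kB := fun τ => P.β⁻¹ * O τ P.B)
    (continuousOn_const.mul (h.continuousOn_apply P.B)) ((h.integrableOn_apply P.B).const_mul _)
    (fun _ ht => h.K_eq_integral hP ht) hat
    (hs.e_cont.mono fun _ hτ => ha.trans hτ.1) hd hC

lemma enorm_integral_K_le {u : ℝ → ℝ} {a t : ℝ} {C : ℝ≥0∞} (hat : a ≤ t) (hC : C ≠ ∞)
    (hu : ∀ τ ∈ Ioo a t, ‖u τ‖ₑ ≤ C) :
    ‖∫ τ in a..t, P.K S (t - τ) * u τ‖ₑ ≤ P.D S * C := by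
  rw [intervalIntegral.integral_of_le hat, integral_Ioc_eq_integral_Ioo]
  refine (enorm_integral_le_lintegral_enorm _).trans ?_
  simp only [enorm_mul]
  refine (setLIntegral_conv_le (fun τ => ‖P.K S τ‖ₑ) (fun τ => ‖u τ‖ₑ) hC hu).trans ?_
  gcongr
  exact lintegral_mono_set Ioo_subset_Ioi_self

lemma supNorm_ne_top {e : ℝ → ℝ} (he : ContinuousOn e (Ici 0)) (t : ℝ) : supNorm t e ≠ ∞ := by
  obtain ⟨C, hC⟩ := isCompact_Icc.exists_bound_of_continuousOn
    (he.mono (Icc_subset_Ici_self : Icc 0 t ⊆ Ici 0))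
  refine ((iSup₂_le fun τ hτ => ?_).trans_lt (ENNReal.ofReal_lt_top (r := C))).ne
  rw [← ofReal_norm]
  exact ENNReal.ofReal_le_ofReal (hC τ (Ioo_subset_Icc_self hτ))

/-- After the transient is removed, the error is the convolution of K with e' minus the output of F.
The first is bounded by D, the second by D_H and the a priori bound of y. -/
lemma supNorm_error_le (hs : IsStep P S e F y) (h : IsOutput P S k O κ J) (hP : P.Assumptions)
    {t : ℝ} (hd : ContDiffOn ℝ 1 e (Ioo 0 t))
    (hA : ENNReal.ofReal P.ε * P.DA S (Ioo 0 t) < 1) :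
    supNorm t (fun τ => e τ - P.out (P.ι (y τ)) - P.K S τ * e 0) ≤
      (P.D S + P.DD S (Ioo 0 t)) * supNormOne t e := by
  by_cases htop : supNorm t (deriv e) = ∞
  · rw [supNormOne, htop, max_eq_right le_top, ENNReal.mul_top]
    · exact le_top
    · simp [h.D_ne_zero hP]
  have hE := supNorm_ne_top hs.e_cont t
  have heE : ∀ τ ∈ Ioo 0 t, ‖e τ‖ₑ ≤ supNorm t e := fun τ hτ =>
    le_iSup₂ (f := fun τ (_ : τ ∈ Ioo 0 t) => ‖e τ‖ₑ) τ hτ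
  have hdE : ∀ τ ∈ Ioo 0 t, ‖deriv e τ‖ₑ ≤ supNorm t (deriv e) := fun τ hτ =>
    le_iSup₂ (f := fun τ (_ : τ ∈ Ioo 0 t) => ‖deriv e τ‖ₑ) τ hτ
  set q := 1 - ENNReal.ofReal P.ε * P.DA S (Ioo 0 t) with hq
  have hy := hs.posNorm_le_of_bound h hP subset_rfl hA hE heE
  -- D_B may be infinite, while the convolution estimate needs a finite constant; hence the minimum
  -- with the a priori bound.
  have hyfin : ∃ C : ℝ≥0∞, C ≠ ∞ ∧ (∀ τ ∈ Ioo 0 t, posNorm P.T P.s1 (y τ) ≤ C) ∧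
      C ≤ P.DB S (Ioo 0 t) * supNorm t e / q := by
    obtain ⟨C, hC, hb⟩ := hs.y_bdd t
    exact ⟨min C (P.DB S (Ioo 0 t) * supNorm t e / q), ((min_le_left _ _).trans_lt hC.lt_top).ne,
      fun τ hτ => le_min (hb τ (Ioo_subset_Icc_self hτ)) (hy τ hτ), min_le_right _ _⟩
  obtain ⟨C, hC, hyC, hCle⟩ := hyfin
  refine iSup₂_le fun τ hτ => ?_
  have h1 := hs.integral_parts h hP (C := (supNorm t (deriv e)).toReal) le_rfl hτ.1.le
    (fun σ hσ => ((hd.differentiableOn one_ne_zero) σ ⟨hσ.1, hσ.2.trans hτ.2⟩).differentiableAt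
      (Ioo_mem_nhds hσ.1 (hσ.2.trans hτ.2)))
    (fun σ hσ => by
      rw [← toReal_enorm]
      exact ENNReal.toReal_mono htop (hdE σ ⟨hσ.1, hσ.2.trans hτ.2⟩))
  rw [sub_zero] at h1
  have h2 : e τ - P.out (P.ι (y τ)) - P.K S τ * e 0 =
      (∫ σ in (0 : ℝ)..τ, P.K S (τ - σ) * deriv e σ) -
        ∫ σ in (0 : ℝ)..τ, O (τ - σ) (J (P.ι (F σ))) := by
    rw [hs.out_eq h hτ.1.le]
    linarith
  beta_reduce
  rw [h2]
  have h3 := enorm_integral_K_le (P := P) (S := S) hτ.1.le htop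
    (fun σ (hσ : σ ∈ Ioo 0 τ) => hdE σ ⟨hσ.1, hσ.2.trans hτ.2⟩)
  have h4 := enorm_integral_out_le (F := F) h hτ.1.le
  have h5 := setLIntegral_conv_le (IsOutput.outNorm S) (fun σ => ‖F σ‖ₑ) (a := 0) (t := τ)
    (C := ENNReal.ofReal P.ε * C) (ENNReal.mul_ne_top ENNReal.ofReal_ne_top hC)
    (fun σ hσ => (hs.F_le σ).trans (by gcongr; exact hyC σ ⟨hσ.1, hσ.2.trans hτ.2⟩))
  have h6 : (∫⁻ σ in Ioo 0 (τ - 0), IsOutput.outNorm S σ) ≤ P.DH S :=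
    lintegral_mono_set Ioo_subset_Ioi_self
  calc _ ≤ P.D S * supNorm t (deriv e) + P.DH S * (ENNReal.ofReal P.ε * C) :=
        enorm_sub_le.trans (add_le_add h3 (h4.trans (h5.trans (by gcongr))))
    _ ≤ P.D S * supNorm t (deriv e) + P.DH S *
          (ENNReal.ofReal P.ε * (P.DB S (Ioo 0 t) * supNorm t e / q)) := by gcongr
    _ = P.D S * supNorm t (deriv e) + P.DD S (Ioo 0 t) * supNorm t e := by
        rw [DD, ← hq, div_eq_mul_inv, div_eq_mul_inv]; ring
    _ ≤ P.D S * supNormOne t e + P.DD S (Ioo 0 t) * supNormOne t e := by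
        gcongr
        · exact le_max_right _ _
        · exact le_max_left _ _
    _ = _ := by rw [add_mul]

/-- Integrating by parts from a late time a leaves K(t-a)e(a) and the convolution over (0, a], both
vanishing as t → ∞. After a, both e and e' are below any L' exceeding the limit superior. This also
avoids any bound on e' near 0. -/
lemma limsup_error_le (hs : IsStep P S e F y) (h : IsOutput P S k O κ J) (hP : P.Assumptions)
    (hd : ContDiffOn ℝ 1 e (Ioi 0)) (hB : P.DB S (Ioi 0) < ∞)
    (hA : ENNReal.ofReal P.ε * P.DA S (Ioi 0) < 1) :
    limsup (fun t => ‖e t - P.out (P.ι (y t))‖ₑ) atTop ≤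
      (P.D S + P.DD S (Ioi 0)) * limsup (fun t => max ‖e t‖ₑ ‖deriv e t‖ₑ) atTop := by
  set L := limsup (fun t => max ‖e t‖ₑ ‖deriv e t‖ₑ) atTop with hL
  by_cases htop : L = ∞
  · rw [htop, ENNReal.mul_top]
    · exact le_top
    · simp [h.D_ne_zero hP]
  have hε : 0 < ENNReal.ofReal P.ε := ENNReal.ofReal_pos.2 hP.ε_pos
  have hAt : P.DA S (Ioi 0) ≠ ∞ := by
    intro hA'
    rw [hA', ENNReal.mul_top hε.ne'] at hA
    exact not_top_lt hA
  set q := 1 - ENNReal.ofReal P.ε * P.DA S (Ioi 0) with hq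
  have hq0 : q ≠ 0 := (tsub_pos_of_lt hA).ne'
  have hqt : q ≠ ∞ := ENNReal.sub_ne_top ENNReal.one_ne_top
  -- global bound of the error and of the state
  obtain ⟨E, hE, heE⟩ : ∃ E : ℝ≥0∞, E ≠ ∞ ∧ ∀ τ, 0 < τ → ‖e τ‖ₑ ≤ E := by
    obtain ⟨a, ha⟩ := eventually_atTop.1
      (eventually_lt_of_limsup_lt (ENNReal.lt_add_right htop one_ne_zero))
    refine ⟨max (supNorm a e) (L + 1), ?_, fun τ hτ => ?_⟩
    · rw [ne_eq, max_eq_top, not_or]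
      exact ⟨supNorm_ne_top hs.e_cont a, ENNReal.add_ne_top.2 ⟨htop, ENNReal.one_ne_top⟩⟩
    · rcases lt_or_ge τ a with hτa | hτa
      · exact le_max_of_le_left
          (le_iSup₂ (f := fun τ (_ : τ ∈ Ioo 0 a) => ‖e τ‖ₑ) τ ⟨hτ, hτa⟩)
      · exact le_max_of_le_right ((le_max_left _ _).trans (ha τ hτa).le)
  set Y := P.DB S (Ioi 0) * E / q with hY
  have hYt : Y ≠ ∞ := ENNReal.div_ne_top (ENNReal.mul_ne_top hB.ne hE) hq0
  have hyY : ∀ τ, 0 < τ → posNorm P.T P.s1 (y τ) ≤ Y := fun τ hτ =>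
    hs.posNorm_le_of_bound h hP (t := τ + 1) Ioo_subset_Ioi_self hA hE
      (fun σ hσ => heE σ hσ.1) τ ⟨hτ, by linarith⟩
  have hFY : ∀ τ, 0 < τ → ‖F τ‖ₑ ≤ ENNReal.ofReal P.ε * Y := fun τ hτ =>
    (hs.F_le τ).trans (by gcongr; exact hyY τ hτ)
  have hFt : ENNReal.ofReal P.ε * Y ≠ ∞ := ENNReal.mul_ne_top ENNReal.ofReal_ne_top hYt
  set m := limsup (fun t => posNorm P.T P.s1 (y t)) atTop with hm
  have hmt : m ≠ ∞ := by
    refine ((limsup_le_of_le (by isBoundedDefault) ?_).trans_lt hYt.lt_top).ne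
    filter_upwards [Ioi_mem_atTop 0] with τ hτ
    exact hyY τ hτ
  have hFm : limsup (fun t => ‖F t‖ₑ) atTop ≤ ENNReal.ofReal P.ε * m := by
    rw [hm, ← ENNReal.limsup_const_mul_of_ne_top ENNReal.ofReal_ne_top]
    exact limsup_le_limsup (Eventually.of_forall hs.F_le)
  have heL : limsup (fun t => ‖e t‖ₑ) atTop ≤ L :=
    limsup_le_limsup (Eventually.of_forall fun t => le_max_left _ _)
  -- the asymptotic bound of the state
  have hmle : m ≤ P.DB S (Ioi 0) * L / q := by
    have h1 : m ≤ limsup (fun t => (∫⁻ τ in Ioo 0 t, stateNorm S (t - τ) * ‖F τ‖ₑ) +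
        ∫⁻ τ in Ioo 0 t, inputNorm S (t - τ) * ‖e τ‖ₑ) atTop := by
      refine limsup_le_limsup ?_
      filter_upwards [Ici_mem_atTop 0] with t ht
      exact hs.posNorm_le h hP ht
    have h2 := limsup_conv_le (g := stateNorm S) hAt hFt hFY
    have h3 := limsup_conv_le (g := inputNorm S) hB.ne hE heE
    -- The absorption argument again, now for limits superior; m is finite by the global bound Y.
    have key : m ≤ m * (ENNReal.ofReal P.ε * P.DA S (Ioi 0)) + P.DB S (Ioi 0) * L := by
      refine h1.trans ((limsup_add_le_add _ _).trans (add_le_add (h2.trans ?_) (h3.trans ?_)))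
      · calc _ ≤ P.DA S (Ioi 0) * (ENNReal.ofReal P.ε * m) := by
              gcongr
              exact le_rfl
          _ = _ := by ring
      · gcongr
        exact le_rfl
    rw [ENNReal.le_div_iff_mul_le (Or.inl hq0) (Or.inl hqt), hq,
      ENNReal.mul_sub fun _ _ => hmt, mul_one, tsub_le_iff_left]
    exact key
  have hDH := (h.DH_lt_top).ne
  have hlimO := limsup_conv_le (g := IsOutput.outNorm S) hDH hFt hFY
  have hDDt : P.DH S * (ENNReal.ofReal P.ε * m) ≤ P.DD S (Ioi 0) * L := by
    calc _ ≤ P.DH S * (ENNReal.ofReal P.ε * (P.DB S (Ioi 0) * L / q)) := by gcongr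
      _ = _ := by rw [DD, ← hq, div_eq_mul_inv, div_eq_mul_inv]; ring
  rw [add_mul]
  have hfin : limsup (fun t => ‖e t - P.out (P.ι (y t))‖ₑ) atTop ≤
      P.D S * L + P.DH S * (ENNReal.ofReal P.ε * m) := by
    have hstep : ∀ L', L < L' → L' ≠ ∞ → limsup (fun t => ‖e t - P.out (P.ι (y t))‖ₑ) atTop ≤
        P.D S * L' + P.DH S * (ENNReal.ofReal P.ε * m) := by
      intro L' hLL' hL't
      obtain ⟨a₀, ha₀⟩ := eventually_atTop.1 (eventually_lt_of_limsup_lt hLL')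
      -- Positivity of a keeps [a, ∞) inside the open half line on which e is C¹.
      set a := max a₀ 1 with ha
      have ha0 : 0 < a := lt_max_of_lt_right one_pos
      have haL : ∀ τ, a ≤ τ → max ‖e τ‖ₑ ‖deriv e τ‖ₑ ≤ L' := fun τ hτ =>
        (ha₀ τ ((le_max_left _ _).trans hτ)).le
      set kB : ℝ → ℝ := fun τ => P.β⁻¹ * O τ P.B with hkB
      have hkBi : IntegrableOn kB (Ioi 0) := (h.integrableOn_apply P.B).const_mul _
      have hhead := tendsto_setLIntegral_conv_head (g := fun τ => ‖kB τ‖ₑ)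
        (u := fun τ => ‖e τ‖ₑ) hkBi.hasFiniteIntegral.ne hE (a := a) fun τ hτ => heE τ hτ.1
      have htr : Tendsto (fun t => ‖P.K S (t - a)‖ₑ * ‖e a‖ₑ) atTop (𝓝 0) := by
        have h1 : Tendsto (fun t => P.K S (t - a) * e a) atTop (𝓝 (0 * e a)) :=
          ((h.tendsto_K hP).comp (tendsto_atTop_add_const_right atTop (-a) tendsto_id)).mul_const _
        rw [zero_mul] at h1
        have h2 := (continuous_enorm.tendsto (0 : ℝ)).comp h1
        rw [enorm_zero] at h2
        exact h2.congr fun t => enorm_mul _ _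
      have hev : ∀ᶠ t in atTop, ‖e t - P.out (P.ι (y t))‖ₑ ≤
          (‖P.K S (t - a)‖ₑ * ‖e a‖ₑ + ∫⁻ τ in Ioc 0 a, ‖kB (t - τ)‖ₑ * ‖e τ‖ₑ) +
          (P.D S * L' + ∫⁻ τ in Ioo 0 t, IsOutput.outNorm S (t - τ) * ‖F τ‖ₑ) := by
        filter_upwards [Ioi_mem_atTop a] with t hat
        have hat' : a ≤ t := le_of_lt hat
        have ht0 : 0 ≤ t := ha0.le.trans hat'
        have hp := hs.integral_parts h hP (C := L'.toReal) ha0.le hat'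
          (fun σ hσ => ((hd.differentiableOn one_ne_zero) σ (ha0.trans hσ.1)).differentiableAt
            (Ioi_mem_nhds (ha0.trans hσ.1)))
          (fun σ hσ => by
            rw [← toReal_enorm]
            exact ENNReal.toReal_mono hL't ((le_max_right _ _).trans (haL σ hσ.1.le)))
        have hI : IntervalIntegrable (fun τ => kB (t - τ) * e τ) volume 0 t := by
          refine (IsOutput.intervalIntegrable_reflect hkBi ht0).mul_continuousOn ?_
          rw [uIcc_of_le ht0]
          exact hs.e_cont.mono Icc_subset_Ici_self
        have hsplit := intervalIntegral.integral_add_adjacent_intervals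
          (hI.mono_set (by
            rw [uIcc_of_le ha0.le, uIcc_of_le ht0]; exact Icc_subset_Icc_right hat'))
          (hI.mono_set (c := a) (d := t) (by
            rw [uIcc_of_le hat', uIcc_of_le ht0]; exact Icc_subset_Icc_left ha0.le))
        -- The linear convolution is split at a and only its part over (a, t) is integrated by
        -- parts.
        have heq : e t - P.out (P.ι (y t)) =
            (P.K S (t - a) * e a - ∫ τ in (0 : ℝ)..a, kB (t - τ) * e τ) +
            ((∫ τ in a..t, P.K S (t - τ) * deriv e τ) -
              ∫ τ in (0 : ℝ)..t, O (t - τ) (J (P.ι (F τ)))) := by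
          rw [hs.out_eq h ht0]
          simp only [hkB] at hsplit ⊢
          linarith
        rw [heq]
        refine (enorm_add_le _ _).trans (add_le_add (enorm_sub_le.trans (add_le_add ?_ ?_))
          (enorm_sub_le.trans (add_le_add ?_ ?_)))
        · rw [enorm_mul]
        · rw [intervalIntegral.integral_of_le ha0.le]
          refine (enorm_integral_le_lintegral_enorm _).trans_eq ?_
          simp only [enorm_mul]
        · exact enorm_integral_K_le hat' hL't fun τ hτ =>
            (le_max_right _ _).trans (haL τ hτ.1.le)
        · exact enorm_integral_out_le h ht0
      refine (limsup_le_limsup hev).trans ((limsup_add_le_add _ _).trans ?_)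
      have h0 := htr.add hhead
      rw [add_zero] at h0
      rw [h0.limsup_eq, zero_add]
      refine (limsup_add_le_add _ _).trans ?_
      rw [limsup_const]
      gcongr
      refine hlimO.trans ?_
      gcongr
      exact le_rfl
    have hcont : Tendsto (fun L' : ℝ≥0∞ => P.D S * (L + L') + P.DH S * (ENNReal.ofReal P.ε * m))
        (𝓝[>] 0) (𝓝 (P.D S * (L + 0) + P.DH S * (ENNReal.ofReal P.ε * m))) := by
      refine Tendsto.add (ENNReal.Tendsto.const_mul ?_ (Or.inr (h.D_lt_top hP).ne))
        tendsto_const_nhds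
      exact ((continuous_const.add continuous_id).tendsto 0).mono_left nhdsWithin_le_nhds
    rw [add_zero] at hcont
    refine ge_of_tendsto hcont ?_
    have h2 : ∀ᶠ η : ℝ≥0∞ in 𝓝[>] 0, η < 1 := nhdsWithin_le_nhds (Iio_mem_nhds one_pos)
    filter_upwards [self_mem_nhdsWithin, h2] with η hη hη1
    exact hstep _ (ENNReal.lt_add_right htop (ne_of_gt hη))
      (ENNReal.add_ne_top.2 ⟨htop, (hη1.trans ENNReal.one_lt_top).ne⟩)
  exact hfin.trans (by gcongr)

end IsStep
end Plant
namespace Plant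

/-! ### The iteration -/

variable {Z : Type*} [NormedAddCommGroup Z] [InnerProductSpace ℝ Z] [CompleteSpace Z]
  {P : Plant Z} {S : C0Semigroup P.X}

lemma Assumptions.out_ι_zero (hP : P.Assumptions) : P.out (P.ι 0) = 0 := by
  have := hP.out_ι_negPow 0
  rwa [map_zero, map_zero] at this

lemma Assumptions.continuousOn_out (hP : P.Assumptions) {y : ℝ → Z}
    (hy : ContinuousInto P.T P.sc y) : ContinuousOn (fun t => P.out (P.ι (y t))) (Ici 0) := by
  obtain ⟨v, hv, hyv⟩ := hy
  refine (hP.outBase.continuous.comp_continuousOn hv).congr fun t ht => ?_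
  rw [hyv t ht, hP.out_ι_negPow]
  rfl

/-- f is Lipschitz only for the Z^{s_1} norm, so continuity is available after lifting the argument
through (-A)^{-s_1}. -/
lemma Assumptions.continuous_f_negPow (hP : P.Assumptions) :
    Continuous fun v => P.f (negPow P.T P.s1 v) := by
  have h1 : LipschitzWith P.ε.toNNReal fun v => P.f (negPow P.T P.s1 v) := by
    intro v w
    rw [edist_eq_enorm_sub, edist_eq_enorm_sub]
    refine (hP.f_lipschitz _ _).trans ?_
    rw [← map_sub]
    rw [ENNReal.ofReal]
    gcongr
    exact posNorm_negPow_le _ _ _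
  exact h1.continuous

namespace IsIteration

variable {r d : ℝ → ℝ} {z₀ : Z} {n : ℕ} {z : ℕ → ℝ → Z}

lemma cont_s1 (hz : P.IsIteration S r d z₀ n z) {j : ℕ} (hj : j ≤ n) :
    ContinuousInto P.T P.s1 (z j) := by
  rcases j.eq_zero_or_pos with rfl | h
  exacts [hz.zero.cont_s1, (hz.succ j h hj).cont_s1]

lemma cont_sc (hz : P.IsIteration S r d z₀ n z) {j : ℕ} (hj : j ≤ n) :
    ContinuousInto P.T P.sc (z j) := by
  rcases j.eq_zero_or_pos with rfl | h
  exacts [hz.zero.cont_sc, (hz.succ j h hj).cont_sc]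

lemma continuousOn_err (hz : P.IsIteration S r d z₀ n z) (hP : P.Assumptions)
    (hr : ContinuousOn r (Ici 0)) {j : ℕ} (hj : j ≤ n) : ContinuousOn (P.err r z j) (Ici 0) := by
  induction j with
  | zero => exact hr.sub (hP.continuousOn_out (hz.cont_sc hj))
  | succ j ih => exact (ih (by omega)).sub (hP.continuousOn_out (hz.cont_sc hj))

lemma state_zero (hz : P.IsIteration S r d z₀ n z) (hP : P.Assumptions) : z 0 0 = z₀ := by
  have h1 := hz.zero.formula 0 le_rfl
  rw [intervalIntegral.integral_same, add_zero, S.op_zero_apply] at h1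
  exact hP.ι_injective h1

lemma state_succ_zero (hz : P.IsIteration S r d z₀ n z) (hP : P.Assumptions) {j : ℕ}
    (hj : j + 1 ≤ n) : z (j + 1) 0 = 0 := by
  have h1 := (hz.succ (j + 1) (by omega) hj).formula 0 le_rfl
  rw [intervalIntegral.integral_same, add_zero, S.op_zero_apply] at h1
  exact hP.ι_injective h1

/-- Compatibility of the initial state makes e_0 vanish at time 0, and later corrections start from
0. Hence the transient K(t)e_{n-1}(0) disappears. -/
lemma err_zero (hz : P.IsIteration S r d z₀ n z) (hP : P.Assumptions)
    (h0 : P.out (P.ι z₀) = r 0) {j : ℕ} (hj : j ≤ n) : P.err r z j 0 = 0 := by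
  induction j with
  | zero => rw [err, hz.state_zero hP, h0, sub_self]
  | succ j ih => rw [err, ih (by omega), hz.state_succ_zero hP hj, hP.out_ι_zero, sub_zero]

lemma continuousOn_f_partialSum (hz : P.IsIteration S r d z₀ n z) (hP : P.Assumptions) {j : ℕ}
    (hj : j ≤ n) : ContinuousOn (fun t => P.f (partialSum z j t)) (Ici 0) := by
  have h1 : ∀ i, ∃ v : ℝ → Z, i ≤ n → ContinuousOn v (Ici 0) ∧
      ∀ t : ℝ, 0 ≤ t → z i t = negPow P.T P.s1 (v t) := by
    intro i
    by_cases hi : i ≤ n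
    · obtain ⟨v, hv⟩ := hz.cont_s1 hi
      exact ⟨v, fun _ => hv⟩
    · exact ⟨0, fun h => absurd h hi⟩
  choose v hv using h1
  have h2 : ContinuousOn (fun t => ∑ i ∈ Finset.range (j + 1), v i t) (Ici 0) :=
    continuousOn_finsetSum _ fun i hi => (hv i (by
      have := Finset.mem_range.1 hi; omega)).1
  refine (hP.continuous_f_negPow.comp_continuousOn h2).congr fun t ht => ?_
  simp only [Function.comp, partialSum, map_sum]
  congr 1
  refine Finset.sum_congr rfl fun i hi => (hv i (by
    have := Finset.mem_range.1 hi; omega)).2 t ht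

lemma isStep (hz : P.IsIteration S r d z₀ n z) (hP : P.Assumptions)
    (hr : ContinuousOn r (Ici 0)) {j : ℕ} (hj : j + 1 ≤ n) :
    IsStep P S (P.err r z j) (P.Fterm z (j + 1)) (z (j + 1)) where
  e_cont := hz.continuousOn_err hP hr (by omega)
  F_cont := (hz.continuousOn_f_partialSum hP hj).sub
    (hz.continuousOn_f_partialSum hP (by omega))
  F_le t := by
    refine (hP.f_lipschitz _ _).trans_eq ?_
    -- Consecutive partial sums differ by exactly the new state.
    congr 2
    rw [Nat.add_sub_cancel, partialSum, partialSum, Finset.sum_range_succ, add_sub_cancel_left]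
  y_bdd t := by
    obtain ⟨v, hv, hyv⟩ := hz.cont_s1 hj
    obtain ⟨C, hC⟩ := isCompact_Icc.exists_bound_of_continuousOn
      (hv.mono (Icc_subset_Ici_self : Icc 0 t ⊆ Ici 0))
    refine ⟨ENNReal.ofReal C, ENNReal.ofReal_ne_top, fun τ hτ => ?_⟩
    rw [hyv τ hτ.1]
    refine (posNorm_negPow_le _ _ _).trans ?_
    rw [← ofReal_norm]
    exact ENNReal.ofReal_le_ofReal (hC τ hτ)
  formula t ht := by
    have h1 := (hz.succ (j + 1) (by omega) hj).formula t ht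
    rwa [ι_zero, map_zero, zero_add] at h1

end IsIteration
end Plant
end GeomReg
end

theorem mainTheorem4 {Z : Type*} [NormedAddCommGroup Z] [InnerProductSpace ℝ Z] [CompleteSpace Z]
    (P : GeomReg.Plant Z) (hP : P.Assumptions)
    (S : GeomReg.C0Semigroup P.X) (hS : S.generatorGraph = P.AβGraph) (hSstable : S.ExpStable)
    (r d : ℝ → ℝ) (hr : ContinuousOn r (Ici 0)) (hd : ContinuousOn d (Ici 0))
    (z₀ : Z) (n : ℕ) (hn : 1 ≤ n) (z : ℕ → ℝ → Z) (hz : P.IsIteration S r d z₀ n z) :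
    (P.D S < ∞ ∧ P.DH S < ∞) ∧
    (∀ t : ℝ, 0 < t → ContDiffOn ℝ 1 (P.err r z (n - 1)) (Ioo 0 t) →
      ENNReal.ofReal P.ε * P.DA S (Ioo 0 t) < 1 →
      (GeomReg.supNorm t (fun τ => P.err r z n τ - P.K S τ * P.err r z (n - 1) 0)
          ≤ (P.D S + P.DD S (Ioo 0 t)) * GeomReg.supNormOne t (P.err r z (n - 1))) ∧
      (P.out (P.ι z₀) = r 0 →
        GeomReg.supNorm t (P.err r z n)
          ≤ (P.D S + P.DD S (Ioo 0 t)) * GeomReg.supNormOne t (P.err r z (n - 1)))) ∧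
    (ContDiffOn ℝ 1 (P.err r z (n - 1)) (Ioi 0) →
      P.DB S (Ioi 0) < ∞ → ENNReal.ofReal P.ε * P.DA S (Ioi 0) < 1 →
      limsup (fun t => ‖P.err r z n t‖ₑ) atTop
        ≤ (P.D S + P.DD S (Ioi 0)) *
          limsup (fun t => max ‖P.err r z (n - 1) t‖ₑ ‖deriv (P.err r z (n - 1)) t‖ₑ) atTop) := by
  obtain ⟨k, O, κ, J, h⟩ := hP.exists_isOutput hS hSstable
  -- With n = m + 1 the new error is, by definition, the old one minus the output of the new state,
  -- so the one-step estimates apply verbatim.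
  obtain ⟨m, rfl⟩ : ∃ m, n = m + 1 := ⟨n - 1, by omega⟩
  rw [Nat.add_sub_cancel]
  have hs := hz.isStep hP hr le_rfl
  refine ⟨⟨h.D_lt_top hP, h.DH_lt_top⟩, fun t _ hC hA => ?_, fun hC hB hA =>
    hs.limsup_error_le h hP hC hB hA⟩
  have h1 := hs.supNorm_error_le h hP hC hA
  refine ⟨h1, fun h0 => ?_⟩
  rw [hz.err_zero hP h0 (Nat.le_succ m)] at h1
  simp only [mul_zero, sub_zero] at h1
  exact h1
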